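/- Let $(Z_n)_{n\ge 0}$ be a zero linear recurrence sequence: a nondecreasing sequence of positive integers with $Z_0=1$, $Z_n\to\infty$, satisfying $Z_{n+1}=c_1Z_n+c_2Z_{n-1}+\dots+c_LZ_{n+1-L}$ for all $n\ge L-1$, with integer coefficients and $c_1=0$. Assume that it has a dominant root $\lambda>1$: $\lambda$ is a simple root of $x^L-\sum_i c_ix^{L-i}$, all other complex roots have modulus less than $\lambda$, and, in case some $c_i$ is negative, $Z_n/\lambda^n\not\to0$ (if all $c_i\ge0$ nothing more is assumed). The greedy decomposition of $m\ge1$ is obtained by repeatedly subtracting the term $Z_j$ with the largest index $j$ such that $Z_j$ does not exceed the remainder; the digit of $m$ at $j$ is the number of times $Z_j$ is used. The microcanonical ensemble $\mathbb P_N$ is the law of the digit sequence $(x_0,x_1,\dots)$ of an integer $m$ chosen uniformly from $[Z_N,Z_{N+1})$, where $x_i$ is the digit at index $N-i$ for $i\le N$ and $x_i=0$ for $i>N$. A finite word, read towards decreasing indices, is admissible if it occurs as a block of consecutive digits of greedy decompositions at arbitrarily high indices; it is free if it may be followed by every admissible word (the result being admissible). A canonical ensemble is a shift-invariant probability measure $\mu$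 on $\mathbb N^{\mathbb N}$ such that almost surely all finite blocks are admissible, and such that for some constants $c,C>0$ every word of length $n$ has probability at most $C\lambda^{-n}$ as a prefix, and every free word of length $n$ has probability at least $c\lambda^{-n}$. Then there is exactly one canonical ensemble $\mu$, and limit laws under $\mu$ hold identically under the microcanonical ensembles, in the following sense. 1. (General limit laws.) Let $S$ be a metric space with its Borel $\sigma$-algebra, $T_n:\mathbb N^{\mathbb N}\to S$ measurable and $\nu$ a probability measure on $S$. Suppose that $(T_n)$ is insensitive to the boundary: for all $B,K\in\mathbb N$ and $\varepsilon>0$, the $\mu$-probability that there is a sequence $y$ with all digits at most $B$, equal to $x$ in the positions $K\le i\le n-K$, and with $d(T_n(x),T_n(y))>\varepsilon$, tends to $0$ as $n\to\infty$. If the law of $T_n$ under $\mu$ converges weakly to $\nu$, then the law of $T_N$ under $\mathbb P_N$ converges weakly to $\nu$. 2. (Central limit theorem and other laws for sums.) Let $f$ be a local statistic, i.e. a real function of $L$ consecutive digits, and $S_nf(x)=\sum_{i=0}^{n}f(x_i,\dots,x_{i+L-1})$. Let $a_n\in\mathbb R$, $b_n\to+\infty$ and $\nu$ a probability measure on $\mathbb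 R$. If $(S_nf-a_n)/b_n$ converges in law to $\nu$ under $\mu$, then $(S_Nf-a_N)/b_N$ under $\mathbb P_N$ converges in law to $\nu$. 3. (Law of large numbers.) If $S_nf/(n+1)\to c$ in probability under $\mu$, then $S_Nf/(N+1)\to c$ in probability under $\mathbb P_N$. 4. (Gap distribution.) For $g\ge0$ let $G_{g,n}$ be the number of gaps of length $g$ between consecutive summands (counted with multiplicity) in the positions $0,\dots,n$, and $G_n$ the total number of gaps. If $G_{g,n}/G_n\to p$ in probability under $\mu$, then $G_{g,N}/G_N\to p$ in probability under $\mathbb P_N$. If $\mathbb E_\mu[G_{g,n}]/\mathbb E_\mu[G_n]\to p$, then $\mathbb E_{\mathbb P_N}[G_{g,N}]/\mathbb E_{\mathbb P_N}[G_N]\to p$. -/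

import Mathlib

open Filter Topology MeasureTheory

noncomputable section

namespace ZLRR

/-! ### Zero linear recurrences and their greedy decompositions -/

/-- `Z` is a zero linear recurrence sequence with recurrence `E`.  Mathlib's `LinearRecurrence`
is `Z (n + L) = ∑ i, coeffs i * Z (n + i)`, so the coefficient `c₁` of the most recent term is
the one whose index `i` satisfies `i + 1 = L`.  `Z` is only required to be weakly increasing, so
that `1, 2, 3, 3, 5, 6, 8, 11, …` with `Z (n + 3) = Z (n + 1) + Z n` is included. -/
structure IsZLRR (E : LinearRecurrence ℤ) (Z : ℕ → ℕ) : Prop where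
  recurrence : E.IsSolution (fun n => (Z n : ℤ))
  leading_eq_zero : ∀ i : Fin E.order, (i : ℕ) + 1 = E.order → E.coeffs i = 0
  zero_eq_one : Z 0 = 1
  mono : Monotone Z
  tendsto : Tendsto Z atTop atTop

/-- `lam > 1` is the dominant root: a simple root of the characteristic polynomial, all other
complex roots having strictly smaller modulus.  When all coefficients are nonnegative the
`lam ^ n` term of `Z n` never vanishes; when some coefficient is negative, initial values could
kill that term (the sequence would then not see `lam` at all), which is excluded. -/
structure IsDominantRoot (E : LinearRecurrence ℤ) (Z : ℕ → ℕ) (lam : ℝ) : Prop where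
  one_lt : 1 < lam
  simple : (E.charPoly.map (Int.castRingHom ℂ)).rootMultiplicity (lam : ℂ) = 1
  dominant : ∀ z : ℂ, (E.charPoly.map (Int.castRingHom ℂ)).IsRoot z → z ≠ (lam : ℂ) → ‖z‖ < lam
  nondegenerate : (∃ i, E.coeffs i < 0) →
    ¬ Tendsto (fun n => (Z n : ℝ) / lam ^ n) atTop (𝓝 0)

/-- The largest index `j` with `Z j ≤ m`. -/
def topIndex (Z : ℕ → ℕ) (m : ℕ) : ℕ := sSup {j | Z j ≤ m}

/-- The indices `j₁, j₂, …` chosen by the greedy algorithm: repeatedly subtract the largest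
term `Z j` not exceeding what is left.  (`0 < Z _` always holds for the sequences considered;
it is there for termination only.) -/
def greedyIndices (Z : ℕ → ℕ) (m : ℕ) : List ℕ :=
  if _h : 0 < m ∧ 0 < Z (topIndex Z m) then
    topIndex Z m :: greedyIndices Z (m - Z (topIndex Z m))
  else []
termination_by m
decreasing_by omega

/-- The greedy digit of `m` at index `j`: how often `Z j` is used in the greedy decomposition. -/
def greedyDigit (Z : ℕ → ℕ) (m j : ℕ) : ℕ := (greedyIndices Z m).count j

/-- The greedy digits of `m` read downwards from index `N`, continued by zeros below index `0`.
For `m ∈ [Z N, Z (N + 1))` this is the whole greedy decomposition of `m`. -/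
def greedySeq (Z : ℕ → ℕ) (N m : ℕ) : ℕ → ℕ :=
  fun i => if i ≤ N then greedyDigit Z m (N - i) else 0

/-! ### The two ensembles, as measures on digit sequences read from the top -/

/-- The microcanonical ensemble: the law of the greedy digits of a uniformly chosen
`m ∈ [Z N, Z (N + 1))`. -/
def microcanonical (Z : ℕ → ℕ) (N : ℕ) : Measure (ℕ → ℕ) :=
  (ProbabilityTheory.uniformOn (Set.Ico (Z N) (Z (N + 1)))).map (greedySeq Z N)

/-- A word (read downwards) is admissible if it occurs as a block of consecutive digits of
greedy decompositions at arbitrarily high indices. -/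
def IsAdmissible (Z : ℕ → ℕ) {n : ℕ} (w : Fin n → ℕ) : Prop :=
  ∀ K : ℕ, ∃ j ≥ K, ∃ m : ℕ, ∀ t : Fin n, w t = greedyDigit Z m (j + (Fin.rev t : ℕ))

/-- An admissible word after which the greedy choices start afresh: every admissible word may
follow it. -/
def IsFree (Z : ℕ → ℕ) {n : ℕ} (w : Fin n → ℕ) : Prop :=
  ∀ (k : ℕ) (v : Fin k → ℕ), IsAdmissible Z v → IsAdmissible Z (Fin.append w v)

/-- An infinite greedy digit sequence: all its finite blocks are admissible. -/
def IsGreedySequence (Z : ℕ → ℕ) (x : ℕ → ℕ) : Prop :=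
  ∀ i n : ℕ, IsAdmissible Z (fun t : Fin n => x (i + t))

/-- The sequences beginning with the word `w`. -/
def prefixCylinder {n : ℕ} (w : Fin n → ℕ) : Set (ℕ → ℕ) := {x | ∀ t : Fin n, x t = w t}

/-- The canonical ensemble: a stationary probability measure on infinite greedy digit sequences
in which prefixes are weighted by the dominant root: a prefix of length `n` has probability of
the order of `lam ^ (-n)` (at most that order in general, and exactly that order when the prefix
puts no constraint on its continuation). -/
structure IsCanonical (Z : ℕ → ℕ) (lam : ℝ) (μ : Measure (ℕ → ℕ)) : Prop where
  isProbability : IsProbabilityMeasure μ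
  stationary : μ.map (fun x i => x (i + 1)) = μ
  greedy : ∀ᵐ x ∂μ, IsGreedySequence Z x
  weight : ∃ c C : ℝ, 0 < c ∧
    (∀ (n : ℕ) (w : Fin n → ℕ), μ.real (prefixCylinder w) ≤ C * (lam ^ n)⁻¹) ∧
    (∀ (n : ℕ) (w : Fin n → ℕ), IsFree Z w → c * (lam ^ n)⁻¹ ≤ μ.real (prefixCylinder w))

/-! ### Limit laws -/

/-- Convergence in law of `T n` under `P n` to `ν`. -/
def ConvergesInLaw {E : Type*} [TopologicalSpace E] [MeasurableSpace E]
    (P : ℕ → Measure (ℕ → ℕ)) (T : ℕ → (ℕ → ℕ) → E) (ν : Measure E) : Prop :=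
  ∀ g : BoundedContinuousFunction E ℝ,
    Tendsto (fun n => ∫ x, g (T n x) ∂(P n)) atTop (𝓝 (∫ y, g y ∂ν))

/-- Convergence in probability of `T n` under `P n` to the constant `c`. -/
def ConvergesInProb (P : ℕ → Measure (ℕ → ℕ)) (T : ℕ → (ℕ → ℕ) → ℝ) (c : ℝ) : Prop :=
  ∀ ε > 0, Tendsto (fun n => P n {x | ε ≤ |T n x - c|}) atTop (𝓝 0)

/-- `T n`, viewed as a statistic of the digits in positions `0, …, n`, does not asymptotically
depend on boundedly many digits at either end: with `μ`-probability tending to `1`, arbitrary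
changes (by digits at most `B`) outside the positions `K ≤ i ≤ n - K` move `T n` by at
most `ε`. -/
def BoundaryInsensitive {E : Type*} [PseudoMetricSpace E] (μ : Measure (ℕ → ℕ))
    (T : ℕ → (ℕ → ℕ) → E) : Prop :=
  ∀ B K : ℕ, ∀ ε > 0, Tendsto
    (fun n => μ {x | ∃ y : ℕ → ℕ, (∀ i, y i ≤ B) ∧ (∀ i, K ≤ i → i + K ≤ n → y i = x i) ∧
      ε < dist (T n x) (T n y)}) atTop (𝓝 0)

/-- The sum of a local statistic `f` (a function of `L` consecutive digits) over the windows
starting at the positions `0, …, n`. -/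
def localSum {L : ℕ} (f : (Fin L → ℕ) → ℝ) (n : ℕ) (x : ℕ → ℕ) : ℝ :=
  ∑ i ∈ Finset.range (n + 1), f (fun t => x (i + t))

/-- The positions of the summands among the positions `0, …, n`, with multiplicity, in order. -/
def summandPositions (n : ℕ) (x : ℕ → ℕ) : List ℕ :=
  (List.range (n + 1)).flatMap fun i => List.replicate (x i) i

/-- The list of gaps between consecutive summands among the positions `0, …, n`. -/
def gaps (n : ℕ) (x : ℕ → ℕ) : List ℕ :=
  List.zipWith (fun a b => b - a) (summandPositions n x) (summandPositions n x).tail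

/-- The number of gaps of length `g`. -/
def gapCount (g n : ℕ) (x : ℕ → ℕ) : ℝ := ((gaps n x).count g : ℝ)

/-- The total number of gaps. -/
def gapTotal (n : ℕ) (x : ℕ → ℕ) : ℝ := ((gaps n x).length : ℝ)

end ZLRR

end

/-! Up to boundary effects, greedy digits are digits of real numbers in base λ. Let T x = λx mod 1
be the beta-transformation. Since Z_n = aλ^n + O(r^n) with 1 < r < λ (`IsZLRR.exists_asymptotics`),
the number of greedy continuations of a word (`intRoom`) and the rescaled length of the interval of
reals whose expansion begins with it (`realRoom`) satisfy the same recursion, with Z_n in place of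
λ^n.

The canonical ensemble is `betaMeasure`, the digit law of Parry's T-invariant measure, whose density
is proportional to Σ λ^(-n) 1_[0, T^n 1). This density lies between two positive constants, which
gives the required weights. For uniqueness, let μ be canonical. A word with little room can only be
continued by zeros, so the upper bound on prefixes sharpens to a constant times Lebesgue measure
(`IsCanonical.prefixSet_le`). Hence μ is absolutely continuous with respect to `betaMeasure`, and
ergodicity forces equality.

The microcanonical ensemble, whose leading digit is nonzero, is compared with Lebesgue measure on
[1/λ, 1). The two rooms agree up to a small relative error unless the orbit comes very close to 1,
and the closeness that matters is noticeable only near the end of the word (`intRoom_ge`). Dropping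
the last K digits therefore makes the exceptional set small. Dropping the first K digits replaces
Lebesgue measure by Parry's measure, because Lebesgue measure converges to it in total variation
under T. This exactness comes from a renewal argument (`exists_forall_renewal_lt`). Together, the
digits in positions K to N - K have nearly the same law in total variation in both ensembles
(`exists_forall_abs_microcanonical_sub_le`).

Limit laws then transfer: a statistic insensitive to the ends may be evaluated on the middle digits
alone. Local sums and gap counts change by a bounded amount when the ends change, so after
normalization they are insensitive. Expected gap counts are compared after division by N + 1. -/

noncomputable section

namespace ZLRR

section

/-! ### Asymptotics of the sequence -/

/-- The shift operator on complex sequences. -/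
def seqShift : Module.End ℂ (ℕ → ℂ) := LinearMap.funLeft ℂ ℂ Nat.succ

theorem seqShift_apply (u : ℕ → ℂ) (n : ℕ) : seqShift u n = u (n + 1) := rfl

theorem seqShift_pow_apply (k : ℕ) (u : ℕ → ℂ) (n : ℕ) : (seqShift ^ k) u n = u (n + k) := by
  induction k generalizing n with
  | zero => simp
  | succ k ih =>
    rw [pow_succ', Module.End.mul_apply, seqShift_apply, ih]
    congr 1; ring

/-- The bound propagates by induction as soon as C + ‖z‖ C' ≤ r C', which dictates the choice C' ≥ C
/ (r - ‖z‖). -/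
theorem growth_of_shift_sub {r C : ℝ} (hr : 0 < r) {z : ℂ} (hz : ‖z‖ < r) {u : ℕ → ℂ}
    (h : ∀ n, ‖u (n + 1) - z * u n‖ ≤ C * r ^ n) : ∃ C', ∀ n, ‖u n‖ ≤ C' * r ^ n := by
  refine ⟨max ‖u 0‖ (C / (r - ‖z‖)), fun n => ?_⟩
  set C' := max ‖u 0‖ (C / (r - ‖z‖))
  have hC : C ≤ C' * (r - ‖z‖) := by
    rw [← div_le_iff₀ (by linarith)]; exact le_max_right _ _
  induction n with
  | zero => rw [pow_zero, mul_one]; exact le_max_left _ _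
  | succ n ih =>
    calc ‖u (n + 1)‖ = ‖(u (n + 1) - z * u n) + z * u n‖ := by ring_nf
      _ ≤ C * r ^ n + ‖z‖ * (C' * r ^ n) := by
        refine (norm_add_le _ _).trans (add_le_add (h n) ?_)
        rw [norm_mul]; gcongr
      _ ≤ (C' * (r - ‖z‖)) * r ^ n + ‖z‖ * (C' * r ^ n) := by gcongr
      _ = C' * r ^ (n + 1) := by ring

/-- The linear factors are stripped off one root at a time with `growth_of_shift_sub`; this avoids
solving the recurrence explicitly and treats multiple roots like simple ones. -/
theorem growth_of_aeval_prod {r : ℝ} (hr : 0 < r) (s : Multiset ℂ) (hs : ∀ z ∈ s, ‖z‖ < r)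
    (u : ℕ → ℂ)
    (h : ∃ C, ∀ n, ‖(Polynomial.aeval seqShift
      (s.map fun z => Polynomial.X - Polynomial.C z).prod) u n‖ ≤ C * r ^ n) :
    ∃ C, ∀ n, ‖u n‖ ≤ C * r ^ n := by
  induction s using Multiset.induction_on generalizing u with
  | empty => simpa using h
  | cons z s ih =>
    obtain ⟨C, hC⟩ := h
    refine ih (fun w hw => hs w (Multiset.mem_cons_of_mem hw)) u ?_
    refine growth_of_shift_sub hr (hs z (Multiset.mem_cons_self z s)) (C := C) fun n => ?_
    convert hC n using 2
    rw [Multiset.map_cons, Multiset.prod_cons, map_mul, Module.End.mul_apply]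
    simp [seqShift_apply]

/-- The requirement 1 < r is there for `intRoom_ge`, where the errors r ^ u are summed as a
convergent series in r⁻¹. -/
theorem exists_between_roots (s : Multiset ℂ) {lam : ℝ} (h1 : 1 < lam) (hs : ∀ z ∈ s, ‖z‖ < lam) :
    ∃ r, 1 < r ∧ r < lam ∧ ∀ z ∈ s, ‖z‖ < r := by
  induction s using Multiset.induction_on with
  | empty =>
    obtain ⟨r, h⟩ := exists_between h1
    exact ⟨r, h.1, h.2, by simp⟩
  | cons z s ih =>
    obtain ⟨r, hr1, hr2, hr⟩ := ih fun w hw => hs w (Multiset.mem_cons_of_mem hw)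
    obtain ⟨q, hq⟩ := exists_between (hs z (Multiset.mem_cons_self z s))
    refine ⟨max r q, lt_max_of_lt_left hr1, max_lt hr2 hq.2, fun w hw => ?_⟩
    rcases Multiset.mem_cons.1 hw with rfl | hw
    · exact lt_max_of_lt_right hq.1
    · exact lt_max_of_lt_left (hr w hw)

variable {E : LinearRecurrence ℤ} {Z : ℕ → ℕ} {lam : ℝ}

theorem IsZLRR.one_le (hZ : IsZLRR E Z) (n : ℕ) : 1 ≤ Z n :=
  hZ.zero_eq_one ▸ hZ.mono (Nat.zero_le n)

theorem IsZLRR.aeval_charPoly (hZ : IsZLRR E Z) :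
    Polynomial.aeval seqShift (E.charPoly.map (Int.castRingHom ℂ)) (fun n => (Z n : ℂ)) = 0 := by
  funext n
  have h := congrArg (Int.cast : ℤ → ℂ) (hZ.recurrence n)
  simp only [LinearRecurrence.charPoly, Polynomial.map_sub, Polynomial.map_sum,
    Polynomial.map_monomial, map_sub, map_sum, Polynomial.aeval_monomial, LinearMap.sub_apply,
    Pi.sub_apply, LinearMap.sum_apply, Finset.sum_apply, Module.End.mul_apply,
    Module.algebraMap_end_apply, Pi.smul_apply, seqShift_pow_apply, Pi.zero_apply, smul_eq_mul]
  push_cast at h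
  simp [h]

theorem IsDominantRoot.pow_order_eq (hlam : IsDominantRoot E Z lam) :
    lam ^ E.order = ∑ i, (E.coeffs i : ℝ) * lam ^ (i : ℕ) := by
  have h : (E.charPoly.map (Int.castRingHom ℂ)).IsRoot (lam : ℂ) := by
    have := hlam.simple
    by_contra hne
    rw [Polynomial.rootMultiplicity_eq_zero hne] at this
    omega
  rw [Polynomial.IsRoot.def, LinearRecurrence.charPoly] at h
  simp only [Polynomial.map_sub, Polynomial.map_sum, Polynomial.map_monomial,
    Polynomial.eval_sub, Polynomial.eval_finsetSum, Polynomial.eval_monomial] at h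
  rw [sub_eq_zero] at h
  have h2 : ((lam ^ E.order : ℝ) : ℂ) = ((∑ i, (E.coeffs i : ℝ) * lam ^ (i : ℕ) : ℝ) : ℂ) := by
    push_cast
    simpa using h
  exact_mod_cast h2

/-- The powers of `lam` satisfy the same recurrence, and nonnegative coefficients preserve the
inequality; the factor `lam ^ E.order` makes it true for the initial values, which are at least 1.
-/
theorem IsZLRR.le_mul_of_coeffs_nonneg (hZ : IsZLRR E Z) (hlam : IsDominantRoot E Z lam)
    (h0 : ∀ i, 0 ≤ E.coeffs i) (n : ℕ) : lam ^ n ≤ lam ^ E.order * Z n := by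
  have h1 := hlam.one_lt
  induction n using Nat.strong_induction_on with
  | _ n ih =>
    rcases lt_or_ge n E.order with hn | hn
    · have hz : (1 : ℝ) ≤ Z n := by exact_mod_cast hZ.one_le n
      calc lam ^ n ≤ lam ^ E.order := pow_le_pow_right₀ h1.le hn.le
        _ ≤ lam ^ E.order * Z n := le_mul_of_one_le_right (by positivity) hz
    · obtain ⟨k, rfl⟩ := Nat.exists_eq_add_of_le' hn
      have h := congrArg (Int.cast : ℤ → ℝ) (hZ.recurrence k)
      push_cast at h
      rw [h, pow_add, Finset.mul_sum]
      nth_rewrite 1 [hlam.pow_order_eq]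
      rw [Finset.mul_sum]
      refine Finset.sum_le_sum fun i _ => ?_
      have hi := ih (k + i) (by omega)
      have hc : (0 : ℝ) ≤ E.coeffs i := by exact_mod_cast h0 i
      calc lam ^ k * (E.coeffs i * lam ^ (i : ℕ)) = E.coeffs i * lam ^ (k + i) := by ring
        _ ≤ E.coeffs i * (lam ^ E.order * Z (k + i)) := by gcongr
        _ = _ := by ring

/-- The recurrence sequence is `a * lam ^ n` up to an exponentially smaller error. -/
theorem IsZLRR.exists_asymptotics (hZ : IsZLRR E Z) (hlam : IsDominantRoot E Z lam) :
    ∃ a C r : ℝ, 0 < a ∧ 0 < C ∧ 1 < r ∧ r < lam ∧ ∀ n, |(Z n : ℝ) - a * lam ^ n| ≤ C * r ^ n := by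
  have h1 := hlam.one_lt
  have h0 : 0 < lam := by linarith
  set P := E.charPoly.map (Int.castRingHom ℂ) with hP
  have hPm : P.Monic := (E.charPoly_monic).map _
  -- Write the characteristic polynomial as (X - lam) q. Simplicity of the root leaves q with roots
  -- of modulus below `lam` only, and q annihilates Y n = Z (n + 1) - lam * Z n, so Y n = O(r ^ n).
  obtain ⟨q, hq, hqd⟩ := Polynomial.exists_eq_pow_rootMultiplicity_mul_and_not_dvd P hPm.ne_zero
    (lam : ℂ)
  rw [hlam.simple, pow_one] at hq
  have hqm : q.Monic := (Polynomial.monic_X_sub_C (lam : ℂ)).of_mul_monic_left (hq ▸ hPm)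
  have hroots : ∀ z ∈ q.roots, ‖z‖ < lam := by
    intro z hz
    have hz' := Polynomial.isRoot_of_mem_roots hz
    refine hlam.dominant z ?_ ?_
    · rw [← hP, hq]; exact Polynomial.root_mul_left_of_isRoot _ hz'
    · rintro rfl
      exact hqd (Polynomial.dvd_iff_isRoot.2 hz')
  obtain ⟨r, hr1, hr2, hr⟩ := exists_between_roots q.roots h1 hroots
  have hr0 : 0 < r := by linarith
  set u : ℕ → ℂ := fun n => (Z n : ℂ) with hu
  set Y : ℕ → ℂ := Polynomial.aeval seqShift (Polynomial.X - Polynomial.C (lam : ℂ)) u with hY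
  have hqY : Polynomial.aeval seqShift q Y = 0 := by
    rw [hY, ← Module.End.mul_apply, ← map_mul, mul_comm, ← hq]
    exact hZ.aeval_charPoly
  obtain ⟨C, hC⟩ := growth_of_aeval_prod hr0 q.roots hr Y ⟨0, fun n => by
    rw [← (IsAlgClosed.splits q).eq_prod_roots_of_monic hqm, hqY]; simp⟩
  have hYn : ∀ n, ‖Y n‖ = |(Z (n + 1) : ℝ) - lam * Z n| := by
    intro n
    have : Y n = (((Z (n + 1) : ℝ) - lam * Z n : ℝ) : ℂ) := by
      simp [hY, hu, seqShift_apply]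
    rw [this, Complex.norm_real, Real.norm_eq_abs]
  have hrl : r / lam < 1 := (div_lt_one h0).2 hr2
  -- The quotients Z n / lam ^ n move by at most a geometric amount, so they converge to some a with
  -- a geometric rate; this rate is the error term.
  have hstep : ∀ n, dist ((Z n : ℝ) / lam ^ n) ((Z (n + 1) : ℝ) / lam ^ (n + 1))
      ≤ C / lam * (r / lam) ^ n := by
    intro n
    have hn := hC n
    rw [hYn] at hn
    rw [dist_comm, Real.dist_eq]
    have : (Z (n + 1) : ℝ) / lam ^ (n + 1) - Z n / lam ^ n
        = (Z (n + 1) - lam * Z n) / lam ^ (n + 1) := by field_simp; ring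
    rw [this, abs_div, abs_of_pos (by positivity : 0 < lam ^ (n + 1)), div_pow, div_mul_div_comm,
      ← pow_succ']
    gcongr
  obtain ⟨a, ha⟩ := cauchySeq_tendsto_of_complete (cauchySeq_of_le_geometric _ _ hrl hstep)
  have hbound := dist_le_of_le_geometric_of_tendsto _ _ hrl hstep ha
  -- With a negative coefficient this is the nondegeneracy assumption; otherwise the quotients are
  -- bounded below by `le_mul_of_coeffs_nonneg`.
  have ha0 : a ≠ 0 := by
    rintro rfl
    by_cases hneg : ∃ i, E.coeffs i < 0
    · exact hlam.nondegenerate hneg ha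
    · push Not at hneg
      have h3 : ∀ n, (lam ^ E.order)⁻¹ ≤ (Z n : ℝ) / lam ^ n := by
        intro n
        have := hZ.le_mul_of_coeffs_nonneg hlam hneg n
        rw [inv_le_iff_one_le_mul₀ (by positivity), mul_comm, ← mul_div_assoc,
          one_le_div (by positivity)]
        exact this
      have := ge_of_tendsto' ha h3
      have : 0 < (lam ^ E.order)⁻¹ := by positivity
      linarith
  have ha1 : 0 ≤ a := ge_of_tendsto' ha fun n => by positivity
  have hC0 : 0 ≤ C := by simpa using (norm_nonneg _).trans (hC 0)
  refine ⟨a, C / lam / (1 - r / lam) + 1, r, lt_of_le_of_ne ha1 ha0.symm, ?_, hr1, hr2, fun n => ?_⟩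
  · have : 0 < 1 - r / lam := by linarith
    positivity
  · have hb := hbound n
    rw [Real.dist_eq] at hb
    have h4 : (Z n : ℝ) - a * lam ^ n = (Z n / lam ^ n - a) * lam ^ n := by field_simp
    rw [h4, abs_mul, abs_of_pos (by positivity : 0 < lam ^ n)]
    calc |(Z n : ℝ) / lam ^ n - a| * lam ^ n
        ≤ (C / lam * (r / lam) ^ n / (1 - r / lam)) * lam ^ n := by gcongr
      _ = C / lam / (1 - r / lam) * r ^ n := by rw [div_pow]; field_simp
      _ ≤ (C / lam / (1 - r / lam) + 1) * r ^ n := by gcongr; linarith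

end

section

variable {E : LinearRecurrence ℤ} {Z : ℕ → ℕ} {lam : ℝ}

/-! ### Greedy digits -/

theorem topIndex_eq (hZ : IsZLRR E Z) {j m : ℕ} (h1 : Z j ≤ m) (h2 : m < Z (j + 1)) :
    topIndex Z m = j := by
  have : {i | Z i ≤ m} = Set.Iic j := by
    ext i
    refine ⟨fun hi => ?_, fun hi => (hZ.mono hi).trans h1⟩
    by_contra hij
    exact absurd ((hZ.mono (Nat.succ_le_of_lt (not_le.1 hij))).trans hi) (not_le.2 h2)
  rw [topIndex, this, csSup_Iic]

theorem greedyIndices_zero : greedyIndices Z 0 = [] := by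
  rw [greedyIndices]; simp

theorem greedyIndices_mul_add (hZ : IsZLRR E Z) {j d r : ℕ} (h : d * Z j + r < Z (j + 1)) :
    greedyIndices Z (d * Z j + r) = List.replicate d j ++ greedyIndices Z r := by
  have hj := hZ.one_le j
  induction d with
  | zero => simp
  | succ d ih =>
    have hle : Z j ≤ (d + 1) * Z j + r := by nlinarith
    have htop := topIndex_eq hZ hle h
    have hsub : (d + 1) * Z j + r - Z j = d * Z j + r := by
      rw [add_mul, one_mul]; omega
    rw [greedyIndices, dif_pos ⟨by omega, by rw [htop]; omega⟩, htop, hsub, ih (by omega),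
      List.replicate_succ, List.cons_append]

theorem greedyIndices_eq_mod (hZ : IsZLRR E Z) {n m : ℕ} (h : m < Z (n + 1)) :
    greedyIndices Z m = List.replicate (m / Z n) n ++ greedyIndices Z (m % Z n) := by
  rw [← greedyIndices_mul_add hZ, mul_comm, Nat.div_add_mod]
  rwa [mul_comm, Nat.div_add_mod]

theorem lt_of_mem_greedyIndices (hZ : IsZLRR E Z) {n m : ℕ} (h : m < Z n) {i : ℕ}
    (hi : i ∈ greedyIndices Z m) : i < n := by
  induction n generalizing m with
  | zero =>
    obtain rfl : m = 0 := by rw [hZ.zero_eq_one] at h; omega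
    simp [greedyIndices_zero] at hi
  | succ n ih =>
    rw [greedyIndices_eq_mod hZ h, List.mem_append] at hi
    rcases hi with hi | hi
    · rw [List.eq_of_mem_replicate hi]; omega
    · have := ih (Nat.mod_lt _ (hZ.one_le n)) hi
      omega

theorem greedyDigit_eq_zero (hZ : IsZLRR E Z) {n m j : ℕ} (h : m < Z n) (hj : n ≤ j) :
    greedyDigit Z m j = 0 :=
  List.count_eq_zero.2 fun hi => absurd (lt_of_mem_greedyIndices hZ h hi) (by omega)

theorem greedyDigit_top (hZ : IsZLRR E Z) {n m : ℕ} (h : m < Z (n + 1)) :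
    greedyDigit Z m n = m / Z n := by
  have := greedyDigit_eq_zero hZ (Nat.mod_lt m (hZ.one_le n)) le_rfl
  rw [greedyDigit] at this ⊢
  rw [greedyIndices_eq_mod hZ h, List.count_append, List.count_replicate_self, this, add_zero]

theorem greedyDigit_mod (hZ : IsZLRR E Z) {n m j : ℕ} (h : m < Z (n + 1)) (hj : j < n) :
    greedyDigit Z m j = greedyDigit Z (m % Z n) j := by
  rw [greedyDigit, greedyIndices_eq_mod hZ h, List.count_append, List.count_replicate,
    if_neg (by simpa using hj.ne'), zero_add, greedyDigit]

theorem IsZLRR.exists_lt (hZ : IsZLRR E Z) (m n : ℕ) : ∃ k, m < Z (n + k) := by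
  obtain ⟨N, hN⟩ := (hZ.tendsto.eventually_gt_atTop m).exists
  exact ⟨N, hN.trans_le (hZ.mono (Nat.le_add_left _ _))⟩

/-- The digits of `m` below `n` are the digits of an integer below `Z n`. -/
theorem exists_lt_forall_greedyDigit_eq (hZ : IsZLRR E Z) (m n : ℕ) :
    ∃ m' < Z n, ∀ j < n, greedyDigit Z m j = greedyDigit Z m' j := by
  obtain ⟨k, hk⟩ := hZ.exists_lt m n
  induction k generalizing m with
  | zero => exact ⟨m, hk, fun _ _ => rfl⟩
  | succ k ih =>
    obtain ⟨m', hm', h⟩ := ih (m % Z (n + k)) (Nat.mod_lt _ (hZ.one_le _))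
    exact ⟨m', hm', fun j hj => (greedyDigit_mod hZ hk (hj.trans_le (Nat.le_add_right n k))).trans (h j hj)⟩

theorem sum_greedyDigit (hZ : IsZLRR E Z) {n m N : ℕ} (hn : n ≤ N + 1) (hm : m < Z (N + 1)) :
    ∑ k ∈ Finset.range n, greedyDigit Z m (N - k) * Z (N - k) ≤ m := by
  induction N generalizing n m with
  | zero =>
    interval_cases n
    · simp
    · simp only [Finset.sum_range_one, Nat.sub_self]
      rw [greedyDigit_top hZ hm]
      exact Nat.div_mul_le_self _ _
  | succ N ih =>
    rcases n with _ | n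
    · simp
    · rw [Finset.sum_range_succ', Nat.sub_zero, greedyDigit_top hZ hm]
      have h1 := ih (n := n) (m := m % Z (N + 1)) (by omega) (Nat.mod_lt _ (hZ.one_le _))
      have h2 : ∑ k ∈ Finset.range n, greedyDigit Z m (N + 1 - (k + 1)) * Z (N + 1 - (k + 1))
          = ∑ k ∈ Finset.range n, greedyDigit Z (m % Z (N + 1)) (N - k) * Z (N - k) := by
        refine Finset.sum_congr rfl fun k _ => ?_
        rw [Nat.add_sub_add_right, greedyDigit_mod hZ hm (by omega)]
      rw [h2]
      have := Nat.div_add_mod' m (Z (N + 1))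
      omega

/-- The number of ways to continue the word `x 0, …, x (k - 1)`, placed at the indices
`N, N - 1, …`, to the greedy digits of an integer (if this is positive). -/
def intRoom (Z : ℕ → ℕ) (N : ℕ) (x : ℕ → ℕ) : ℕ → ℝ
  | 0 => Z (N + 1)
  | k + 1 => min (Z (N - k)) (intRoom Z N x k - x k * Z (N - k))

theorem intRoom_le (N : ℕ) (x : ℕ → ℕ) {k : ℕ} (hk : k ≤ N + 1) :
    intRoom Z N x k ≤ Z (N + 1 - k) := by
  rcases k with _ | k
  · simp [intRoom]
  · rw [Nat.add_sub_add_right]; exact min_le_left _ _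

/-- The two entries of the minimum in `intRoom` say that the remainder is below the current term, so
that division recovers the digit, and that digit and remainder together fit into the previous room.
-/
theorem greedyDigit_sum_add (hZ : IsZLRR E Z) (N : ℕ) (x : ℕ → ℕ) {n : ℕ} (hn : n ≤ N + 1) {r : ℕ}
    (hr : (r : ℝ) < intRoom Z N x n) {m : ℕ}
    (hm : m = ∑ k ∈ Finset.range n, x k * Z (N - k) + r) :
    m < Z (N + 1) ∧ (∀ k < n, greedyDigit Z m (N - k) = x k) ∧
      ∀ j < N + 1 - n, greedyDigit Z m j = greedyDigit Z r j := by
  induction n generalizing r with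
  | zero =>
    simp only [intRoom, Nat.cast_lt] at hr
    simp at hm
    subst hm
    exact ⟨hr, by simp, fun j _ => rfl⟩
  | succ n ih =>
    rw [intRoom, lt_min_iff] at hr
    have hr1 : r < Z (N - n) := by exact_mod_cast hr.1
    have hr2 : ((x n * Z (N - n) + r : ℕ) : ℝ) < intRoom Z N x n := by push_cast; linarith
    obtain ⟨h1, h2, h3⟩ := ih (by omega) hr2 (by rw [hm, Finset.sum_range_succ, add_assoc])
    have h4 : x n * Z (N - n) + r < Z (N - n + 1) := by
      have := hr2.trans_le (intRoom_le N x (k := n) (by omega))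
      rw [show N - n + 1 = N + 1 - n by omega]
      exact_mod_cast this
    refine ⟨h1, fun k hk => ?_, fun j hj => ?_⟩
    · rcases Nat.lt_succ_iff_lt_or_eq.1 hk with hk | rfl
      · exact h2 k hk
      · rw [h3 _ (by omega), greedyDigit_top hZ h4, mul_comm,
          Nat.mul_add_div (hZ.one_le _), Nat.div_eq_of_lt hr1, add_zero]
    · rw [h3 j (by omega), greedyDigit_mod hZ h4 (by omega), mul_comm, Nat.mul_add_mod,
        Nat.mod_eq_of_lt hr1]

theorem tendsto_div_pow {a C r : ℝ} (hr1 : 1 < r) (hr2 : r < lam)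
    (h : ∀ n, |(Z n : ℝ) - a * lam ^ n| ≤ C * r ^ n) :
    Tendsto (fun n => (Z n : ℝ) / lam ^ n) atTop (𝓝 a) := by
  have hl : 0 < lam := by linarith
  have h1 : Tendsto (fun n => C * (r / lam) ^ n) atTop (𝓝 0) := by
    simpa using (tendsto_pow_atTop_nhds_zero_of_lt_one (by positivity)
      ((div_lt_one hl).2 hr2)).const_mul C
  rw [tendsto_iff_dist_tendsto_zero]
  refine squeeze_zero (fun _ => dist_nonneg) (fun n => ?_) h1
  rw [Real.dist_eq, div_pow, ← mul_div_assoc, le_div_iff₀ (by positivity),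
    ← abs_of_pos (by positivity : 0 < lam ^ n), ← abs_mul, abs_of_pos (by positivity : 0 < lam ^ n),
    sub_mul, div_mul_cancel₀ _ (by positivity)]
  exact h n

/-- After removal of the higher digits, the digit at j is a leading digit, hence at most Z (j + 1) /
Z j, a sequence converging to `lam`. -/
theorem exists_greedyDigit_le (hZ : IsZLRR E Z) (hlam : IsDominantRoot E Z lam) :
    ∃ B, ∀ m j, greedyDigit Z m j ≤ B := by
  obtain ⟨a, C, r, ha, -, hr1, hr2, h⟩ := hZ.exists_asymptotics hlam
  have hl : 0 < lam := by linarith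
  have h1 := tendsto_div_pow hr1 hr2 h
  have h2 := ((((tendsto_add_atTop_iff_nat 1).2 h1).div h1 ha.ne').mul_const lam)
  obtain ⟨B, hB⟩ := h2.bddAbove_range
  refine ⟨⌊B⌋₊, fun m j => ?_⟩
  obtain ⟨m', hm', hd⟩ := exists_lt_forall_greedyDigit_eq hZ m (j + 1)
  rw [hd j (by omega), greedyDigit_top hZ hm']
  refine Nat.le_floor ?_
  have hzj : (0 : ℝ) < Z j := by exact_mod_cast hZ.one_le j
  calc ((m' / Z j : ℕ) : ℝ) ≤ m' / Z j := Nat.cast_div_le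
    _ ≤ Z (j + 1) / Z j := by gcongr
    _ = (Z (j + 1) / lam ^ (j + 1)) / (Z j / lam ^ j) * lam := by field_simp; ring
    _ ≤ B := hB ⟨j, rfl⟩

end

section

/-! ### The beta-transformation -/

/-- The beta-transformation `x ↦ b * x mod 1`. -/
def betaMap (b x : ℝ) : ℝ := Int.fract (b * x)

/-- The digits of the greedy expansion of `x` in base `b`. -/
def betaSeq (b x : ℝ) : ℕ → ℕ := fun i => ⌊b * (betaMap b)^[i] x⌋₊

/-- `realRoom b x n` times `b ^ (-n)` is the length of the interval of the real numbers whose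
expansion begins with `x 0, …, x (n - 1)` (if this is nonnegative). -/
def realRoom (b : ℝ) (x : ℕ → ℕ) : ℕ → ℝ
  | 0 => 1
  | k + 1 => min 1 (b * realRoom b x k - x k)

/-- The value of the word `x 0, …, x (n - 1)` in base `b`. -/
def realValue (b : ℝ) (x : ℕ → ℕ) (n : ℕ) : ℝ := ∑ k ∈ Finset.range n, x k * (b ^ (k + 1))⁻¹

/-- The sequences agreeing with `x` in the first `n` positions. -/
def prefixSet (n : ℕ) (x : ℕ → ℕ) : Set (ℕ → ℕ) := {y | ∀ i < n, y i = x i}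

variable {b : ℝ}

theorem betaMap_nonneg (x : ℝ) : 0 ≤ betaMap b x := Int.fract_nonneg _

theorem betaMap_lt_one (x : ℝ) : betaMap b x < 1 := Int.fract_lt_one _

theorem betaMap_iterate_nonneg {x : ℝ} (hx : 0 ≤ x) (n : ℕ) : 0 ≤ (betaMap b)^[n] x := by
  rcases n with _ | n
  · exact hx
  · rw [Function.iterate_succ_apply']; exact betaMap_nonneg _

theorem betaMap_iterate_mem {x : ℝ} (hx : x ∈ Set.Ico 0 1) (n : ℕ) :
    (betaMap b)^[n] x ∈ Set.Ico (0 : ℝ) 1 := by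
  rcases n with _ | n
  · exact hx
  · rw [Function.iterate_succ_apply']; exact ⟨betaMap_nonneg _, betaMap_lt_one _⟩

theorem betaMap_iterate_le_one {x : ℝ} (hx : x ≤ 1) (n : ℕ) : (betaMap b)^[n] x ≤ 1 := by
  rcases n with _ | n
  · exact hx
  · rw [Function.iterate_succ_apply']; exact (betaMap_lt_one _).le

theorem floor_add_betaMap (hb : 0 < b) {x : ℝ} (hx : 0 ≤ x) :
    (⌊b * x⌋₊ : ℝ) + betaMap b x = b * x := by
  rw [betaMap, natCast_floor_eq_intCast_floor (by positivity), Int.floor_add_fract]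

theorem betaSeq_add_iterate (hb : 0 < b) {x : ℝ} (hx : 0 ≤ x) (n : ℕ) :
    (betaSeq b x n : ℝ) + (betaMap b)^[n + 1] x = b * (betaMap b)^[n] x := by
  rw [Function.iterate_succ_apply']
  exact floor_add_betaMap hb (betaMap_iterate_nonneg hx n)

theorem betaSeq_iterate (x : ℝ) (n i : ℕ) : betaSeq b ((betaMap b)^[n] x) i = betaSeq b x (n + i) := by
  simp only [betaSeq]
  rw [← Function.iterate_add_apply, add_comm]

theorem betaSeq_le (hb : 0 < b) {x : ℝ} (h1 : x ≤ 1) (n : ℕ) : betaSeq b x n ≤ ⌊b⌋₊ := by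
  refine Nat.floor_mono ?_
  exact mul_le_of_le_one_right hb.le (betaMap_iterate_le_one h1 n)

theorem measurable_betaMap : Measurable (betaMap b) :=
  measurable_fract.comp (measurable_const_mul b)

theorem measurable_betaSeq : Measurable (betaSeq b) :=
  measurable_pi_lambda _ fun i =>
    Nat.measurable_floor.comp ((measurable_const_mul b).comp (measurable_betaMap.iterate i))

theorem realValue_add_iterate (hb : 0 < b) {x : ℝ} (hx : 0 ≤ x) (n : ℕ) :
    realValue b (betaSeq b x) n + (b ^ n)⁻¹ * (betaMap b)^[n] x = x := by
  induction n with
  | zero => simp [realValue]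
  | succ n ih =>
    rw [realValue, Finset.sum_range_succ, ← realValue]
    have h := betaSeq_add_iterate hb hx n
    rw [← eq_sub_iff_add_eq'] at h
    rw [h]
    convert ih using 1
    field_simp
    ring

theorem realRoom_le_one (x : ℕ → ℕ) (n : ℕ) : realRoom b x n ≤ 1 := by
  rcases n with _ | n
  · exact le_rfl
  · exact min_le_left _ _

theorem realRoom_congr {x y : ℕ → ℕ} {n : ℕ} (h : ∀ i < n, x i = y i) :
    realRoom b x n = realRoom b y n := by
  induction n with
  | zero => rfl
  | succ n ih => rw [realRoom, realRoom, ih fun i hi => h i (by omega), h n (by omega)]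

theorem realValue_congr {x y : ℕ → ℕ} {n : ℕ} (h : ∀ i < n, x i = y i) :
    realValue b x n = realValue b y n :=
  Finset.sum_congr rfl fun i hi => by rw [h i (Finset.mem_range.1 hi)]

theorem realValue_shift (hb : 0 < b) (x : ℕ → ℕ) (k : ℕ) :
    realValue b (fun j => x (j + 1)) k = b * realValue b x (k + 1) - x 0 := by
  rw [realValue, realValue, Finset.sum_range_succ', mul_add, Finset.mul_sum]
  have : b * (x 0 * (b ^ (0 + 1))⁻¹) = x 0 := by rw [zero_add, pow_one]; field_simp
  rw [this, add_sub_cancel_right]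
  refine Finset.sum_congr rfl fun i _ => ?_
  field_simp
  ring

/-- Together with `exists_betaSeq_eq` this identifies the n-th iterates of the points of a cylinder
with the whole interval from 0 to `realRoom`. -/
theorem iterate_lt_realRoom (hb : 0 < b) {x : ℝ} (hx : x ∈ Set.Ico 0 1) (n : ℕ) :
    (betaMap b)^[n] x < realRoom b (betaSeq b x) n := by
  induction n with
  | zero => exact hx.2
  | succ n ih =>
    rw [realRoom, lt_min_iff]
    refine ⟨(betaMap_iterate_mem hx _).2, ?_⟩
    have := betaSeq_add_iterate hb hx.1 n
    have := mul_lt_mul_of_pos_left ih hb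
    linarith

/-- Inverse branches: the point is pulled back through y ↦ (x n + y) / b, and the room condition
keeps each preimage in the range where the induction hypothesis applies. -/
theorem exists_betaSeq_eq (hb : 0 < b) (x : ℕ → ℕ) (n : ℕ) {y : ℝ} (h0 : 0 ≤ y)
    (hy : y < realRoom b x n) :
    realValue b x n + (b ^ n)⁻¹ * y ∈ Set.Ico (0 : ℝ) 1 ∧
    (∀ k < n, betaSeq b (realValue b x n + (b ^ n)⁻¹ * y) k = x k) ∧
    (betaMap b)^[n] (realValue b x n + (b ^ n)⁻¹ * y) = y := by
  induction n generalizing y with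
  | zero => simpa [realValue] using ⟨h0, hy⟩
  | succ n ih =>
    rw [realRoom, lt_min_iff] at hy
    have hn : (x n + y) / b < realRoom b x n := by
      rw [div_lt_iff₀ hb]; linarith
    have heq : realValue b x n + (b ^ n)⁻¹ * ((x n + y) / b)
        = realValue b x (n + 1) + (b ^ (n + 1))⁻¹ * y := by
      rw [realValue, realValue, Finset.sum_range_succ]
      field_simp
      ring
    obtain ⟨h1, h2, h3⟩ := ih (by positivity) hn
    rw [heq] at h1 h2 h3
    have hxy : b * ((x n + y) / b) = x n + y := by field_simp
    refine ⟨h1, fun k hk => ?_, ?_⟩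
    · rcases Nat.lt_succ_iff_lt_or_eq.1 hk with hk | rfl
      · exact h2 k hk
      · rw [betaSeq, h3, hxy, add_comm, Nat.floor_add_natCast h0, Nat.floor_eq_zero.2 hy.1,
          zero_add]
    · rw [Function.iterate_succ_apply', h3, betaMap, hxy, Int.fract_natCast_add,
        Int.fract_eq_self.2 ⟨h0, hy.1⟩]

/-- For sequences not known to be the expansion of a point: it suffices that every block has value
at most 1, a closed condition that survives the limits taken for admissible words. -/
theorem realValue_le_realRoom (hb : 0 < b) {x : ℕ → ℕ}
    (h : ∀ i k, realValue b (fun j => x (i + j)) k ≤ 1) (n k : ℕ) :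
    realValue b (fun j => x (n + j)) k ≤ realRoom b x n := by
  induction n generalizing k with
  | zero => exact h 0 k
  | succ n ih =>
    refine le_min (h _ _) ?_
    have h1 := realValue_shift hb (fun j => x (n + j)) k
    have h2 : (fun j => x (n + 1 + j)) = fun j => x (n + (j + 1)) := by
      funext j; congr 1; ring
    rw [h2, h1, add_zero]
    have := mul_le_mul_of_nonneg_left (ih (k + 1)) hb.le
    linarith

theorem prefixSet_eq (hb : 0 < b) (x : ℕ → ℕ) (n : ℕ) :
    Set.Ico (0 : ℝ) 1 ∩ betaSeq b ⁻¹' prefixSet n x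
      = Set.Ico (0 : ℝ) 1 ∩
        Set.Ico (realValue b x n) (realValue b x n + (b ^ n)⁻¹ * realRoom b x n) := by
  ext z
  simp only [Set.mem_inter_iff, Set.mem_preimage, prefixSet, Set.mem_ofPred_eq]
  refine and_congr_right fun hz => ⟨fun h => ?_, fun h => ?_⟩
  · have h1 := realValue_add_iterate hb hz.1 n
    have h2 := iterate_lt_realRoom hb hz n
    have h3 := betaMap_iterate_nonneg (b := b) hz.1 n
    rw [realValue_congr h] at h1
    rw [realRoom_congr h] at h2
    have h4 : 0 < (b ^ n)⁻¹ := by positivity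
    have h5 := mul_lt_mul_of_pos_left h2 h4
    have h6 := mul_nonneg h4.le h3
    constructor <;> linarith
  · have hbn : 0 < b ^ n := by positivity
    have h1 : 0 ≤ b ^ n * (z - realValue b x n) := mul_nonneg hbn.le (by linarith [h.1])
    have h2 : b ^ n * (z - realValue b x n) < realRoom b x n := by
      rw [mul_comm, ← lt_div_iff₀ hbn, div_eq_inv_mul]; linarith [h.2]
    have h3 := (exists_betaSeq_eq hb x n h1 h2).2.1
    rwa [inv_mul_cancel_left₀ hbn.ne', add_sub_cancel] at h3

theorem Ico_realValue_subset (hb : 0 < b) (x : ℕ → ℕ) (n : ℕ) :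
    Set.Ico (realValue b x n) (realValue b x n + (b ^ n)⁻¹ * realRoom b x n) ⊆ Set.Ico 0 1 := by
  intro z h
  have hbn : 0 < b ^ n := by positivity
  have h1 : 0 ≤ b ^ n * (z - realValue b x n) := mul_nonneg hbn.le (by linarith [h.1])
  have h2 : b ^ n * (z - realValue b x n) < realRoom b x n := by
    rw [mul_comm, ← lt_div_iff₀ hbn, div_eq_inv_mul]; linarith [h.2]
  have h3 := (exists_betaSeq_eq hb x n h1 h2).1
  rwa [inv_mul_cancel_left₀ hbn.ne', add_sub_cancel] at h3

/-- The measure of a cylinder. -/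
theorem volume_prefixSet (hb : 0 < b) (x : ℕ → ℕ) (n : ℕ) :
    volume (Set.Ico (0 : ℝ) 1 ∩ betaSeq b ⁻¹' prefixSet n x)
      = ENNReal.ofReal ((b ^ n)⁻¹ * realRoom b x n) := by
  rw [prefixSet_eq hb, Set.inter_eq_right.2 (Ico_realValue_subset hb x n), Real.volume_Ico,
    add_sub_cancel_left]

theorem measurableSet_prefixSet (n : ℕ) (x : ℕ → ℕ) : MeasurableSet (prefixSet n x) := by
  have : prefixSet n x = ⋂ i ∈ Finset.range n, (fun y : ℕ → ℕ => y i) ⁻¹' {x i} := by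
    ext y; simp [prefixSet]
  rw [this]
  exact Finset.measurableSet_biInter _ fun i _ => measurable_pi_apply i (measurableSet_singleton _)

end

section

variable {b : ℝ}

/-! ### The invariant measure of the beta-transformation -/

theorem volume_Ico_inter_ne_top (s t : ℝ) (A : Set ℝ) : volume (Set.Ico s t ∩ A) ≠ ⊤ :=
  ((measure_mono Set.inter_subset_left).trans_lt measure_Ico_lt_top).ne

/-- The Lebesgue measure of the part of `A` in `[0, t)`. -/
def initMass (t : ℝ) (A : Set ℝ) : ℝ := volume.real (Set.Ico 0 t ∩ A)

theorem initMass_nonneg (t : ℝ) (A : Set ℝ) : 0 ≤ initMass t A := measureReal_nonneg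

theorem initMass_le {t : ℝ} (ht : 0 ≤ t) (A : Set ℝ) : initMass t A ≤ t := by
  calc initMass t A ≤ volume.real (Set.Ico 0 t) :=
        measureReal_mono Set.inter_subset_left measure_Ico_lt_top.ne
    _ = t := by rw [Real.volume_real_Ico_of_le ht, sub_zero]

theorem initMass_univ {t : ℝ} (ht : 0 ≤ t) : initMass t Set.univ = t := by
  rw [initMass, Set.inter_univ, Real.volume_real_Ico_of_le ht, sub_zero]

theorem initMass_mono {s t : ℝ} (h : s ≤ t) (A : Set ℝ) : initMass s A ≤ initMass t A :=
  measureReal_mono (Set.inter_subset_inter_left _ (Set.Ico_subset_Ico_right h))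
    (volume_Ico_inter_ne_top _ _ _)

theorem initMass_preimage_fract {A : Set ℝ} (hA : MeasurableSet A) (n : ℕ) {u : ℝ}
    (hu : u ∈ Set.Ico (0 : ℝ) 1) :
    initMass (n + u) (Int.fract ⁻¹' A) = n * initMass 1 A + initMass u A := by
  have key : ∀ s ≤ (1 : ℝ), Set.Ico 0 s ∩ Int.fract ⁻¹' A = Set.Ico 0 s ∩ A := by
    intro s hs
    ext z
    simp only [Set.mem_inter_iff, Set.mem_preimage]
    refine and_congr_right fun hz => ?_
    rw [Int.fract_eq_self.2 ⟨hz.1, hz.2.trans_le hs⟩]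
  have hfA : MeasurableSet (Int.fract ⁻¹' A : Set ℝ) := measurable_fract hA
  induction n with
  | zero => simp [initMass, key u hu.2.le]
  | succ n ih =>
    -- Split off the first unit interval and translate the rest back by one period.
    have h1 : Set.Ico (0 : ℝ) ((n + 1 : ℕ) + u) ∩ Int.fract ⁻¹' A
        = (Set.Ico 0 1 ∩ A) ∪ (fun z => z + (-1)) ⁻¹' (Set.Ico 0 (n + u) ∩ Int.fract ⁻¹' A) := by
      rw [← key 1 le_rfl]
      ext z
      have hz : Int.fract (z + -1) = Int.fract z := by
        rw [← sub_eq_add_neg, Int.fract_sub_one]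
      simp only [Set.mem_inter_iff, Set.mem_preimage, Set.mem_union, Set.mem_Ico, hz]
      push_cast
      have := hu.1
      have : (0 : ℝ) ≤ n := by positivity
      constructor
      · rintro ⟨⟨h2, h3⟩, h4⟩
        rcases lt_or_ge z 1 with h5 | h5
        · exact Or.inl ⟨⟨h2, h5⟩, h4⟩
        · exact Or.inr ⟨⟨by linarith, by linarith⟩, h4⟩
      · rintro (⟨⟨h2, h3⟩, h4⟩ | ⟨⟨h2, h3⟩, h4⟩)
        · exact ⟨⟨h2, by linarith⟩, h4⟩
        · exact ⟨⟨by linarith, by linarith⟩, h4⟩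
    have h2 : volume.real ((fun z => z + (-1)) ⁻¹' (Set.Ico (0 : ℝ) (n + u) ∩ Int.fract ⁻¹' A))
        = initMass (n + u) (Int.fract ⁻¹' A) := by
      rw [initMass, measureReal_def, measure_preimage_add_right, measureReal_def]
    have h3 : volume ((fun z => z + (-1)) ⁻¹' (Set.Ico (0 : ℝ) (n + u) ∩ Int.fract ⁻¹' A)) ≠ ⊤ := by
      rw [measure_preimage_add_right]; exact volume_Ico_inter_ne_top _ _ _
    have h4 : Disjoint (Set.Ico 0 1 ∩ A)
        ((fun z => z + (-1)) ⁻¹' (Set.Ico (0 : ℝ) (n + u) ∩ Int.fract ⁻¹' A)) := by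
      rw [Set.disjoint_left]
      rintro z ⟨hz, -⟩ ⟨hz', -⟩
      have h3 : (0 : ℝ) ≤ z + -1 := hz'.1
      linarith [hz.2]
    rw [initMass, h1, measureReal_union h4
      (measurable_add_const (-1) (measurableSet_Ico.inter hfA))
      (volume_Ico_inter_ne_top _ _ _) h3, h2, ih, ← initMass]
    push_cast; ring

/-- On [0, t) the map has slope b, ⌊b t⌋ full branches, and one last branch that stops at `betaMap b
t`. -/
theorem initMass_preimage (hb : 0 < b) {A : Set ℝ} (hA : MeasurableSet A) {t : ℝ} (ht : 0 ≤ t) :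
    initMass t (betaMap b ⁻¹' A)
      = b⁻¹ * (⌊b * t⌋₊ * initMass 1 A + initMass (betaMap b t) A) := by
  have h1 : Set.Ico 0 t ∩ betaMap b ⁻¹' A
      = (fun z => b * z) ⁻¹' (Set.Ico 0 (b * t) ∩ Int.fract ⁻¹' A) := by
    ext z
    simp only [Set.mem_inter_iff, Set.mem_preimage, Set.mem_Ico, betaMap, mul_nonneg_iff_of_pos_left hb,
      mul_lt_mul_iff_right₀ hb]
  have h2 := initMass_preimage_fract hA ⌊b * t⌋₊
    (u := betaMap b t) ⟨betaMap_nonneg _, betaMap_lt_one _⟩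
  rw [floor_add_betaMap hb ht] at h2
  rw [← h2, initMass, h1, measureReal_def, Real.volume_preimage_mul_left hb.ne', ENNReal.toReal_mul,
    ENNReal.toReal_ofReal (abs_nonneg _), abs_of_pos (by positivity), initMass, measureReal_def]

/-- The orbit of `1`. -/
def parryPoint (b : ℝ) (n : ℕ) : ℝ := (betaMap b)^[n] 1

theorem parryPoint_nonneg (n : ℕ) : 0 ≤ parryPoint b n := betaMap_iterate_nonneg zero_le_one n

theorem parryPoint_le_one (n : ℕ) : parryPoint b n ≤ 1 := betaMap_iterate_le_one le_rfl n

/-- The total mass of the non-normalized invariant measure. -/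
def parryMass (b : ℝ) : ℝ := ∑' n, (b ^ n)⁻¹ * parryPoint b n

/-- Parry's invariant probability measure of the beta-transformation. -/
def parryMeasure (b : ℝ) : Measure ℝ :=
  Measure.sum fun n => ENNReal.ofReal ((parryMass b)⁻¹ * (b ^ n)⁻¹) •
    volume.restrict (Set.Ico 0 (parryPoint b n))

theorem summable_inv_pow (hb : 1 < b) : Summable fun n : ℕ => (b ^ n)⁻¹ := by
  simpa using summable_geometric_of_lt_one (by positivity) (inv_lt_one_of_one_lt₀ hb)

theorem tsum_inv_pow (hb : 1 < b) : ∑' n : ℕ, (b ^ n)⁻¹ = b / (b - 1) := by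
  have h := tsum_geometric_of_lt_one (by positivity) (inv_lt_one_of_one_lt₀ hb)
  simp only [inv_pow] at h
  rw [h]
  have : b - 1 ≠ 0 := by linarith
  field_simp

theorem summable_inv_pow_mul (hb : 1 < b) {f : ℕ → ℝ} (h : ∀ n, |f n| ≤ 1) :
    Summable fun n : ℕ => (b ^ n)⁻¹ * f n := by
  refine Summable.of_norm_bounded (summable_inv_pow hb) fun n => ?_
  have : 0 < (b ^ n)⁻¹ := by positivity
  rw [Real.norm_eq_abs, abs_mul, abs_of_pos this]
  exact mul_le_of_le_one_right this.le (h n)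

theorem abs_initMass_parryPoint_le (A : Set ℝ) (n : ℕ) : |initMass (parryPoint b n) A| ≤ 1 := by
  rw [abs_of_nonneg (initMass_nonneg _ _)]
  exact (initMass_le (parryPoint_nonneg n) A).trans (parryPoint_le_one n)

theorem one_le_parryMass (hb : 1 < b) : 1 ≤ parryMass b := by
  have h := (summable_inv_pow_mul hb (f := parryPoint b) fun n => by
    rw [abs_of_nonneg (parryPoint_nonneg n)]; exact parryPoint_le_one n).le_tsum 0
    fun n _ => mul_nonneg (by positivity) (parryPoint_nonneg n)
  rw [parryMass]
  simpa [parryPoint] using h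

theorem parryMeasure_apply {A : Set ℝ} (hA : MeasurableSet A) (hb : 1 < b) :
    parryMeasure b A
      = ENNReal.ofReal ((parryMass b)⁻¹ * ∑' n, (b ^ n)⁻¹ * initMass (parryPoint b n) A) := by
  have hm : 0 < parryMass b := zero_lt_one.trans_le (one_le_parryMass hb)
  have h0 : ∀ n, 0 ≤ (b ^ n)⁻¹ * initMass (parryPoint b n) A :=
    fun n => mul_nonneg (by positivity) (initMass_nonneg _ _)
  rw [parryMeasure, Measure.sum_apply _ hA, ← tsum_mul_left, ENNReal.ofReal_tsum_of_nonneg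
    (fun n => mul_nonneg (by positivity) (h0 n))
    ((summable_inv_pow_mul hb (abs_initMass_parryPoint_le A)).mul_left _)]
  refine tsum_congr fun n => ?_
  rw [← mul_assoc, ENNReal.ofReal_mul (by positivity : 0 ≤ (parryMass b)⁻¹ * (b ^ n)⁻¹),
    Measure.smul_apply, Measure.restrict_apply hA, smul_eq_mul, initMass, Set.inter_comm,
    ofReal_measureReal (volume_Ico_inter_ne_top _ _ _)]

theorem parryMeasure_real {A : Set ℝ} (hA : MeasurableSet A) (hb : 1 < b) :
    (parryMeasure b).real A
      = (parryMass b)⁻¹ * ∑' n, (b ^ n)⁻¹ * initMass (parryPoint b n) A := by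
  have hm : 0 < parryMass b := zero_lt_one.trans_le (one_le_parryMass hb)
  rw [measureReal_def, parryMeasure_apply hA hb, ENNReal.toReal_ofReal]
  exact mul_nonneg (by positivity)
    (tsum_nonneg fun n => mul_nonneg (by positivity) (initMass_nonneg _ _))

theorem isProbabilityMeasure_parryMeasure (hb : 1 < b) :
    IsProbabilityMeasure (parryMeasure b) := by
  have hm : 0 < parryMass b := zero_lt_one.trans_le (one_le_parryMass hb)
  constructor
  rw [parryMeasure_apply MeasurableSet.univ hb]
  simp_rw [initMass_univ (parryPoint_nonneg _)]
  rw [← parryMass, inv_mul_cancel₀ hm.ne', ENNReal.ofReal_one]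

/-- The weights of the renewal equation. -/
def parryWeight (b : ℝ) (k : ℕ) : ℝ := (b ^ (k + 1))⁻¹ * betaSeq b 1 k

theorem sum_parryWeight (hb : 1 < b) (n : ℕ) :
    ∑ k ∈ Finset.range n, parryWeight b k = 1 - (b ^ n)⁻¹ * parryPoint b n := by
  have h := realValue_add_iterate (zero_lt_one.trans hb) zero_le_one n
  rw [← parryPoint, realValue] at h
  rw [eq_sub_iff_add_eq, ← h]
  simp only [parryWeight, mul_comm]

theorem tendsto_inv_pow (hb : 1 < b) : Tendsto (fun n : ℕ => (b ^ n)⁻¹) atTop (𝓝 0) :=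
  (summable_inv_pow hb).tendsto_atTop_zero

/-- The weights are the terms of the greedy expansion of 1 in base b. -/
theorem hasSum_parryWeight (hb : 1 < b) : HasSum (parryWeight b) 1 := by
  have hn : ∀ k, 0 ≤ parryWeight b k := fun k => mul_nonneg (by positivity) (by positivity)
  rw [hasSum_iff_tendsto_nat_of_nonneg hn]
  simp_rw [sum_parryWeight hb]
  have : Tendsto (fun n => (b ^ n)⁻¹ * parryPoint b n) atTop (𝓝 0) :=
    squeeze_zero (fun n => mul_nonneg (by positivity) (parryPoint_nonneg n))
      (fun n => mul_le_of_le_one_right (by positivity) (parryPoint_le_one n)) (tendsto_inv_pow hb)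
  simpa using this.const_sub 1

theorem initMass_parryPoint_preimage (hb : 1 < b) {A : Set ℝ} (hA : MeasurableSet A) (n : ℕ) :
    (b ^ n)⁻¹ * initMass (parryPoint b n) (betaMap b ⁻¹' A)
      = parryWeight b n * initMass 1 A + (b ^ (n + 1))⁻¹ * initMass (parryPoint b (n + 1)) A := by
  rw [initMass_preimage (zero_lt_one.trans hb) hA (parryPoint_nonneg n), parryWeight, betaSeq,
    parryPoint, parryPoint, Function.iterate_succ_apply', pow_succ, mul_inv]
  ring

/-- Pulling back turns the n-th term of the series into the (n + 1)-st plus a multiple of the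
zeroth; those multiples sum to 1 and restore the zeroth term lost by the shift. -/
theorem parryMeasure_real_preimage (hb : 1 < b) {A : Set ℝ} (hA : MeasurableSet A) :
    (parryMeasure b).real (betaMap b ⁻¹' A) = (parryMeasure b).real A := by
  rw [parryMeasure_real hA hb, parryMeasure_real (measurable_betaMap hA) hb]
  congr 1
  simp_rw [initMass_parryPoint_preimage hb hA]
  have hs := summable_inv_pow_mul hb (abs_initMass_parryPoint_le (b := b) A)
  have hs1 := (summable_nat_add_iff 1).2 hs
  rw [((hasSum_parryWeight hb).summable.mul_right _).tsum_add hs1, tsum_mul_right,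
    (hasSum_parryWeight hb).tsum_eq, hs.tsum_eq_zero_add]
  simp [parryPoint]

theorem measurePreserving_betaMap (hb : 1 < b) :
    MeasurePreserving (betaMap b) (parryMeasure b) (parryMeasure b) := by
  have := isProbabilityMeasure_parryMeasure hb
  refine ⟨measurable_betaMap, Measure.ext fun A hA => ?_⟩
  rw [Measure.map_apply measurable_betaMap hA, ← measureReal_eq_measureReal_iff]
  exact parryMeasure_real_preimage hb hA

/-- The term n = 0 of the density is already constant on [0, 1), as the orbit starts at 1. With
`parryMeasure_le_initMass_one` this makes the two measures comparable. -/
theorem initMass_one_le_parryMeasure (hb : 1 < b) {A : Set ℝ} (hA : MeasurableSet A) :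
    (parryMass b)⁻¹ * initMass 1 A ≤ (parryMeasure b).real A := by
  have hm : 0 < parryMass b := zero_lt_one.trans_le (one_le_parryMass hb)
  rw [parryMeasure_real hA hb]
  refine mul_le_mul_of_nonneg_left ?_ (by positivity)
  have := (summable_inv_pow_mul hb (abs_initMass_parryPoint_le (b := b) A)).le_tsum 0
    fun n _ => mul_nonneg (by positivity) (initMass_nonneg _ _)
  simpa [parryPoint] using this

theorem parryMeasure_le_initMass_one (hb : 1 < b) {A : Set ℝ} (hA : MeasurableSet A) :
    (parryMeasure b).real A ≤ b / (b - 1) * initMass 1 A := by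
  have hm := one_le_parryMass hb
  have hs := summable_inv_pow_mul hb (abs_initMass_parryPoint_le (b := b) A)
  rw [parryMeasure_real hA hb, ← tsum_inv_pow hb, ← tsum_mul_right]
  refine (mul_le_of_le_one_left (tsum_nonneg fun n => mul_nonneg (by positivity)
    (initMass_nonneg _ _)) (inv_le_one_of_one_le₀ hm)).trans ?_
  refine hs.tsum_le_tsum (fun n => ?_) ((summable_inv_pow hb).mul_right _)
  exact mul_le_mul_of_nonneg_left (initMass_mono (parryPoint_le_one n) A) (by positivity)

/-- The orbit of the Lebesgue measure is dominated by a multiple of the Lebesgue measure. -/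
theorem initMass_one_preimage_iterate_le (hb : 1 < b) {A : Set ℝ} (hA : MeasurableSet A) (n : ℕ) :
    initMass 1 ((betaMap b)^[n] ⁻¹' A) ≤ parryMass b * (b / (b - 1)) * initMass 1 A := by
  have hm : 0 < parryMass b := zero_lt_one.trans_le (one_le_parryMass hb)
  have h1 := initMass_one_le_parryMeasure hb ((measurable_betaMap (b := b)).iterate n hA)
  rw [inv_mul_le_iff₀ hm, measureReal_def, ((measurePreserving_betaMap hb).iterate n).measure_preimage
    hA.nullMeasurableSet, ← measureReal_def] at h1
  calc _ ≤ _ := h1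
    _ ≤ parryMass b * (b / (b - 1) * initMass 1 A) :=
      mul_le_mul_of_nonneg_left (parryMeasure_le_initMass_one hb hA) hm.le
    _ = _ := by ring

end

section

variable {b : ℝ}

/-! ### Exactness of the beta-transformation -/

/-- A quantitative form of the renewal theorem, uniform over all solutions `f` of the renewal
recursion: they cannot stay close to a positive upper bound. -/
theorem exists_forall_renewal_lt {p q : ℕ → ℝ} {U : ℝ} (hb : 1 < b) (hp0 : 0 < p 0) (hp : ∀ k, 0 ≤ p k)
    (hq0 : q 0 = 1) (hpq : ∀ k, p k + q (k + 1) = q k) (hq : ∀ k, 0 ≤ q k) (hU : 0 < U) :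
    ∃ ε > 0, ∃ R, ∀ f : ℕ → ℕ → ℝ, (∀ i k, |f i k| ≤ (b ^ k)⁻¹) →
      (∀ i k, f (i + 1) k = p k * f i 0 + f i (k + 1)) → (∀ i, ∑' k, f i k = 0) →
      (∀ i, f i 0 ≤ U + ε) → f R 0 < U - ε := by
  have hb0 : 0 < b := by linarith
  have hp1 : p 0 ≤ 1 := by linarith [hpq 0, hq 1]
  obtain ⟨J, hJ, hJ0⟩ := (((tendsto_sum_nat_add fun k : ℕ => (b ^ k)⁻¹).eventually_lt_const
    (by positivity : 0 < U / 3)).and (eventually_ge_atTop 1)).exists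
  have hpJ : 0 < p 0 ^ J := by positivity
  set ε := p 0 ^ J * U / (12 * (J + 1)) with hε
  have hε0 : 0 < ε := by positivity
  obtain ⟨n, hn⟩ := (((tendsto_inv_pow hb).const_mul (J * J : ℝ)).eventually_lt_const
    (by rw [mul_zero]; positivity : (J * J : ℝ) * 0 < p 0 ^ J * U / 6)).exists
  have hbn : 0 < (b ^ n)⁻¹ := by positivity
  refine ⟨ε, hε0, n + J, fun f hf hrec hsum hle => ?_⟩
  by_contra! hR
  -- Unrolling the recursion i times, every contribution f · 0 is at most U + ε, and only the
  -- initial data leave an error.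
  have hupper : ∀ i k, f i k ≤ q k * (U + ε) + (b ^ (i + k))⁻¹ := by
    intro i
    induction i with
    | zero =>
      intro k
      rw [zero_add]
      exact ((le_abs_self _).trans (hf 0 k)).trans
        (le_add_of_nonneg_left (mul_nonneg (hq k) (by positivity)))
    | succ i ih =>
      intro k
      have h1 := ih (k + 1)
      have h2 := mul_le_mul_of_nonneg_left (hle i) (hp k)
      rw [hrec, ← hpq k, add_right_comm]
      rw [← add_assoc] at h1
      linarith
  set w : ℕ → ℝ := fun i => U + ε - f i 0 with hw
  have hw0 : ∀ i, 0 ≤ w i := fun i => by simp only [hw]; linarith [hle i]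
  -- A deficit w i below the maximum persists up to the factor p 0 > 0. Read backwards: if f is
  -- almost maximal at time n + J, it was almost maximal at the J preceding times.
  have hstep : ∀ i, p 0 * w i ≤ w (i + 1) + (b ^ (i + 1))⁻¹ := by
    intro i
    have h1 := hupper i 1
    have h2 := hrec i 0
    have h3 := hpq 0
    rw [hq0] at h3
    have h4 : q 1 = 1 - p 0 := by rw [zero_add] at h3; linarith
    rw [h4] at h1
    simp only [hw]
    rw [zero_add] at h2
    nlinarith
  have hback : ∀ j ≤ J, p 0 ^ j * w (n + J - j) ≤ 2 * ε + j * (b ^ n)⁻¹ := by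
    intro j
    induction j with
    | zero => intro _; simp only [hw, pow_zero, Nat.sub_zero, Nat.cast_zero]; linarith
    | succ j ih =>
      intro hj
      have h1 := hstep (n + J - (j + 1))
      rw [show n + J - (j + 1) + 1 = n + J - j by omega] at h1
      have h2 := ih (by omega)
      have h3 : (b ^ (n + J - j))⁻¹ ≤ (b ^ n)⁻¹ :=
        inv_anti₀ (by positivity) (pow_le_pow_right₀ hb.le (by omega))
      have h4 : p 0 ^ j ≤ 1 := pow_le_one₀ hp0.le hp1
      have h5 : 0 ≤ p 0 ^ j := by positivity
      calc p 0 ^ (j + 1) * w (n + J - (j + 1)) = p 0 ^ j * (p 0 * w (n + J - (j + 1))) := by ring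
        _ ≤ p 0 ^ j * (w (n + J - j) + (b ^ (n + J - j))⁻¹) := by gcongr
        _ = p 0 ^ j * w (n + J - j) + p 0 ^ j * (b ^ (n + J - j))⁻¹ := by ring
        _ ≤ (2 * ε + j * (b ^ n)⁻¹) + 1 * (b ^ n)⁻¹ := by gcongr
        _ = _ := by push_cast; ring
  have hwk : ∀ k < J, p 0 ^ J * w (n + k) ≤ 2 * ε + J * (b ^ n)⁻¹ := by
    intro k hk
    have h1 := hback (J - k) (by omega)
    rw [show n + J - (J - k) = n + k by omega] at h1
    have h2 : p 0 ^ J ≤ p 0 ^ (J - k) := pow_le_pow_of_le_one hp0.le hp1 (by omega)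
    have h3 : ((J - k : ℕ) : ℝ) ≤ J := by exact_mod_cast Nat.sub_le J k
    calc p 0 ^ J * w (n + k) ≤ p 0 ^ (J - k) * w (n + k) :=
          mul_le_mul_of_nonneg_right h2 (hw0 _)
      _ ≤ _ := h1
      _ ≤ _ := by gcongr
  -- The recursion solved for f i (k + 1): near-maximality at time i + k bounds f i k from below by
  -- almost q k (U + ε).
  have hlower : ∀ k i, q k * (U + ε) - w (i + k) ≤ f i k := by
    intro k
    induction k with
    | zero => intro i; simp only [hq0, hw, add_zero]; linarith
    | succ k ih =>
      intro i
      have h1 := ih (i + 1)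
      rw [show i + 1 + k = i + (k + 1) by ring] at h1
      have h2 := hrec i k
      have h3 := mul_le_mul_of_nonneg_left (hle i) (hp k)
      rw [← hpq k] at h1
      linarith
  have hfs : Summable (f n) :=
    Summable.of_norm_bounded (summable_inv_pow hb) fun k => hf n k
  have htail : -(U / 3) < ∑' k, f n (k + J) := by
    have h1 : ‖∑' k, f n (k + J)‖ ≤ ∑' k, (b ^ (k + J))⁻¹ :=
      tsum_of_norm_bounded ((summable_nat_add_iff J).2 (summable_inv_pow hb)).hasSum
        fun k => hf n (k + J)
    rw [Real.norm_eq_abs] at h1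
    linarith [neg_abs_le (∑' k, f n (k + J))]
  have hsplit := hfs.sum_add_tsum_nat_add J
  rw [hsum n] at hsplit
  have h1 : ∑ k ∈ Finset.range J, (q k * (U + ε) - w (n + k)) ≤ ∑ k ∈ Finset.range J, f n k :=
    Finset.sum_le_sum fun k _ => hlower k n
  rw [Finset.sum_sub_distrib] at h1
  -- The zeroth term alone gives U + ε; deficits and tail cost less than U / 3 each, so the sum of f
  -- n is positive, contradicting that it vanishes.
  have h2 : U + ε ≤ ∑ k ∈ Finset.range J, q k * (U + ε) := by
    have := Finset.single_le_sum (f := fun k => q k * (U + ε)) (s := Finset.range J)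
      (fun k _ => mul_nonneg (hq k) (by positivity)) (Finset.mem_range.2 hJ0)
    simpa [hq0] using this
  have h3 : p 0 ^ J * ∑ k ∈ Finset.range J, w (n + k) < p 0 ^ J * (U / 3) := by
    rw [Finset.mul_sum]
    calc _ ≤ ∑ k ∈ Finset.range J, (2 * ε + J * (b ^ n)⁻¹) :=
          Finset.sum_le_sum fun k hk => hwk k (Finset.mem_range.1 hk)
      _ = J * (2 * ε) + J * J * (b ^ n)⁻¹ := by
        rw [Finset.sum_const, Finset.card_range, nsmul_eq_mul]; ring
      _ < p 0 ^ J * U / 6 + p 0 ^ J * U / 6 := by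
        refine add_lt_add_of_le_of_lt ?_ hn
        rw [hε, ← mul_div_assoc, ← mul_div_assoc, div_le_div_iff₀ (by positivity) (by norm_num)]
        have : 0 < p 0 ^ J * U := by positivity
        nlinarith
      _ = _ := by ring
  have h4 := lt_of_mul_lt_mul_left h3 hpJ.le
  linarith

/-- Let U be the infimum over n of the uniform upper bounds for the discrepancy. Were U positive,
the renewal lemma, started at a time n with bound below U + δ, would give the bound U - δ at time R
+ n for all sets at once. The uniformity of R in the set is essential here. -/
theorem exists_forall_initMass_preimage_le (hb : 1 < b) {ε : ℝ} (hε : 0 < ε) :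
    ∃ n₀, ∀ n ≥ n₀, ∀ A : Set ℝ, MeasurableSet A →
      initMass 1 ((betaMap b)^[n] ⁻¹' A) - (parryMeasure b).real A ≤ ε := by
  have hb0 : 0 < b := by linarith
  have := isProbabilityMeasure_parryMeasure hb
  set v : ℕ → Set ℝ → ℝ := fun n A =>
    initMass 1 ((betaMap b)^[n] ⁻¹' A) - (parryMeasure b).real A with hv
  have hmi : ∀ n {A : Set ℝ}, MeasurableSet A →
      (parryMeasure b).real ((betaMap b)^[n] ⁻¹' A) = (parryMeasure b).real A := fun n A hA => by
    rw [measureReal_def, ((measurePreserving_betaMap hb).iterate n).measure_preimage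
      hA.nullMeasurableSet, ← measureReal_def]
  have hvadd : ∀ i n {A : Set ℝ}, MeasurableSet A →
      v (i + n) A = v i ((betaMap b)^[n] ⁻¹' A) := fun i n A hA => by
    simp only [hv]
    rw [hmi n hA, ← Set.preimage_comp, ← Function.iterate_add, add_comm]
  have hmeas : ∀ n {A : Set ℝ}, MeasurableSet A → MeasurableSet ((betaMap b)^[n] ⁻¹' A) :=
    fun n A hA => (measurable_betaMap.iterate n) hA
  set V : Set ℝ := {u | ∃ n, ∀ A, MeasurableSet A → v n A ≤ u} with hV
  have hVne : V.Nonempty := ⟨1, 0, fun A _ => by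
    have h1 := initMass_le zero_le_one ((betaMap b)^[0] ⁻¹' A)
    have h2 : 0 ≤ (parryMeasure b).real A := measureReal_nonneg
    simp only [hv]; linarith⟩
  have hVbdd : BddBelow V := ⟨0, by
    rintro u ⟨n, hn⟩
    simpa [hv, initMass] using hn ∅ MeasurableSet.empty⟩
  have hmono : ∀ n u, (∀ A, MeasurableSet A → v n A ≤ u) →
      ∀ k, ∀ A, MeasurableSet A → v (n + k) A ≤ u := fun n u h k A hA => by
    rw [hvadd n k hA]; exact h _ (hmeas k hA)
  have hinf : sInf V ≤ 0 := by
    by_contra! hU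
    obtain ⟨δ, hδ, R, hR⟩ := exists_forall_renewal_lt (p := parryWeight b)
      (q := fun k => (b ^ k)⁻¹ * parryPoint b k) hb
      (by
        have : 1 ≤ ⌊b⌋₊ := Nat.le_floor (by simpa using hb.le)
        simp only [parryWeight, betaSeq, Function.iterate_zero, id, mul_one]
        positivity)
      (fun k => mul_nonneg (by positivity) (by positivity)) (by simp [parryPoint])
      (fun k => by
        have h1 := sum_parryWeight hb k
        have h2 := sum_parryWeight hb (k + 1)
        rw [Finset.sum_range_succ] at h2
        linarith)
      (fun k => mul_nonneg (by positivity) (parryPoint_nonneg k)) hU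
    obtain ⟨u, ⟨n, hn⟩, hu⟩ := exists_lt_of_csInf_lt hVne (lt_add_of_pos_right _ hδ)
    have hnot : sInf V - δ ∉ V := fun h => by linarith [csInf_le hVbdd h]
    simp only [hV, Set.mem_ofPred_eq, not_exists, not_forall, not_le] at hnot
    obtain ⟨A, hA, hlt⟩ := hnot (R + n)
    refine lt_asymm hlt ?_
    set A' := (betaMap b)^[n] ⁻¹' A with hA'
    have hA'm : MeasurableSet A' := hmeas n hA
    have hf0 : ∀ i, (b ^ 0)⁻¹ * (initMass (parryPoint b 0) ((betaMap b)^[i] ⁻¹' A')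
        - parryPoint b 0 * (parryMeasure b).real A') = v (i + n) A := fun i => by
      rw [hvadd i n hA]; simp [hv, parryPoint, hA']
    -- The discrepancies on the intervals [0, T^k 1), weighted by b ^ (-k), satisfy the renewal
    -- recursion; for k = 0 the interval is [0, 1).
    have key := hR (fun i k => (b ^ k)⁻¹ * (initMass (parryPoint b k) ((betaMap b)^[i] ⁻¹' A')
        - parryPoint b k * (parryMeasure b).real A')) ?_ ?_ ?_ ?_
    · rw [hf0] at key; exact key
    · intro i k
      have hbk : 0 < (b ^ k)⁻¹ := by positivity
      rw [abs_mul, abs_of_pos hbk]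
      refine mul_le_of_le_one_right hbk.le (abs_le.2 ?_)
      have h1 := parryPoint_le_one (b := b) k
      have h2 := parryPoint_nonneg (b := b) k
      have h3 : 0 ≤ (parryMeasure b).real A' := measureReal_nonneg
      have h4 : (parryMeasure b).real A' ≤ 1 := measureReal_le_one
      have h5 := initMass_le h2 ((betaMap b)^[i] ⁻¹' A')
      have h6 := initMass_nonneg (parryPoint b k) ((betaMap b)^[i] ⁻¹' A')
      constructor <;> nlinarith
    · intro i k
      have h1 := initMass_parryPoint_preimage hb (hmeas i hA'm) k
      have h2 := sum_parryWeight hb k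
      have h3 := sum_parryWeight hb (k + 1)
      rw [Finset.sum_range_succ] at h3
      have h4 : (betaMap b)^[i + 1] ⁻¹' A' = betaMap b ⁻¹' ((betaMap b)^[i] ⁻¹' A') := by
        rw [Function.iterate_succ, Set.preimage_comp]
      have h5 : parryPoint b 0 = 1 := rfl
      rw [h4, mul_sub, h1, h5]
      have h6 : (b ^ k)⁻¹ * parryPoint b k
          = parryWeight b k + (b ^ (k + 1))⁻¹ * parryPoint b (k + 1) := by linarith
      rw [← mul_assoc, h6]
      ring
    -- The weighted sum over k is a multiple of the difference of the Parry measures of a set and of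
    -- its preimage, hence zero by invariance.
    · intro i
      have hs1 := summable_inv_pow_mul hb
        (abs_initMass_parryPoint_le (b := b) ((betaMap b)^[i] ⁻¹' A'))
      have hs2 := summable_inv_pow_mul hb (f := parryPoint b) fun n => by
        rw [abs_of_nonneg (parryPoint_nonneg n)]; exact parryPoint_le_one n
      simp only [mul_sub, ← mul_assoc]
      rw [hs1.tsum_sub (hs2.mul_right _), tsum_mul_right, ← parryMass, sub_eq_zero,
        ← hmi i hA'm, parryMeasure_real (hmeas i hA'm) hb, mul_inv_cancel_left₀]
      exact (zero_lt_one.trans_le (one_le_parryMass hb)).ne'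
    · intro i
      rw [hf0, add_comm i n]
      exact (hmono n u hn i A hA).trans hu.le
  obtain ⟨u, ⟨n, hn⟩, hu⟩ := exists_lt_of_csInf_lt hVne (hinf.trans_lt hε)
  refine ⟨n, fun m hm A hA => ?_⟩
  obtain ⟨k, rfl⟩ := Nat.exists_eq_add_of_le hm
  exact (hmono n u hn k A hA).trans hu.le

/-- The orbit of the Lebesgue measure converges in total variation to the invariant measure. -/
theorem exists_forall_abs_initMass_preimage_sub_le (hb : 1 < b) {ε : ℝ} (hε : 0 < ε) :
    ∃ n₀, ∀ n ≥ n₀, ∀ A : Set ℝ, MeasurableSet A →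
      |initMass 1 ((betaMap b)^[n] ⁻¹' A) - (parryMeasure b).real A| ≤ ε := by
  have := isProbabilityMeasure_parryMeasure hb
  obtain ⟨n₀, h⟩ := exists_forall_initMass_preimage_le hb hε
  refine ⟨n₀, fun n hn A hA => abs_le.2 ⟨?_, h n hn A hA⟩⟩
  -- Both measures have total mass 1, so the upper bound for the complement is the lower bound for
  -- A.
  have h1 := h n hn Aᶜ hA.compl
  rw [probReal_compl_eq_one_sub hA] at h1
  have hA' : MeasurableSet ((betaMap b)^[n] ⁻¹' A) := measurable_betaMap.iterate n hA
  have h2 : initMass 1 ((betaMap b)^[n] ⁻¹' A) + initMass 1 ((betaMap b)^[n] ⁻¹' Aᶜ) = 1 := by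
    rw [initMass, initMass, Set.preimage_compl, ← Set.sdiff_eq,
      measureReal_inter_add_sdiff hA' measure_Ico_lt_top.ne, Real.volume_real_Ico_of_le zero_le_one,
      sub_zero]
  linarith

/-- A set that is invariant under the beta-transformation occupies the same proportion of all
intervals `[0, t)`. -/
theorem initMass_of_preimage_eq (hb : 1 < b) {A : Set ℝ} (hA : MeasurableSet A)
    (hinv : betaMap b ⁻¹' A = A) {t : ℝ} (h0 : 0 ≤ t) (h1 : t ≤ 1) :
    initMass t A = t * initMass 1 A := by
  have hb0 : 0 < b := by linarith
  -- For invariant A, passing from t to its image multiplies the discrepancy by b; since it stays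
  -- bounded, it must vanish.
  have key : ∀ n, initMass t A - t * initMass 1 A = (b ^ n)⁻¹ *
      (initMass ((betaMap b)^[n] t) A - (betaMap b)^[n] t * initMass 1 A) := by
    intro n
    induction n with
    | zero => simp
    | succ n ih =>
      have h2 := initMass_preimage hb0 hA (betaMap_iterate_nonneg (b := b) h0 n)
      rw [hinv] at h2
      have h3 := betaSeq_add_iterate hb0 h0 n
      rw [betaSeq] at h3
      rw [ih, h2, Function.iterate_succ_apply'] at *
      have h4 : (betaMap b)^[n] t = b⁻¹ * (⌊b * (betaMap b)^[n] t⌋₊ + betaMap b ((betaMap b)^[n] t)) := by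
        rw [h3]; field_simp
      nth_rewrite 3 [h4]
      rw [pow_succ, mul_inv]
      ring
  have hlim : Tendsto (fun n => (b ^ n)⁻¹ *
      (initMass ((betaMap b)^[n] t) A - (betaMap b)^[n] t * initMass 1 A)) atTop (𝓝 0) := by
    refine squeeze_zero_norm (fun n => ?_) (tendsto_inv_pow hb)
    have hbk : 0 < (b ^ n)⁻¹ := by positivity
    rw [Real.norm_eq_abs, abs_mul, abs_of_pos hbk]
    refine mul_le_of_le_one_right hbk.le (abs_le.2 ?_)
    have h1 := betaMap_iterate_le_one (b := b) h1 n
    have h2 := betaMap_iterate_nonneg (b := b) h0 n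
    have h3 := initMass_nonneg 1 A
    have h4 := initMass_le zero_le_one A
    have h5 := initMass_le h2 A
    have h6 := initMass_nonneg ((betaMap b)^[n] t) A
    constructor <;> nlinarith
  have h2 := tendsto_nhds_unique (tendsto_const_nhds.congr key) hlim
  linarith

end

section

variable {b : ℝ}

/-! ### Measures on sequences -/

theorem measure_le_of_forall_singleton {α : Type*} [MeasurableSpace α] [Countable α]
    [MeasurableSingletonClass α] {μ ν : Measure α} (h : ∀ a, μ {a} ≤ ν {a}) : μ ≤ ν := by
  refine Measure.le_intro fun s hs _ => ?_
  rw [← Measure.tsum_indicator_apply_singleton μ s hs, ← Measure.tsum_indicator_apply_singleton ν s hs]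
  exact ENNReal.tsum_le_tsum fun a => Set.indicator_le_indicator (h a)

/-- The first `n` terms of a sequence. -/
def firstTerms (n : ℕ) (x : ℕ → ℕ) : Fin n → ℕ := fun i => x i

/-- A word, continued by zeros. -/
def extendZero {n : ℕ} (w : Fin n → ℕ) : ℕ → ℕ := fun i => if h : i < n then w ⟨i, h⟩ else 0

theorem extendZero_apply {n : ℕ} (w : Fin n → ℕ) (i : Fin n) : extendZero w i = w i := by
  simp [extendZero]

theorem measurable_firstTerms (n : ℕ) : Measurable (firstTerms n) :=
  measurable_pi_lambda _ fun i => measurable_pi_apply (i : ℕ)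

theorem prefixCylinder_eq {n : ℕ} (w : Fin n → ℕ) : prefixCylinder w = prefixSet n (extendZero w) := by
  ext y
  refine ⟨fun h i hi => ?_, fun h t => ?_⟩
  · exact (h ⟨i, hi⟩).trans (extendZero_apply w ⟨i, hi⟩).symm
  · rw [h t t.2, extendZero_apply]

theorem firstTerms_preimage_singleton {n : ℕ} (w : Fin n → ℕ) :
    firstTerms n ⁻¹' {w} = prefixSet n (extendZero w) := by
  rw [← prefixCylinder_eq]
  ext y
  exact funext_iff

theorem prefixSet_eq_prefixCylinder (n : ℕ) (x : ℕ → ℕ) :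
    prefixSet n x = prefixCylinder (firstTerms n x) :=
  Set.ext fun _ => ⟨fun h t => h t t.2, fun h i hi => h ⟨i, hi⟩⟩

theorem map_firstTerms_le {μ ν : Measure (ℕ → ℕ)} {n : ℕ}
    (h : ∀ x, μ (prefixSet n x) ≤ ν (prefixSet n x)) :
    μ.map (firstTerms n) ≤ ν.map (firstTerms n) := by
  refine measure_le_of_forall_singleton fun w => ?_
  rw [Measure.map_apply (measurable_firstTerms n) (measurableSet_singleton w),
    Measure.map_apply (measurable_firstTerms n) (measurableSet_singleton w),
    firstTerms_preimage_singleton]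
  exact h _

/-- An open set is an increasing union of sets decided by finitely many terms; outer regularity of ν
extends the inequality from open to all measurable sets. -/
theorem measure_le_of_prefixSet_le {μ ν : Measure (ℕ → ℕ)} [IsFiniteMeasure ν]
    (h : ∀ n x, μ (prefixSet n x) ≤ ν (prefixSet n x)) : μ ≤ ν := by
  have hopen : ∀ U : Set (ℕ → ℕ), IsOpen U → μ U ≤ ν U := by
    intro U hU
    set V : ℕ → Set (ℕ → ℕ) := fun n => {x | prefixSet n x ⊆ U} with hV
    have hmono : Monotone V := fun m n hmn x hx y hy =>
      hx fun i hi => hy i (hi.trans_le hmn)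
    have hUV : U = ⋃ n, V n := by
      refine Set.Subset.antisymm (fun x hx => ?_) (Set.iUnion_subset fun n x hx => hx fun i _ => rfl)
      obtain ⟨_, ⟨y, n, rfl⟩, hxy, hyU⟩ :=
        (PiNat.isTopologicalBasis_cylinders (fun _ => ℕ)).exists_subset_of_mem_open hx hU
      refine Set.mem_iUnion.2 ⟨n, fun z hz => hyU fun i hi => ?_⟩
      rw [hz i hi, hxy i hi]
    have hle : ∀ n, μ (V n) ≤ ν (V n) := by
      intro n
      have hVn : V n = firstTerms n ⁻¹' {w | prefixSet n (extendZero w) ⊆ U} := by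
        ext x
        simp only [hV, Set.mem_ofPred_eq, Set.mem_preimage]
        rw [prefixSet_eq_prefixCylinder, prefixCylinder_eq]
      rw [hVn, ← Measure.map_apply (measurable_firstTerms n) (Set.to_countable _).measurableSet,
        ← Measure.map_apply (measurable_firstTerms n) (Set.to_countable _).measurableSet]
      exact map_firstTerms_le (h n) _
    rw [hUV, hmono.measure_iUnion, hmono.measure_iUnion]
    exact iSup_mono hle
  refine Measure.le_intro fun s _ _ => ?_
  rw [s.measure_eq_iInf_isOpen ν]
  exact le_iInf₂ fun U hsU => le_iInf fun hU => (measure_mono hsU).trans (hopen U hU)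

/-! ### Ergodicity -/

/-- By `initMass_of_preimage_eq`, Lebesgue measure restricted to an invariant set is a multiple α of
Lebesgue measure on [0, 1). Evaluating both on the set itself gives α = α², so α is 0 or 1. -/
theorem ergodic_betaMap (hb : 1 < b) : Ergodic (betaMap b) (parryMeasure b) := by
  have hprob := isProbabilityMeasure_parryMeasure hb
  refine ⟨measurePreserving_betaMap hb, ⟨fun A hA hinv => ?_⟩⟩
  set α := initMass 1 A with hα
  have hα0 : 0 ≤ α := initMass_nonneg _ _
  have hext : volume.restrict (Set.Ico 0 1 ∩ A)
      = ENNReal.ofReal α • volume.restrict (Set.Ico (0 : ℝ) 1) := by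
    have hf : IsFiniteMeasure (volume.restrict (Set.Ico 0 1 ∩ A)) :=
      ⟨by rw [Measure.restrict_apply_univ]; exact (volume_Ico_inter_ne_top _ _ _).lt_top⟩
    refine Measure.ext_of_Ici _ _ fun t => ?_
    set c := max 0 (min t 1) with hc
    have hc0 : 0 ≤ c := le_max_left _ _
    have hc1 : c ≤ 1 := max_le zero_le_one (min_le_right _ _)
    have hI : Set.Ici t ∩ Set.Ico 0 1 = Set.Ico c 1 := by
      ext z
      simp only [Set.mem_inter_iff, Set.mem_Ici, Set.mem_Ico, hc, max_le_iff, min_le_iff]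
      constructor
      · rintro ⟨h1, h2, h3⟩; exact ⟨⟨h2, Or.inl h1⟩, h3⟩
      · rintro ⟨⟨h1, h2⟩, h3⟩
        exact ⟨h2.resolve_right (by linarith), h1, h3⟩
    rw [Measure.smul_apply, Measure.restrict_apply measurableSet_Ici,
      Measure.restrict_apply measurableSet_Ici, ← Set.inter_assoc, hI, Real.volume_Ico, smul_eq_mul,
      ← ENNReal.ofReal_mul hα0, ← ofReal_measureReal (volume_Ico_inter_ne_top _ _ _)]
    congr 1
    have h1 := initMass_of_preimage_eq hb hA hinv hc0 hc1
    have h2 : initMass 1 A = initMass c A + volume.real (Set.Ico c 1 ∩ A) := by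
      rw [initMass, initMass, ← Set.Ico_union_Ico_eq_Ico hc0 hc1, Set.union_inter_distrib_right,
        measureReal_union _ (measurableSet_Ico.inter hA) (volume_Ico_inter_ne_top _ _ _)
          (volume_Ico_inter_ne_top _ _ _)]
      exact (Set.Ico_disjoint_Ico_same).mono Set.inter_subset_left Set.inter_subset_left
    rw [h1] at h2
    linarith
  have hαα : α = α * α := by
    have h1 := congrArg (fun ρ : Measure ℝ => ρ.real A) hext
    simp only [measureReal_def, Measure.smul_apply, Measure.restrict_apply hA, smul_eq_mul,
      ENNReal.toReal_mul, ENNReal.toReal_ofReal hα0] at h1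
    rw [Set.inter_left_comm, Set.inter_self, Set.inter_comm A] at h1
    exact h1
  rw [eventuallyConst_set]
  have h0 : α = 0 ∨ α = 1 := by
    rcases eq_or_ne α 0 with h | h
    · exact Or.inl h
    · exact Or.inr (mul_left_cancel₀ h (by rw [← hαα, mul_one]))
  rcases h0 with h | h
  · right
    have h1 := parryMeasure_le_initMass_one hb hA
    rw [← hα, h, mul_zero] at h1
    have h2 : (parryMeasure b).real A = 0 := le_antisymm h1 measureReal_nonneg
    rwa [measureReal_eq_zero_iff, measure_eq_zero_iff_ae_notMem] at h2
  · left
    have h1 := parryMeasure_le_initMass_one hb hA.compl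
    have h3 : initMass 1 A + initMass 1 Aᶜ = 1 := by
      rw [initMass, initMass, ← Set.sdiff_eq,
        measureReal_inter_add_sdiff hA measure_Ico_lt_top.ne,
        Real.volume_real_Ico_of_le zero_le_one, sub_zero]
    rw [show initMass 1 Aᶜ = 0 by linarith, mul_zero] at h1
    have h2 : (parryMeasure b).real Aᶜ = 0 := le_antisymm h1 measureReal_nonneg
    rw [measureReal_eq_zero_iff, measure_eq_zero_iff_ae_notMem] at h2
    simpa using h2

/-- The law of the digits under Parry's measure. -/
def betaMeasure (b : ℝ) : Measure (ℕ → ℕ) := (parryMeasure b).map (betaSeq b)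

theorem betaSeq_betaMap (x : ℝ) : betaSeq b (betaMap b x) = fun i => betaSeq b x (i + 1) := by
  funext i
  rw [add_comm]
  exact betaSeq_iterate x 1 i

theorem measurable_seqTail : Measurable fun (x : ℕ → ℕ) i => x (i + 1) :=
  measurable_pi_lambda _ fun i => measurable_pi_apply (i + 1)

theorem ergodic_betaMeasure (hb : 1 < b) :
    Ergodic (fun (x : ℕ → ℕ) i => x (i + 1)) (betaMeasure b) :=
  (measurable_betaSeq.measurePreserving (parryMeasure b)).ergodic_of_ergodic_semiconj
    (ergodic_betaMap hb) measurable_seqTail betaSeq_betaMap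

theorem betaMeasure_real {A : Set (ℕ → ℕ)} (hA : MeasurableSet A) :
    (betaMeasure b).real A = (parryMeasure b).real (betaSeq b ⁻¹' A) :=
  map_measureReal_apply measurable_betaSeq hA

theorem initMass_prefixSet (hb : 0 < b) (x : ℕ → ℕ) (n : ℕ) :
    initMass 1 (betaSeq b ⁻¹' prefixSet n x) = max ((b ^ n)⁻¹ * realRoom b x n) 0 := by
  rw [initMass, measureReal_def, volume_prefixSet hb, ENNReal.toReal_ofReal']

end

section

variable {E : LinearRecurrence ℤ} {Z : ℕ → ℕ} {lam : ℝ}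

/-! ### Admissible words and expansions in base `lam` -/

theorem IsAdmissible.subblock {x : ℕ → ℕ} {M : ℕ} (h : IsAdmissible Z fun t : Fin M => x t)
    {i k : ℕ} (hik : i + k ≤ M) : IsAdmissible Z fun t : Fin k => x (i + t) := by
  intro K
  obtain ⟨j, hj, m, hm⟩ := h K
  refine ⟨j + (M - i - k), by omega, m, fun t => ?_⟩
  have ht := t.2
  refine (hm ⟨i + t, by omega⟩).trans ?_
  congr 1
  simp only [Fin.val_rev]
  omega

theorem IsZLRR.exists_limit (hZ : IsZLRR E Z) (hlam : IsDominantRoot E Z lam) :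
    ∃ a, 0 < a ∧ Tendsto (fun n => (Z n : ℝ) / lam ^ n) atTop (𝓝 a) := by
  obtain ⟨a, C, r, ha, -, hr1, hr2, h⟩ := hZ.exists_asymptotics hlam
  exact ⟨a, ha, tendsto_div_pow hr1 hr2 h⟩

theorem tendsto_div_pow_sub {a : ℝ} (h : Tendsto (fun n => (Z n : ℝ) / lam ^ n) atTop (𝓝 a))
    (k : ℕ) : Tendsto (fun N => (Z (N - k) : ℝ) / lam ^ (N - k)) atTop (𝓝 a) :=
  h.comp (tendsto_sub_atTop_nat k)

/-- Each occurrence at a high index gives Σ x_t Z (N - t) ≤ Z (N + 1). Division by lam ^ (N + 1) and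
passage to the limit along such N leave the inequality for the powers of `lam`. -/
theorem IsAdmissible.realValue_le_one (hZ : IsZLRR E Z) (hlam : IsDominantRoot E Z lam)
    {x : ℕ → ℕ} {n : ℕ} (h : IsAdmissible Z fun t : Fin n => x t) : realValue lam x n ≤ 1 := by
  have hl : 0 < lam := zero_lt_one.trans hlam.one_lt
  obtain ⟨a, ha, hlim⟩ := hZ.exists_limit hlam
  rcases n with _ | n
  · simp [realValue]
  have h1 : Tendsto (fun N => ∑ t ∈ Finset.range (n + 1),
      x t * (lam ^ (t + 1))⁻¹ * ((Z (N - t) : ℝ) / lam ^ (N - t))) atTop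
      (𝓝 (realValue lam x (n + 1) * a)) := by
    rw [realValue, Finset.sum_mul]
    exact tendsto_finsetSum _ fun t _ => (tendsto_div_pow_sub hlim t).const_mul _
  have h2 : Tendsto (fun N => (Z (N + 1) : ℝ) / lam ^ (N + 1)) atTop (𝓝 a) :=
    (tendsto_add_atTop_iff_nat 1).2 hlim
  have h3 : ∃ᶠ N in atTop, ∑ t ∈ Finset.range (n + 1),
      x t * (lam ^ (t + 1))⁻¹ * ((Z (N - t) : ℝ) / lam ^ (N - t))
      ≤ (Z (N + 1) : ℝ) / lam ^ (N + 1) := by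
    rw [frequently_atTop]
    intro K
    obtain ⟨j, hj, m, hm⟩ := h K
    refine ⟨j + n, by omega, ?_⟩
    obtain ⟨m', hm', hd⟩ := exists_lt_forall_greedyDigit_eq hZ m (j + n + 1)
    have h4 := sum_greedyDigit hZ (n := n + 1) (N := j + n) (by omega) hm'
    have h5 : ∑ t ∈ Finset.range (n + 1), x t * Z (j + n - t) ≤ Z (j + n + 1) := by
      refine le_trans (le_of_eq (Finset.sum_congr rfl fun t ht => ?_)) (h4.trans hm'.le)
      rw [Finset.mem_range] at ht
      have h6 := hm ⟨t, ht⟩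
      simp only [Fin.val_rev] at h6
      rw [h6, show j + (n + 1 - (t + 1)) = j + n - t by omega, hd _ (by omega)]
    have h7 : ∑ t ∈ Finset.range (n + 1), (x t : ℝ) * Z (j + n - t) ≤ Z (j + n + 1) := by
      exact_mod_cast h5
    rw [le_div_iff₀ (by positivity), Finset.sum_mul]
    refine le_trans (le_of_eq (Finset.sum_congr rfl fun t ht => ?_)) h7
    rw [Finset.mem_range] at ht
    have h8 : lam ^ (j + n + 1) = lam ^ (t + 1) * lam ^ (j + n - t) := by
      rw [← pow_add]; congr 1; omega
    rw [h8]
    field_simp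
  have h4 := le_of_tendsto_of_tendsto_of_frequently h1 h2 h3
  exact le_of_mul_le_mul_right (by rwa [one_mul]) ha

theorem IsGreedySequence.realValue_le_one (hZ : IsZLRR E Z) (hlam : IsDominantRoot E Z lam)
    {x : ℕ → ℕ} (h : IsGreedySequence Z x) (i k : ℕ) : realValue lam (fun j => x (i + j)) k ≤ 1 :=
  IsAdmissible.realValue_le_one hZ hlam (x := fun j => x (i + j)) (h i k)

theorem tendsto_intRoom {a : ℝ} (hl : 0 < lam)
    (h : Tendsto (fun n => (Z n : ℝ) / lam ^ n) atTop (𝓝 a)) (ha : 0 ≤ a) (x : ℕ → ℕ) (k : ℕ) :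
    Tendsto (fun N => intRoom Z N x k / lam ^ (N + 1 - k)) atTop (𝓝 (a * realRoom lam x k)) := by
  induction k with
  | zero =>
    simp only [intRoom, realRoom, mul_one, Nat.sub_zero]
    exact (tendsto_add_atTop_iff_nat 1).2 h
  | succ k ih =>
    have h1 := tendsto_div_pow_sub h k
    have h2 := h1.min ((ih.const_mul lam).sub (h1.const_mul (x k : ℝ)))
    rw [realRoom, mul_min_of_nonneg _ _ ha, mul_one, mul_sub]
    convert h2.congr' ?_ using 2
    · congr 1; ring
    · filter_upwards [eventually_ge_atTop k] with N hN
      have h3 : lam ^ (N + 1 - k) = lam * lam ^ (N - k) := by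
        rw [← pow_succ']; congr 1; omega
      rw [intRoom, Nat.add_sub_add_right, ← min_div_div_right (by positivity), h3, sub_div]
      congr 2
      · field_simp
      · ring

/-- The rescaled integer room tends to a positive multiple of the real room, so it is positive at
all high indices, and remainder 0 realizes the word. -/
theorem isAdmissible_of_realRoom_pos (hZ : IsZLRR E Z) (hlam : IsDominantRoot E Z lam) {x : ℕ → ℕ}
    {n : ℕ} (h : 0 < realRoom lam x n) : IsAdmissible Z fun t : Fin n => x t := by
  have hl : 0 < lam := zero_lt_one.trans hlam.one_lt
  obtain ⟨a, ha, hlim⟩ := hZ.exists_limit hlam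
  intro K
  obtain ⟨N, hN, hNK⟩ := (((tendsto_intRoom hl hlim ha.le x n).eventually_const_lt
    (mul_pos ha h)).and (eventually_ge_atTop (n + K))).exists
  have h1 : 0 < intRoom Z N x n := by
    by_contra! h0
    exact absurd hN (not_lt.2 (div_nonpos_of_nonpos_of_nonneg h0 (by positivity)))
  refine ⟨N + 1 - n, by omega, ∑ k ∈ Finset.range n, x k * Z (N - k) + 0, fun t => ?_⟩
  have ht := t.2
  have := (greedyDigit_sum_add hZ N x (n := n) (by omega) (r := 0) (by simpa using h1) rfl).2.1 t ht
  refine this.symm.trans (congrArg _ ?_)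
  rw [Fin.val_rev]
  omega

theorem isGreedySequence_betaSeq (hZ : IsZLRR E Z) (hlam : IsDominantRoot E Z lam) {z : ℝ}
    (hz : z ∈ Set.Ico (0 : ℝ) 1) : IsGreedySequence Z (betaSeq lam z) := by
  have hl : 0 < lam := zero_lt_one.trans hlam.one_lt
  intro i n
  simp_rw [← betaSeq_iterate]
  have hz' := betaMap_iterate_mem (b := lam) hz i
  exact isAdmissible_of_realRoom_pos hZ hlam
    ((betaMap_iterate_mem hz' n).1.trans_lt (iterate_lt_realRoom hl hz' n))

/-- A free word may be followed by the expansion of any y < 1, and a tail of value y needs room y.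
So the cylinder of a free word has full length lam ^ (-n). -/
theorem IsFree.one_le_realRoom (hZ : IsZLRR E Z) (hlam : IsDominantRoot E Z lam) {n : ℕ}
    {w : Fin n → ℕ} (hw : IsFree Z w) : 1 ≤ realRoom lam (extendZero w) n := by
  have hl : 0 < lam := zero_lt_one.trans hlam.one_lt
  refine le_of_forall_lt fun y' hy' => ?_
  obtain ⟨y, hy1, hy2⟩ := exists_between (max_lt hy' zero_lt_one)
  have hy : y ∈ Set.Ico (0 : ℝ) 1 := ⟨(le_max_right _ _).trans hy1.le, hy2⟩
  refine ((le_max_left _ _).trans_lt hy1).trans_le ?_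
  set X : ℕ → ℕ := fun i => if h : i < n then w ⟨i, h⟩ else betaSeq lam y (i - n) with hX
  have hXadm : ∀ k, IsAdmissible Z fun t : Fin (n + k) => X t := by
    intro k
    have h1 := hw k (fun t => betaSeq lam y t) (by
      simpa using isGreedySequence_betaSeq hZ hlam hy 0 k)
    convert h1 using 1
    funext t
    refine Fin.addCases (fun i => ?_) (fun i => ?_) t
    · simp [hX]
    · simp [hX]
  have h1 : ∀ i k, realValue lam (fun j => X (i + j)) k ≤ 1 := fun i k =>
    IsAdmissible.realValue_le_one hZ hlam (x := fun j => X (i + j))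
      ((hXadm (i + k)).subblock (by omega))
  have h2 : ∀ k, y - (lam ^ k)⁻¹ ≤ realRoom lam (extendZero w) n := by
    intro k
    have h3 := realValue_le_realRoom hl h1 n k
    have h4 : (fun j => X (n + j)) = betaSeq lam y := by
      funext j; simp [hX]
    have h5 : realRoom lam X n = realRoom lam (extendZero w) n :=
      realRoom_congr fun i hi => by simp [hX, extendZero, hi]
    rw [h4, h5] at h3
    have h6 := realValue_add_iterate hl hy.1 k
    have h7 := (betaMap_iterate_mem (b := lam) hy k).2
    have h8 : 0 < (lam ^ k)⁻¹ := by positivity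
    nlinarith
  have h3 : Tendsto (fun k : ℕ => y - (lam ^ k)⁻¹) atTop (𝓝 (y - 0)) :=
    (tendsto_inv_pow hlam.one_lt).const_sub y
  rw [sub_zero] at h3
  exact le_of_tendsto' h3 h2

/-! ### The canonical ensemble -/

theorem ae_mem_Ico_parryMeasure (hb : 1 < lam) : ∀ᵐ z ∂parryMeasure lam, z ∈ Set.Ico (0 : ℝ) 1 := by
  have := isProbabilityMeasure_parryMeasure hb
  have h := parryMeasure_le_initMass_one hb (measurableSet_Ico (a := (0 : ℝ)) (b := 1)).compl
  rw [initMass, Set.inter_compl_self, measureReal_empty, mul_zero] at h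
  have h2 := le_antisymm h measureReal_nonneg
  rw [measureReal_eq_zero_iff, measure_eq_zero_iff_ae_notMem] at h2
  simpa using h2

theorem measurableSet_isGreedySequence : MeasurableSet {x | IsGreedySequence Z x} := by
  have : {x | IsGreedySequence Z x} = ⋂ (i : ℕ) (n : ℕ),
      (fun (x : ℕ → ℕ) (t : Fin n) => x (i + t)) ⁻¹' {w | IsAdmissible Z w} := by
    ext x; simp [IsGreedySequence]
  rw [this]
  refine MeasurableSet.iInter fun i => MeasurableSet.iInter fun n => ?_
  exact (measurable_pi_lambda _ fun t => measurable_pi_apply _) (Set.to_countable _).measurableSet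

theorem isCanonical_betaMeasure (hZ : IsZLRR E Z) (hlam : IsDominantRoot E Z lam) :
    IsCanonical Z lam (betaMeasure lam) := by
  have hb := hlam.one_lt
  have hl : 0 < lam := zero_lt_one.trans hb
  have hm : 0 < parryMass lam := zero_lt_one.trans_le (one_le_parryMass hb)
  have := isProbabilityMeasure_parryMeasure hb
  have hmeas : ∀ {n : ℕ} (x : ℕ → ℕ), MeasurableSet (betaSeq lam ⁻¹' prefixSet n x) :=
    fun x => measurable_betaSeq (measurableSet_prefixSet _ x)
  refine ⟨Measure.isProbabilityMeasure_map measurable_betaSeq.aemeasurable,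
    (ergodic_betaMeasure hb).map_eq, ?_, (parryMass lam)⁻¹, lam / (lam - 1), by positivity, ?_, ?_⟩
  · rw [betaMeasure, ae_map_iff measurable_betaSeq.aemeasurable measurableSet_isGreedySequence]
    filter_upwards [ae_mem_Ico_parryMeasure hb] with z hz using isGreedySequence_betaSeq hZ hlam hz
  · intro n w
    rw [prefixCylinder_eq, betaMeasure_real (measurableSet_prefixSet _ _)]
    refine (parryMeasure_le_initMass_one hb (hmeas _)).trans ?_
    have h1 : 0 < lam - 1 := by linarith
    gcongr
    rw [initMass_prefixSet hl]
    exact max_le (mul_le_of_le_one_right (by positivity) (realRoom_le_one _ _)) (by positivity)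
  · intro n w hw
    rw [prefixCylinder_eq, betaMeasure_real (measurableSet_prefixSet _ _)]
    refine le_trans ?_ (initMass_one_le_parryMeasure hb (hmeas _))
    gcongr
    rw [initMass_prefixSet hl]
    exact (le_mul_of_one_le_right (by positivity) (hw.one_le_realRoom hZ hlam)).trans
      (le_max_left _ _)

/-- In a canonical ensemble the probability of every prefix is at most a constant times its
Lebesgue measure, because a small remainder forces a run of zeros. -/
theorem IsCanonical.prefixSet_le (hZ : IsZLRR E Z) (hlam : IsDominantRoot E Z lam)
    {μ : Measure (ℕ → ℕ)} (hμ : IsCanonical Z lam μ) :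
    ∃ C, ∀ n x, μ.real (prefixSet n x) ≤ C * max ((lam ^ n)⁻¹ * realRoom lam x n) 0 := by
  have hb := hlam.one_lt
  have hl : 0 < lam := zero_lt_one.trans hb
  have := hμ.isProbability
  obtain ⟨c, C, -, hC, -⟩ := hμ.weight
  have hC0 : 0 ≤ C := by
    simpa using measureReal_nonneg.trans (hC 0 Fin.elim0)
  -- A nonzero digit among the next m would have value at least lam ^ (-m), more than the room. The
  -- prefix is thus almost surely followed by m zeros, and the weight bound applies to the longer
  -- word.
  have hzero : ∀ n x m, realRoom lam x n < (lam ^ m)⁻¹ →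
      μ.real (prefixSet n x) ≤ C * (lam ^ (n + m))⁻¹ := by
    intro n x m hs
    set w : Fin (n + m) → ℕ := fun t => if (t : ℕ) < n then x t else 0
    refine le_trans ?_ (hC (n + m) w)
    refine ENNReal.toReal_mono (measure_ne_top _ _) (measure_mono_ae ?_)
    filter_upwards [hμ.greedy] with y hy hyx t
    simp only [w]
    split_ifs with ht
    · exact hyx t ht
    · obtain ⟨j, hj⟩ := Nat.exists_eq_add_of_le (not_lt.1 ht)
      have hjm : j < m := by have := t.2; omega
      have h1 := realValue_le_realRoom hl (hy.realValue_le_one hZ hlam) n (j + 1)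
      rw [realRoom_congr hyx] at h1
      have h2 : (y (n + j) : ℝ) * (lam ^ (j + 1))⁻¹ ≤ realValue lam (fun i => y (n + i)) (j + 1) :=
        Finset.single_le_sum (f := fun k => (y (n + k) : ℝ) * (lam ^ (k + 1))⁻¹)
          (fun _ _ => by positivity) (Finset.self_mem_range_succ j)
      have h3 : (lam ^ m)⁻¹ ≤ (lam ^ (j + 1))⁻¹ :=
        inv_anti₀ (by positivity) (pow_le_pow_right₀ hb.le hjm)
      rw [hj]
      by_contra hne
      have h4 : (1 : ℝ) ≤ y (n + j) := by exact_mod_cast Nat.one_le_iff_ne_zero.2 hne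
      have h5 : (lam ^ (j + 1))⁻¹ ≤ (y (n + j) : ℝ) * (lam ^ (j + 1))⁻¹ :=
        le_mul_of_one_le_left (by positivity) h4
      linarith
  -- The room is located between consecutive powers of `lam`, which costs one factor; the strict
  -- inequality in `hzero` costs the other.
  refine ⟨C * lam ^ 2, fun n x => ?_⟩
  rcases le_or_gt (realRoom lam x n) 0 with h0 | h0
  · have h1 : ∀ m, μ.real (prefixSet n x) ≤ C * (lam ^ n)⁻¹ * (lam ^ m)⁻¹ := fun m => by
      have := hzero n x m (h0.trans_lt (by positivity))
      rwa [pow_add, mul_inv, ← mul_assoc] at this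
    have h2 := ge_of_tendsto' ((tendsto_inv_pow hb).const_mul (C * (lam ^ n)⁻¹)) h1
    rw [mul_zero] at h2
    exact h2.trans (by positivity)
  · have h1 : 1 ≤ (realRoom lam x n)⁻¹ := (one_le_inv₀ h0).2 (realRoom_le_one x n)
    obtain ⟨m, hm1, hm2⟩ := exists_nat_pow_near h1 hb
    have hm3 : realRoom lam x n ≤ (lam ^ m)⁻¹ := by
      rwa [le_inv_comm₀ h0 (by positivity)]
    have hm4 : (lam ^ (m + 1))⁻¹ ≤ realRoom lam x n := by
      rw [inv_le_comm₀ (by positivity) h0]; exact hm2.le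
    refine le_trans ?_ (mul_le_mul_of_nonneg_left (le_max_left _ _) (by positivity))
    have h3 : ∃ k, μ.real (prefixSet n x) ≤ C * (lam ^ (n + k))⁻¹ ∧
        (lam ^ k)⁻¹ ≤ lam ^ 2 * realRoom lam x n := by
      rcases m with _ | m
      · refine ⟨0, ?_, ?_⟩
        · have := hC n (firstTerms n x)
          rwa [← prefixSet_eq_prefixCylinder] at this
        · calc (lam ^ 0)⁻¹ ≤ lam * (lam * (lam ^ (0 + 1))⁻¹) := by
                rw [zero_add, pow_one, mul_inv_cancel₀ hl.ne']; simpa using hb.le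
            _ ≤ lam * (lam * realRoom lam x n) := by gcongr
            _ = _ := by ring
      · refine ⟨m, hzero n x m (hm3.trans_lt
          (inv_strictAnti₀ (by positivity) (pow_lt_pow_right₀ hb (Nat.lt_succ_self m)))), ?_⟩
        calc (lam ^ m)⁻¹ = lam ^ 2 * (lam ^ (m + 1 + 1))⁻¹ := by field_simp; ring
          _ ≤ _ := by gcongr
    obtain ⟨k, hk1, hk2⟩ := h3
    calc μ.real (prefixSet n x) ≤ C * (lam ^ (n + k))⁻¹ := hk1
      _ = C * (lam ^ n)⁻¹ * (lam ^ k)⁻¹ := by rw [pow_add, mul_inv]; ring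
      _ ≤ C * (lam ^ n)⁻¹ * (lam ^ 2 * realRoom lam x n) := by gcongr
      _ = _ := by ring

/-- The domination by Lebesgue measure on cylinders gives absolute continuity, and an invariant
probability measure absolutely continuous with respect to an ergodic one equals it. -/
theorem IsCanonical.eq_betaMeasure (hZ : IsZLRR E Z) (hlam : IsDominantRoot E Z lam)
    {μ : Measure (ℕ → ℕ)} (hμ : IsCanonical Z lam μ) : μ = betaMeasure lam := by
  have hb := hlam.one_lt
  have hl : 0 < lam := zero_lt_one.trans hb
  have hm : 0 < parryMass lam := zero_lt_one.trans_le (one_le_parryMass hb)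
  have h1 := hμ.isProbability
  have h2 := (isCanonical_betaMeasure hZ hlam).isProbability
  obtain ⟨C, hC⟩ := hμ.prefixSet_le hZ hlam
  have hle : μ ≤ ENNReal.ofReal (|C| * parryMass lam) • betaMeasure lam := by
    have : IsFiniteMeasure (ENNReal.ofReal (|C| * parryMass lam) • betaMeasure lam) :=
      Measure.smul_finite _ ENNReal.ofReal_ne_top
    refine measure_le_of_prefixSet_le fun n x => ?_
    have h3 := hC n x
    rw [← initMass_prefixSet hl] at h3
    have h4 := initMass_one_le_parryMeasure hb
      (measurable_betaSeq (b := lam) (measurableSet_prefixSet n x))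
    rw [← betaMeasure_real (measurableSet_prefixSet n x), inv_mul_le_iff₀ hm] at h4
    rw [Measure.smul_apply, smul_eq_mul, ← ofReal_measureReal (μ := μ),
      ← ofReal_measureReal (μ := betaMeasure lam), ← ENNReal.ofReal_mul (by positivity)]
    refine ENNReal.ofReal_le_ofReal ?_
    calc _ ≤ _ := h3
      _ ≤ |C| * initMass 1 (betaSeq lam ⁻¹' prefixSet n x) :=
        mul_le_mul_of_nonneg_right (le_abs_self C) (initMass_nonneg _ _)
      _ ≤ |C| * (parryMass lam * (betaMeasure lam).real (prefixSet n x)) := by gcongr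
      _ = _ := by ring
  refine (ergodic_betaMeasure hb).eq_of_absolutelyContinuous ⟨measurable_seqTail, hμ.stationary⟩ ?_
  exact (Measure.absolutelyContinuous_of_le hle).trans (Measure.smul_absolutelyContinuous)

end

section

variable {E : LinearRecurrence ℤ} {Z : ℕ → ℕ} {lam : ℝ}

/-! ### Comparison of the microcanonical ensemble with the Lebesgue measure -/

theorem measurable_greedySeq (N : ℕ) : Measurable (greedySeq Z N) := measurable_from_top

theorem microcanonical_apply {N : ℕ} {A : Set (ℕ → ℕ)} (hA : MeasurableSet A) :
    microcanonical Z N A = (Measure.count (Set.Ico (Z N) (Z (N + 1))))⁻¹ *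
      Measure.count (Set.Ico (Z N) (Z (N + 1)) ∩ greedySeq Z N ⁻¹' A) := by
  rw [microcanonical, Measure.map_apply (measurable_greedySeq N) hA, ProbabilityTheory.uniformOn,
    ProbabilityTheory.cond_apply measurableSet_Ico]

theorem count_Ico (a b : ℕ) : (Measure.count (Set.Ico a b) : ENNReal) = ((b - a : ℕ) : ENNReal) := by
  rw [← Finset.coe_Ico, Measure.count_apply_finset, Nat.card_Ico]

theorem isProbabilityMeasure_microcanonical {N : ℕ} (h : Z N < Z (N + 1)) :
    IsProbabilityMeasure (microcanonical Z N) := by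
  have : IsProbabilityMeasure (ProbabilityTheory.uniformOn (Set.Ico (Z N) (Z (N + 1)))) :=
    ProbabilityTheory.isProbabilityMeasure_uniformOn (Set.finite_Ico _ _) ⟨Z N, le_rfl, h⟩
  exact Measure.isProbabilityMeasure_map (measurable_greedySeq N).aemeasurable

/-- Each natural number r below the room yields a different integer with this prefix; the nonzero
first digit places it at or above Z N. Only this inequality is needed, as the converse will follow
by complementation. -/
theorem intRoom_le_microcanonical (hZ : IsZLRR E Z) {N n : ℕ} {x : ℕ → ℕ} (h : Z N < Z (N + 1))
    (hn : n ≤ N + 1) (hn0 : 0 < n) (hx : 1 ≤ x 0) :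
    intRoom Z N x n / ((Z (N + 1) : ℝ) - Z N) ≤ (microcanonical Z N).real (prefixSet n x) := by
  have hd : (0 : ℝ) < (Z (N + 1) : ℝ) - Z N := by
    have : (Z N : ℝ) < Z (N + 1) := by exact_mod_cast h
    linarith
  rw [measureReal_def, microcanonical_apply (measurableSet_prefixSet n x), count_Ico,
    ENNReal.toReal_mul, ENNReal.toReal_inv, ENNReal.toReal_natCast, Nat.cast_sub h.le,
    inv_mul_eq_div]
  refine div_le_div_of_nonneg_right ?_ hd.le
  set s := ∑ k ∈ Finset.range n, x k * Z (N - k)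
  set F : Finset ℕ := (Finset.range ⌈intRoom Z N x n⌉₊).map (addLeftEmbedding s) with hF
  have hsub : (F : Set ℕ) ⊆ Set.Ico (Z N) (Z (N + 1)) ∩ greedySeq Z N ⁻¹' prefixSet n x := by
    intro m hm
    simp only [hF, Finset.coe_map, Set.mem_image, Finset.mem_coe, Finset.mem_range,
      addLeftEmbedding_apply, Nat.lt_ceil] at hm
    obtain ⟨r, hr, rfl⟩ := hm
    obtain ⟨h1, h2, -⟩ := greedyDigit_sum_add hZ N x hn hr rfl
    refine ⟨⟨?_, h1⟩, fun i hi => ?_⟩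
    · have h3 : x 0 * Z (N - 0) ≤ s :=
        Finset.single_le_sum (f := fun k => x k * Z (N - k)) (fun _ _ => Nat.zero_le _)
          (Finset.mem_range.2 hn0)
      rw [Nat.sub_zero] at h3
      nlinarith [Nat.zero_le (Z N)]
    · rw [greedySeq, if_pos (by omega)]
      exact h2 i hi
  have hcount : (⌈intRoom Z N x n⌉₊ : ENNReal)
      ≤ Measure.count (Set.Ico (Z N) (Z (N + 1)) ∩ greedySeq Z N ⁻¹' prefixSet n x) := by
    refine le_trans (le_of_eq ?_) (measure_mono hsub)
    rw [Measure.count_apply_finset, hF, Finset.card_map, Finset.card_range]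
  have hfin : Measure.count (Set.Ico (Z N) (Z (N + 1)) ∩ greedySeq Z N ⁻¹' prefixSet n x)
      ≠ (⊤ : ENNReal) := by
    refine ((measure_mono Set.inter_subset_left).trans_lt ?_).ne
    rw [count_Ico]
    exact ENNReal.natCast_lt_top _
  calc intRoom Z N x n ≤ (⌈intRoom Z N x n⌉₊ : ℝ) := Nat.le_ceil _
    _ = (⌈intRoom Z N x n⌉₊ : ENNReal).toReal := (ENNReal.toReal_natCast _).symm
    _ ≤ _ := ENNReal.toReal_mono hfin hcount

/-- Resolves the nested minima: i is the last position at which the room was reset to a full term.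
-/
theorem exists_intRoom_eq (N : ℕ) (x : ℕ → ℕ) (k : ℕ) :
    ∃ i j, i + j = k ∧ intRoom Z N x k
      = Z (N + 1 - i) - ∑ t ∈ Finset.range j, (x (i + t) : ℝ) * Z (N - (i + t)) := by
  induction k with
  | zero => exact ⟨0, 0, rfl, by simp [intRoom]⟩
  | succ k ih =>
    obtain ⟨i, j, hij, h⟩ := ih
    rcases min_choice (Z (N - k) : ℝ) (intRoom Z N x k - x k * Z (N - k)) with h1 | h1
    · exact ⟨k + 1, 0, rfl, by rw [intRoom, h1, Nat.add_sub_add_right]; simp⟩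
    · refine ⟨i, j + 1, by omega, ?_⟩
      rw [intRoom, h1, h, Finset.sum_range_succ, hij]
      ring

/-- For the real room any reset position gives an upper bound, in particular the one found in
`exists_intRoom_eq` for the integer room. -/
theorem realRoom_add_le (hl : 0 < lam) (x : ℕ → ℕ) (i j : ℕ) :
    realRoom lam x (i + j) ≤ lam ^ j * (1 - realValue lam (fun t => x (i + t)) j) := by
  induction j with
  | zero => simpa [realValue] using realRoom_le_one x i
  | succ j ih =>
    have h1 : realRoom lam x (i + (j + 1)) ≤ lam * realRoom lam x (i + j) - x (i + j) :=
      min_le_right _ _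
    have h2 := mul_le_mul_of_nonneg_left ih hl.le
    have h3 : realValue lam (fun t => x (i + t)) (j + 1)
        = realValue lam (fun t => x (i + t)) j + x (i + j) * (lam ^ (j + 1))⁻¹ := by
      rw [realValue, Finset.sum_range_succ, ← realValue]
    have h4 : lam ^ (j + 1) * (x (i + j) * (lam ^ (j + 1))⁻¹) = x (i + j) := by field_simp
    rw [h3, ← sub_sub, mul_sub, h4, pow_succ']
    linarith

/-- Away from the boundary the integer count of continuations is at least the real one, up to a
small relative error. -/
theorem intRoom_ge {a C r B δ : ℝ} (hl : 0 < lam) (ha : 0 < a) (hC : 0 < C) (hr1 : 1 < r)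
    (hB : 0 ≤ B) (hδ : 0 < δ) (hδ1 : δ ≤ 1)
    (hZr : ∀ n, |(Z n : ℝ) - a * lam ^ n| ≤ C * r ^ n) {N k : ℕ} (hk : k ≤ N) {x : ℕ → ℕ}
    (hx : ∀ i, (x i : ℝ) ≤ B)
    (hgood : ∀ i j, i ≤ k → C * (1 + B * (r - 1)⁻¹) / (δ * a) * (r / lam) ^ (N + 1 - i)
      ≤ 1 - realValue lam (fun t => x (i + t)) j) :
    (1 - δ) * (a * lam ^ (N + 1 - k)) * realRoom lam x k ≤ intRoom Z N x k := by
  obtain ⟨i, j, rfl, h⟩ := exists_intRoom_eq (Z := Z) N x k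
  obtain ⟨M, hM⟩ : ∃ M, N + 1 = i + M := ⟨N + 1 - i, by omega⟩
  have hMi : N + 1 - i = M := by omega
  have hMj : j ≤ M := by omega
  set V := realValue lam (fun t => x (i + t)) j with hV
  have hr0 : 0 < r := by linarith
  have h1 : (Z (N + 1 - i) : ℝ) ≥ a * lam ^ M - C * r ^ M := by
    rw [hMi]; linarith [(abs_le.1 (hZr M)).1]
  have h2 : ∀ t ∈ Finset.range j, (x (i + t) : ℝ) * Z (N - (i + t))
      ≤ a * lam ^ M * (x (i + t) * (lam ^ (t + 1))⁻¹)
        + B * C * r ^ M * r⁻¹ * (r ^ t)⁻¹ := by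
    intro t ht
    rw [Finset.mem_range] at ht
    obtain ⟨u, hu⟩ : ∃ u, M = t + 1 + u := ⟨M - (t + 1), by omega⟩
    have hu' : N - (i + t) = u := by omega
    have h3 := (abs_le.1 (hZr u)).2
    have h4 : (x (i + t) : ℝ) * (C * r ^ u) ≤ B * (C * r ^ u) :=
      mul_le_mul_of_nonneg_right (hx _) (by positivity)
    have h5 : (x (i + t) : ℝ) * (Z u - a * lam ^ u) ≤ x (i + t) * (C * r ^ u) :=
      mul_le_mul_of_nonneg_left h3 (by positivity)
    have h6 : a * lam ^ M * (x (i + t) * (lam ^ (t + 1))⁻¹) = x (i + t) * (a * lam ^ u) := by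
      rw [hu, pow_add]; field_simp
    have h7 : B * C * r ^ M * r⁻¹ * (r ^ t)⁻¹ = B * (C * r ^ u) := by
      rw [hu, pow_add, pow_succ]; field_simp
    rw [hu', h6, h7]
    linarith
  have h3 := Finset.sum_le_sum h2
  rw [Finset.sum_add_distrib, ← Finset.mul_sum, ← Finset.mul_sum] at h3
  have h4 : ∑ t ∈ Finset.range j, (r ^ t)⁻¹ ≤ r / (r - 1) := by
    rw [← tsum_inv_pow hr1]
    exact (summable_inv_pow hr1).sum_le_tsum _ fun _ _ => by positivity
  have h5 : B * C * r ^ M * r⁻¹ * ∑ t ∈ Finset.range j, (r ^ t)⁻¹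
      ≤ C * r ^ M * (B * (r - 1)⁻¹) := by
    have h6 : 0 < r - 1 := by linarith
    calc _ ≤ B * C * r ^ M * r⁻¹ * (r / (r - 1)) := by gcongr
      _ = _ := by field_simp
  have h6 : ∑ t ∈ Finset.range j, (x (i + t) : ℝ) * (lam ^ (t + 1))⁻¹ = V := rfl
  rw [h6] at h3
  have h7 := hgood i j (by omega)
  rw [hMi, ← hV] at h7
  -- The absolute error is of order r ^ M, while the main term is a lam ^ M (1 - V); `hgood` says
  -- precisely that 1 - V is large enough to absorb it at relative cost δ.
  have h8 : C * r ^ M * (1 + B * (r - 1)⁻¹) ≤ δ * (a * lam ^ M * (1 - V)) := by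
    have h9 := mul_le_mul_of_nonneg_left h7 (by positivity : 0 ≤ δ * (a * lam ^ M))
    calc _ = δ * (a * lam ^ M) * (C * (1 + B * (r - 1)⁻¹) / (δ * a) * (r / lam) ^ M) := by
          rw [div_pow]; field_simp
      _ ≤ _ := h9
      _ = _ := by ring
  have h9 := realRoom_add_le hl x i j
  have h10 : lam ^ M = lam ^ (N + 1 - (i + j)) * lam ^ j := by rw [← pow_add]; congr 1; omega
  calc (1 - δ) * (a * lam ^ (N + 1 - (i + j))) * realRoom lam x (i + j)
      ≤ (1 - δ) * (a * lam ^ (N + 1 - (i + j))) * (lam ^ j * (1 - V)) :=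
        mul_le_mul_of_nonneg_left h9 (mul_nonneg (by linarith) (by positivity))
    _ = (1 - δ) * (a * lam ^ M * (1 - V)) := by rw [h10]; ring
    _ ≤ _ := by rw [h]; linarith

/-- The probability of a set under the uniform distribution on `[lam⁻¹, 1)`. -/
def topMass (lam : ℝ) (A : Set ℝ) : ℝ :=
  (1 - lam⁻¹)⁻¹ * volume.real (Set.Ico lam⁻¹ 1 ∩ A)

theorem topMass_univ (hb : 1 < lam) : topMass lam Set.univ = 1 := by
  have h1 : lam⁻¹ < 1 := inv_lt_one_of_one_lt₀ hb
  rw [topMass, Set.inter_univ, Real.volume_real_Ico_of_le h1.le]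
  exact inv_mul_cancel₀ (by linarith)

theorem topMass_add_compl (hb : 1 < lam) {A : Set ℝ} (hA : MeasurableSet A) :
    topMass lam A + topMass lam Aᶜ = 1 := by
  rw [← topMass_univ hb, topMass, topMass, topMass, ← mul_add, Set.inter_univ, ← Set.sdiff_eq,
    measureReal_inter_add_sdiff hA measure_Ico_lt_top.ne]

/-- On [0, lam⁻¹) the map is multiplication by `lam`, so the part removed from [0, 1) is a scaled
copy of the previous iterate. -/
theorem topMass_preimage_iterate (hb : 1 < lam) {A : Set ℝ} (hA : MeasurableSet A) (n : ℕ) :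
    topMass lam ((betaMap lam)^[n + 1] ⁻¹' A) = (1 - lam⁻¹)⁻¹ *
      (initMass 1 ((betaMap lam)^[n + 1] ⁻¹' A) - lam⁻¹ * initMass 1 ((betaMap lam)^[n] ⁻¹' A)) := by
  have hl : 0 < lam := by linarith
  have h1 : lam⁻¹ < 1 := inv_lt_one_of_one_lt₀ hb
  have hl' : 0 ≤ lam⁻¹ := by positivity
  have hA' : MeasurableSet ((betaMap lam)^[n + 1] ⁻¹' A) := measurable_betaMap.iterate _ hA
  have hAn : MeasurableSet ((betaMap lam)^[n] ⁻¹' A) := measurable_betaMap.iterate _ hA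
  have h2 : initMass 1 ((betaMap lam)^[n + 1] ⁻¹' A) = initMass lam⁻¹ ((betaMap lam)^[n + 1] ⁻¹' A)
      + volume.real (Set.Ico lam⁻¹ 1 ∩ (betaMap lam)^[n + 1] ⁻¹' A) := by
    rw [initMass, initMass, ← Set.Ico_union_Ico_eq_Ico hl' h1.le, Set.union_inter_distrib_right,
      measureReal_union _ (measurableSet_Ico.inter hA') (volume_Ico_inter_ne_top _ _ _)
        (volume_Ico_inter_ne_top _ _ _)]
    exact (Set.Ico_disjoint_Ico_same).mono Set.inter_subset_left Set.inter_subset_left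
  have h3 : initMass lam⁻¹ ((betaMap lam)^[n + 1] ⁻¹' A)
      = lam⁻¹ * initMass 1 ((betaMap lam)^[n] ⁻¹' A) := by
    rw [Function.iterate_succ, Set.preimage_comp, initMass_preimage hl hAn hl', betaMap,
      mul_inv_cancel₀ hl.ne']
    simp [initMass]
  rw [topMass, ← h3, h2]
  ring

end

/-! ### Total variation comparison of the digits away from both ends. -/

section

variable {E : LinearRecurrence ℤ} {Z : ℕ → ℕ} {lam : ℝ}

/-- The real numbers whose orbit under the beta-transformation comes close to `1` in the first `n`
steps, the distance `θ i` being allowed to depend on the step. -/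
def nearOne (lam : ℝ) (θ : ℕ → ℝ) (n : ℕ) : Set ℝ :=
  ⋃ i ∈ Finset.range (n + 1), (betaMap lam)^[i] ⁻¹' Set.Ioi (1 - θ i)

theorem measurableSet_nearOne (θ : ℕ → ℝ) (n : ℕ) : MeasurableSet (nearOne lam θ n) :=
  Finset.measurableSet_biUnion _ fun i _ => measurable_betaMap.iterate i measurableSet_Ioi

/-- Union bound; each iterate distributes Lebesgue measure with density bounded by a constant
independent of the step. -/
theorem initMass_nearOne_le (hb : 1 < lam) {θ : ℕ → ℝ} (hθ : ∀ i, 0 ≤ θ i) (n : ℕ) :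
    initMass 1 (nearOne lam θ n)
      ≤ parryMass lam * (lam / (lam - 1)) * ∑ i ∈ Finset.range (n + 1), θ i := by
  have hm : 0 < parryMass lam := zero_lt_one.trans_le (one_le_parryMass hb)
  have h1 : 0 < lam - 1 := by linarith
  rw [initMass, nearOne, Set.inter_iUnion₂, Finset.mul_sum]
  refine (measureReal_biUnion_finset_le _ _).trans (Finset.sum_le_sum fun i _ => ?_)
  refine (initMass_one_preimage_iterate_le hb measurableSet_Ioi i).trans ?_
  gcongr
  have h2 : Set.Ico (0 : ℝ) 1 ∩ Set.Ioi (1 - θ i) ⊆ Set.Ioo (1 - θ i) 1 :=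
    fun z hz => ⟨hz.2, hz.1.2⟩
  calc _ ≤ volume.real (Set.Ioo (1 - θ i) 1) := measureReal_mono h2 measure_Ioo_lt_top.ne
    _ = θ i := by rw [Real.volume_real_Ioo_of_le (by linarith [hθ i])]; ring

/-- Both sides are compared cylinder by cylinder. One factor 1 - δ pays for `intRoom_ge`, the other
for replacing Z (N + 1) - Z N by its asymptotic value. -/
theorem topMass_le_microcanonical (hZ : IsZLRR E Z) {a C r δ : ℝ} (hb : 1 < lam) (ha : 0 < a)
    (hC : 0 < C) (hr1 : 1 < r) (hδ : 0 < δ) (hδ1 : δ ≤ 1)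
    (hZr : ∀ n, |(Z n : ℝ) - a * lam ^ n| ≤ C * r ^ n) {N n : ℕ} (hn : n ≤ N) (hn0 : 0 < n)
    (hN : Z N < Z (N + 1))
    (hNδ : (1 - δ) * ((Z (N + 1) : ℝ) - Z N) ≤ a * (1 - lam⁻¹) * lam ^ (N + 1))
    (S : Set (Fin n → ℕ)) :
    (1 - δ) ^ 2 * topMass lam (betaSeq lam ⁻¹' (firstTerms n ⁻¹' S) \ nearOne lam
      (fun i => C * (1 + lam * (r - 1)⁻¹) / (δ * a) * (r / lam) ^ (N + 1 - i)) n)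
      ≤ (microcanonical Z N).real (firstTerms n ⁻¹' S) := by
  have hl : 0 < lam := by linarith
  have hl1 : 0 < 1 - lam⁻¹ := by linarith [inv_lt_one_of_one_lt₀ hb]
  have hprob := isProbabilityMeasure_microcanonical hN
  have hd : (0 : ℝ) < (Z (N + 1) : ℝ) - Z N := by
    have : (Z N : ℝ) < Z (N + 1) := by exact_mod_cast hN
    linarith
  set θ : ℕ → ℝ := fun i => C * (1 + lam * (r - 1)⁻¹) / (δ * a) * (r / lam) ^ (N + 1 - i) with hθ
  set G : Set ℝ := Set.Ico lam⁻¹ 1 \ nearOne lam θ n with hG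
  have hGm : MeasurableSet G := measurableSet_Ico.diff (measurableSet_nearOne θ n)
  have hG01 : G ⊆ Set.Ico 0 1 := fun z hz => ⟨(inv_nonneg.2 hl.le).trans hz.1.1, hz.1.2⟩
  set c := (1 - δ) ^ 2 * (1 - lam⁻¹)⁻¹ with hc
  have hc0 : 0 ≤ c := by positivity
  set κ : Measure (ℕ → ℕ) := ENNReal.ofReal c • (volume.restrict G).map (betaSeq lam) with hκ
  have hκA : ∀ A : Set (ℕ → ℕ), MeasurableSet A →
      κ A = ENNReal.ofReal c * volume (betaSeq lam ⁻¹' A ∩ G) := fun A hA => by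
    rw [hκ, Measure.smul_apply, Measure.map_apply measurable_betaSeq hA,
      Measure.restrict_apply (measurable_betaSeq hA), smul_eq_mul]
  have hcyl : ∀ x, κ (prefixSet n x) ≤ microcanonical Z N (prefixSet n x) := by
    intro x
    rw [hκA _ (measurableSet_prefixSet n x)]
    -- A cylinder meeting the good set G is represented by the digits of a point z of G; the orbit
    -- of z staying away from 1 supplies the hypothesis of `intRoom_ge`.
    rcases (betaSeq lam ⁻¹' prefixSet n x ∩ G).eq_empty_or_nonempty with h | ⟨z, hz1, hz2⟩
    · rw [h]; simp
    have hz := hG01 hz2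
    have heq : prefixSet n x = prefixSet n (betaSeq lam z) := by
      ext y
      exact forall₂_congr fun i hi => by rw [← hz1 i hi]
    rw [heq]
    have hroom : 0 ≤ realRoom lam (betaSeq lam z) n :=
      (betaMap_iterate_nonneg hz.1 n).trans (iterate_lt_realRoom hl hz n).le
    have hx0 : 1 ≤ betaSeq lam z 0 := by
      refine Nat.le_floor ?_
      have := mul_le_mul_of_nonneg_left hz2.1.1 hl.le
      rw [mul_inv_cancel₀ hl.ne'] at this
      simpa using this
    have h1 := intRoom_le_microcanonical hZ hN (n := n) (by omega) hn0 hx0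
    have h2 := intRoom_ge hl ha hC hr1 hl.le hδ hδ1 hZr hn (x := betaSeq lam z)
      (fun i => by
        have h3 : (betaSeq lam z i : ℝ) ≤ (⌊lam⌋₊ : ℝ) := by
          exact_mod_cast betaSeq_le hl hz.2.le i
        exact h3.trans (Nat.floor_le hl.le))
      (fun i j hi => by
        have h3 : z ∉ (betaMap lam)^[i] ⁻¹' Set.Ioi (1 - θ i) := fun h =>
          hz2.2 (Set.mem_biUnion (Finset.mem_coe.2 (Finset.mem_range.2 (by omega))) h)
        simp only [Set.mem_preimage, Set.mem_Ioi, not_lt] at h3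
        have h4 := realValue_add_iterate hl (betaMap_iterate_nonneg (b := lam) hz.1 i) j
        have h5 : betaSeq lam ((betaMap lam)^[i] z) = fun t => betaSeq lam z (i + t) :=
          funext fun t => betaSeq_iterate z i t
        rw [h5] at h4
        have h6 := betaMap_iterate_nonneg (b := lam) (betaMap_iterate_nonneg (b := lam) hz.1 i) j
        have h7 : 0 ≤ (lam ^ j)⁻¹ * (betaMap lam)^[j] ((betaMap lam)^[i] z) := by positivity
        simp only [hθ] at h3
        linarith)
    rw [← ofReal_measureReal (μ := microcanonical Z N)]
    calc ENNReal.ofReal c * volume (betaSeq lam ⁻¹' prefixSet n (betaSeq lam z) ∩ G)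
        ≤ ENNReal.ofReal c * ENNReal.ofReal ((lam ^ n)⁻¹ * realRoom lam (betaSeq lam z) n) := by
          rw [← volume_prefixSet hl, Set.inter_comm]
          gcongr
      _ = ENNReal.ofReal (c * ((lam ^ n)⁻¹ * realRoom lam (betaSeq lam z) n)) :=
          (ENNReal.ofReal_mul hc0).symm
      _ ≤ _ := ENNReal.ofReal_le_ofReal (le_trans ?_ h1)
    rw [le_div_iff₀ hd]
    refine le_trans ?_ h2
    have h8 : lam ^ (N + 1) = lam ^ n * lam ^ (N + 1 - n) := by rw [← pow_add]; congr 1; omega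
    have h9 : (1 - δ) * (1 - lam⁻¹)⁻¹ * (lam ^ n)⁻¹ * ((1 - δ) * ((Z (N + 1) : ℝ) - Z N))
        ≤ (1 - δ) * (1 - lam⁻¹)⁻¹ * (lam ^ n)⁻¹ * (a * (1 - lam⁻¹) * lam ^ (N + 1)) := by
      have : 0 ≤ 1 - δ := by linarith
      gcongr
    have h10 : (1 - δ) * (1 - lam⁻¹)⁻¹ * (lam ^ n)⁻¹ * (a * (1 - lam⁻¹) * lam ^ (N + 1))
        = (1 - δ) * (a * lam ^ (N + 1 - n)) := by
      have h11 : ∀ q p M : ℝ, q ≠ 0 → p ≠ 0 →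
          (1 - δ) * q⁻¹ * p⁻¹ * (a * q * (p * M)) = (1 - δ) * (a * M) := by
        intro q p M hq hp; field_simp
      rw [h8]
      exact h11 _ _ _ hl1.ne' (by positivity)
    rw [h10] at h9
    calc _ = ((1 - δ) * (1 - lam⁻¹)⁻¹ * (lam ^ n)⁻¹ * ((1 - δ) * ((Z (N + 1) : ℝ) - Z N)))
          * realRoom lam (betaSeq lam z) n := by rw [hc]; ring
      _ ≤ _ := mul_le_mul_of_nonneg_right h9 hroom
  have hS : MeasurableSet S := (Set.to_countable S).measurableSet
  have hSm := measurable_firstTerms n hS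
  have h1 := map_firstTerms_le hcyl S
  rw [Measure.map_apply (measurable_firstTerms n) hS,
    Measure.map_apply (measurable_firstTerms n) hS, hκA _ hSm] at h1
  have h2 := ENNReal.toReal_mono (measure_ne_top _ _) h1
  rw [ENNReal.toReal_mul, ENNReal.toReal_ofReal hc0, ← measureReal_def, ← measureReal_def] at h2
  refine le_trans (le_of_eq ?_) h2
  have h3 : ∀ A : Set ℝ, Set.Ico lam⁻¹ 1 ∩ (A \ nearOne lam θ n) = A ∩ G := fun A => by
    rw [hG, ← Set.inter_sdiff_assoc, ← Set.inter_sdiff_assoc, Set.inter_comm]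
  rw [topMass, hc, h3, mul_assoc]

theorem exists_forall_topMass_sub_le (hZ : IsZLRR E Z) (hlam : IsDominantRoot E Z lam) {ε : ℝ}
    (hε : 0 < ε) : ∃ K₀, ∀ K ≥ K₀, ∀ᶠ N in atTop, Z N < Z (N + 1) ∧
      ∀ S : Set (Fin (N + 1 - K) → ℕ),
        topMass lam (betaSeq lam ⁻¹' (firstTerms (N + 1 - K) ⁻¹' S)) - ε
          ≤ (microcanonical Z N).real (firstTerms (N + 1 - K) ⁻¹' S) := by
  have hb := hlam.one_lt
  have hl : 0 < lam := by linarith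
  have hl1 : 0 < 1 - lam⁻¹ := by linarith [inv_lt_one_of_one_lt₀ hb]
  have hm : 0 < parryMass lam := zero_lt_one.trans_le (one_le_parryMass hb)
  have hlm : 0 < lam - 1 := by linarith
  obtain ⟨a, C, r, ha, hC, hr1, hr2, hZr⟩ := hZ.exists_asymptotics hlam
  have hr0 : 0 < r := by linarith
  have hr3 : 0 < r - 1 := by linarith
  have hlim := tendsto_div_pow hr1 hr2 hZr
  set δ := min (1 / 2) (ε / 4)
  have hδ : 0 < δ := by positivity
  have hδ1 : δ ≤ 1 / 2 := min_le_left _ _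
  have hδ2 : δ ≤ ε / 4 := min_le_right _ _
  set ρ := r / lam
  have hρ0 : 0 < ρ := by positivity
  have hρ1 : ρ < 1 := (div_lt_one hl).2 hr2
  set c₀ := C * (1 + lam * (r - 1)⁻¹) / (δ * a)
  have hc₀0 : 0 < c₀ := by positivity
  -- The forbidden distances from 1 form a geometric progression ending at order ρ ^ K, so D ρ ^ K
  -- bounds the mass of the exceptional set. Half of ε is spent on it and half on (1 - δ)² ≥ 1 - 2
  -- δ.
  set D := (1 - lam⁻¹)⁻¹ * (parryMass lam * (lam / (lam - 1))) * c₀ * (1 - ρ)⁻¹ with hD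
  have hDlim : Tendsto (fun K : ℕ => D * ρ ^ K) atTop (𝓝 (D * 0)) :=
    (tendsto_pow_atTop_nhds_zero_of_lt_one hρ0.le hρ1).const_mul D
  obtain ⟨K₀, hK₀⟩ := eventually_atTop.1 ((hDlim.eventually_lt_const
    (by rw [mul_zero]; positivity : D * 0 < ε / 2)).and (eventually_ge_atTop 1))
  refine ⟨K₀, fun K hK => ?_⟩
  obtain ⟨hKε, hK1⟩ := hK₀ K hK
  have hdlim : Tendsto (fun N => ((Z (N + 1) : ℝ) - Z N) / lam ^ (N + 1)) atTop
      (𝓝 (a * (1 - lam⁻¹))) := by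
    have h1 := ((tendsto_add_atTop_iff_nat 1).2 hlim).sub (hlim.mul_const lam⁻¹)
    rw [mul_one_sub]
    refine h1.congr fun N => ?_
    rw [pow_succ, sub_div]
    field_simp
  have hlt : a * (1 - lam⁻¹) < a * (1 - lam⁻¹) / (1 - δ) := by
    rw [lt_div_iff₀ (by linarith)]
    have : 0 < a * (1 - lam⁻¹) := by positivity
    nlinarith
  filter_upwards [hdlim.eventually_lt_const hlt, hdlim.eventually_const_lt
    (by positivity : 0 < a * (1 - lam⁻¹)), eventually_ge_atTop K] with N hN1 hN2 hNK
  have hN : Z N < Z (N + 1) := by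
    have h1 : (0 : ℝ) < (Z (N + 1) : ℝ) - Z N := by
      by_contra! h0
      exact absurd hN2 (not_lt.2 (div_nonpos_of_nonpos_of_nonneg h0 (by positivity)))
    have h2 : (Z N : ℝ) < Z (N + 1) := by linarith
    exact_mod_cast h2
  refine ⟨hN, ?_⟩
  set n := N + 1 - K
  intro S
  rw [div_lt_div_iff₀ (by positivity) (by linarith)] at hN1
  have h1 := topMass_le_microcanonical hZ hb ha hC hr1 hδ (by linarith) hZr
    (by omega : n ≤ N) (by omega) hN (by linarith) S
  refine le_trans ?_ h1
  set A := betaSeq lam ⁻¹' (firstTerms n ⁻¹' S)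
  set B := nearOne lam (fun i => C * (1 + lam * (r - 1)⁻¹) / (δ * a) * (r / lam) ^ (N + 1 - i)) n
    with hB
  have hBm : topMass lam B ≤ ε / 2 := by
    have h2 := initMass_nearOne_le hb (θ := fun i => c₀ * ρ ^ (N + 1 - i))
      (fun i => by positivity) n
    have h3 : ∑ i ∈ Finset.range (n + 1), c₀ * ρ ^ (N + 1 - i) ≤ c₀ * (ρ ^ K * (1 - ρ)⁻¹) := by
      rw [← Finset.mul_sum]
      refine mul_le_mul_of_nonneg_left ?_ hc₀0.le
      have h4 : ∑ i ∈ Finset.range (n + 1), ρ ^ (N + 1 - i)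
          = ρ ^ K * ∑ i ∈ Finset.range (n + 1), ρ ^ i := by
        rw [← Finset.sum_range_reflect (fun i => ρ ^ i), Finset.mul_sum]
        refine Finset.sum_congr rfl fun i hi => ?_
        rw [Finset.mem_range] at hi
        rw [← pow_add]
        congr 1
        omega
      rw [h4, ← tsum_geometric_of_lt_one hρ0.le hρ1]
      exact mul_le_mul_of_nonneg_left ((summable_geometric_of_lt_one hρ0.le hρ1).sum_le_tsum _
        fun _ _ => by positivity) (by positivity)
    have h5 : volume.real (Set.Ico lam⁻¹ 1 ∩ B) ≤ initMass 1 B :=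
      measureReal_mono (Set.inter_subset_inter_left _
        (Set.Ico_subset_Ico_left (by positivity))) (volume_Ico_inter_ne_top _ _ _)
    calc topMass lam B ≤ (1 - lam⁻¹)⁻¹ * (parryMass lam * (lam / (lam - 1)) *
          (c₀ * (ρ ^ K * (1 - ρ)⁻¹))) := by
          rw [topMass]
          refine mul_le_mul_of_nonneg_left (h5.trans (h2.trans ?_)) (by positivity)
          exact mul_le_mul_of_nonneg_left h3 (by positivity)
      _ = D * ρ ^ K := by rw [hD]; ring
      _ ≤ ε / 2 := hKε.le
  have hsplit : topMass lam A ≤ topMass lam (A \ B) + topMass lam B := by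
    rw [topMass, topMass, topMass, ← mul_add]
    refine mul_le_mul_of_nonneg_left ?_ (by positivity)
    refine le_trans (measureReal_mono ?_ ?_) (measureReal_union_le _ _)
    · rintro z ⟨hz1, hz2⟩
      by_cases hz : z ∈ B
      · exact Or.inr ⟨hz1, hz⟩
      · exact Or.inl ⟨hz1, hz2, hz⟩
    · exact (measure_union_lt_top (volume_Ico_inter_ne_top _ _ _).lt_top
        (volume_Ico_inter_ne_top _ _ _).lt_top).ne
  have hle1 : topMass lam (A \ B) ≤ 1 := by
    rw [← topMass_univ hb, topMass, topMass]
    refine mul_le_mul_of_nonneg_left ?_ (by positivity)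
    exact measureReal_mono (Set.inter_subset_inter_right _ (Set.subset_univ _))
      (volume_Ico_inter_ne_top _ _ _)
  have h0 : 0 ≤ topMass lam (A \ B) := mul_nonneg (by positivity) measureReal_nonneg
  have h2 : δ * topMass lam (A \ B) ≤ δ := mul_le_of_le_one_right hδ.le hle1
  have h3 : 0 ≤ δ ^ 2 * topMass lam (A \ B) := by positivity
  have h4 : (1 - δ) ^ 2 * topMass lam (A \ B) = topMass lam (A \ B)
      - 2 * (δ * topMass lam (A \ B)) + δ ^ 2 * topMass lam (A \ B) := by ring
  linarith

/-- Keep the digits in the positions `K ≤ i ≤ N - K`. -/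
def middle (K N : ℕ) (x : ℕ → ℕ) : ℕ → ℕ := fun i => if K ≤ i ∧ i + K ≤ N then x i else 0

theorem measurableSet_of_forall_eq {A : Set (ℕ → ℕ)} (n : ℕ)
    (h : ∀ x y, (∀ i < n, x i = y i) → x ∈ A → y ∈ A) : MeasurableSet A := by
  have : A = firstTerms n ⁻¹' {w | extendZero w ∈ A} := by
    ext x
    have hx : ∀ i < n, x i = extendZero (firstTerms n x) i := fun i hi => by
      simp [extendZero, firstTerms, hi]
    exact ⟨h _ _ hx, h _ _ fun i hi => (hx i hi).symm⟩
  rw [this]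
  exact measurable_firstTerms n (Set.to_countable _).measurableSet

theorem measurable_of_forall_eq {α : Type*} [MeasurableSpace α] {F : (ℕ → ℕ) → α} (n : ℕ)
    (h : ∀ x y, (∀ i < n, x i = y i) → F x = F y) : Measurable F := fun A _ =>
  measurableSet_of_forall_eq n fun x y hxy hx => by rwa [Set.mem_preimage, ← h x y hxy]

theorem middle_congr {K N : ℕ} {x y : ℕ → ℕ} (h : ∀ i, K ≤ i → i + K ≤ N → x i = y i) :
    middle K N x = middle K N y := by
  funext i
  rw [middle, middle]
  split_ifs with hi
  · exact h i hi.1 hi.2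
  · rfl

theorem middle_apply {K N : ℕ} (x : ℕ → ℕ) {i : ℕ} (h1 : K ≤ i) (h2 : i + K ≤ N) :
    middle K N x i = x i := if_pos ⟨h1, h2⟩

theorem measurableSet_preimage_middle (K N : ℕ) (A : Set (ℕ → ℕ)) :
    MeasurableSet (middle K N ⁻¹' A) :=
  measurableSet_of_forall_eq (N + 1) fun x y h hx => by
    rwa [Set.mem_preimage, ← middle_congr fun i _ hi => h i (by omega)]

/-- Away from the two ends the digits have asymptotically the same law, in total variation, in the
microcanonical and in the canonical ensemble. -/
theorem exists_forall_abs_microcanonical_sub_le (hZ : IsZLRR E Z) (hlam : IsDominantRoot E Z lam)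
    {ε : ℝ} (hε : 0 < ε) : ∃ K₀, ∀ K ≥ K₀, ∀ᶠ N in atTop, Z N < Z (N + 1) ∧ ∀ A : Set (ℕ → ℕ),
      |(microcanonical Z N).real (middle K N ⁻¹' A)
        - (betaMeasure lam).real (middle K N ⁻¹' A)| ≤ ε := by
  have hb := hlam.one_lt
  have hl : 0 < lam := by linarith
  have hl0 : 0 < lam⁻¹ := by positivity
  have hl1 : 0 < 1 - lam⁻¹ := by linarith [inv_lt_one_of_one_lt₀ hb]
  obtain ⟨K₁, hK₁⟩ := exists_forall_topMass_sub_le hZ hlam (half_pos hε)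
  -- The two iterates in `topMass_preimage_iterate` contribute at most η + lam⁻¹ η ≤ 2 η before
  -- division by 1 - lam⁻¹.
  set η := (1 - lam⁻¹) * (ε / 4) with hη
  obtain ⟨n₀, hn₀⟩ := exists_forall_abs_initMass_preimage_sub_le hb (by positivity : 0 < η)
  refine ⟨max K₁ (n₀ + 1), fun K hK => ?_⟩
  filter_upwards [hK₁ K ((le_max_left _ _).trans hK)] with N hN
  refine ⟨hN.1, fun A => ?_⟩
  have hprob := isProbabilityMeasure_microcanonical hN.1
  set n := N + 1 - K
  set X := middle K N ⁻¹' A with hX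
  set S : Set (Fin n → ℕ) := {w | extendZero w ∈ X} with hS
  have hXS : X = firstTerms n ⁻¹' S := by
    ext x
    simp only [hS, hX, Set.mem_preimage, Set.mem_ofPred_eq]
    rw [middle_congr (y := extendZero (firstTerms n x)) fun i _ hi => ?_]
    simp [extendZero, firstTerms, show i < n by omega]
  have hXm : MeasurableSet X := measurableSet_preimage_middle K N A
  have h1 := hN.2 S
  -- The lower bound for the complement is the upper bound for the event.
  have h2 := hN.2 Sᶜ
  have h3 := topMass_add_compl hb (measurable_betaSeq (b := lam) hXm)
  rw [Set.preimage_compl, Set.preimage_compl] at h2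
  rw [← hXS] at h1 h2
  rw [probReal_compl_eq_one_sub hXm] at h2
  obtain ⟨k, rfl⟩ : ∃ k, K = k + 1 := ⟨K - 1, by have := le_max_right K₁ (n₀ + 1); omega⟩
  have hk : n₀ ≤ k := by have := le_max_right K₁ (n₀ + 1); omega
  -- The event ignores the first k + 1 digits, so it is the pullback of an event under the (k +
  -- 1)-st iterate; the truncated subtraction in the index is harmless because `middle` discards
  -- smaller positions.
  set Y : Set (ℕ → ℕ) := {y | middle (k + 1) N (fun i => y (i - (k + 1))) ∈ A} with hY
  have hYm : MeasurableSet Y := measurableSet_of_forall_eq (N + 1) fun x y h hx => by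
    simp only [hY, Set.mem_ofPred_eq] at hx ⊢
    rwa [← middle_congr (x := fun i => x (i - (k + 1))) fun i _ hi => h _ (by omega)]
  set B := betaSeq lam ⁻¹' Y with hB
  have hBm : MeasurableSet B := measurable_betaSeq hYm
  have hXB : betaSeq lam ⁻¹' X = (betaMap lam)^[k + 1] ⁻¹' B := by
    ext z
    simp only [hX, hB, hY, Set.mem_preimage, Set.mem_ofPred_eq]
    rw [middle_congr (y := fun i => betaSeq lam ((betaMap lam)^[k + 1] z) (i - (k + 1)))
      fun i hi _ => ?_]
    rw [betaSeq_iterate]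
    congr 1
    omega
  have h4 := topMass_preimage_iterate hb hBm k
  have h5 := abs_le.1 (hn₀ k hk B hBm)
  have h6 := abs_le.1 (hn₀ (k + 1) (by omega) B hBm)
  have h7 : (betaMeasure lam).real X = (parryMeasure lam).real B := by
    rw [betaMeasure_real hXm, hXB, measureReal_def,
      ((measurePreserving_betaMap hb).iterate (k + 1)).measure_preimage hBm.nullMeasurableSet,
      ← measureReal_def]
  rw [hXB] at h1 h2 h3
  have h8 : (1 - lam⁻¹) * topMass lam ((betaMap lam)^[k + 1] ⁻¹' B)
      = initMass 1 ((betaMap lam)^[k + 1] ⁻¹' B)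
        - lam⁻¹ * initMass 1 ((betaMap lam)^[k] ⁻¹' B) := by
    rw [h4, mul_inv_cancel_left₀ hl1.ne']
  have h9 : |(1 - lam⁻¹) * (topMass lam ((betaMap lam)^[k + 1] ⁻¹' B)
      - (parryMeasure lam).real B)| ≤ (1 - lam⁻¹) * (ε / 2) := by
    rw [mul_sub, h8, abs_le]
    constructor <;> nlinarith
  rw [abs_mul, abs_of_pos hl1] at h9
  have h10 := abs_le.1 (le_of_mul_le_mul_left h9 hl1)
  have h11 : topMass lam (betaSeq lam ⁻¹' Xᶜ) + topMass lam ((betaMap lam)^[k + 1] ⁻¹' B) = 1 := by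
    rw [Set.preimage_compl, hXB, add_comm]; exact h3
  rw [h7, abs_le]
  constructor <;> linarith

end

section

/-! ### Transfer of limit laws -/

/-- The ensembles `P N` have asymptotically, up to the two ends, the same law as `μ`, and all digits
are bounded by `B`. -/
structure AgreeInMiddle (P : ℕ → Measure (ℕ → ℕ)) (μ : Measure (ℕ → ℕ)) (B : ℕ) : Prop where
  isProbability : IsProbabilityMeasure μ
  bounded : ∀ᵐ x ∂μ, ∀ i, x i ≤ B
  eventually_isProbability : ∀ᶠ N in atTop, IsProbabilityMeasure (P N)
  bounded_left : ∀ N, ∀ᵐ x ∂(P N), ∀ i, x i ≤ B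
  close : ∀ ε > 0, ∃ K₀, ∀ K ≥ K₀, ∀ᶠ N in atTop, ∀ A : Set (ℕ → ℕ),
    |(P N).real (middle K N ⁻¹' A) - μ.real (middle K N ⁻¹' A)| ≤ ε

variable {P : ℕ → Measure (ℕ → ℕ)} {μ κ : Measure (ℕ → ℕ)} {B : ℕ}

theorem middle_le {K N : ℕ} {x : ℕ → ℕ} (h : ∀ i, x i ≤ B) (i : ℕ) : middle K N x i ≤ B := by
  rw [middle]
  split_ifs
  · exact h i
  · exact Nat.zero_le B

theorem measurable_comp_middle {α : Type*} [MeasurableSpace α] (F : (ℕ → ℕ) → α) (K N : ℕ) :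
    Measurable fun x => F (middle K N x) := fun A _ =>
  measurableSet_preimage_middle K N (F ⁻¹' A)

/-- Layer cake formula: the tail probabilities differ by at most ε at each level t in (0, M]. -/
theorem abs_integral_middle_sub_le [IsProbabilityMeasure κ] [IsProbabilityMeasure μ] {K N : ℕ}
    {ε M : ℝ} (hM : 0 ≤ M)
    (h : ∀ A : Set (ℕ → ℕ), |κ.real (middle K N ⁻¹' A) - μ.real (middle K N ⁻¹' A)| ≤ ε)
    {φ : (ℕ → ℕ) → ℝ} (h0 : ∀ x, 0 ≤ φ x) (hκ : ∀ᵐ x ∂κ, φ (middle K N x) ≤ M)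
    (hμ : ∀ᵐ x ∂μ, φ (middle K N x) ≤ M) :
    |∫ x, φ (middle K N x) ∂κ - ∫ x, φ (middle K N x) ∂μ| ≤ ε * M := by
  have hmeas : Measurable fun x => φ (middle K N x) := measurable_comp_middle φ K N
  have hint : ∀ (ρ : Measure (ℕ → ℕ)) [IsProbabilityMeasure ρ],
      (∀ᵐ x ∂ρ, φ (middle K N x) ≤ M) → Integrable (fun x => φ (middle K N x)) ρ := fun ρ _ hρ =>
    Integrable.of_bound hmeas.aestronglyMeasurable M (by
      filter_upwards [hρ] with x hx
      rwa [Real.norm_eq_abs, abs_of_nonneg (h0 _)])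
  have hanti : ∀ (ρ : Measure (ℕ → ℕ)) [IsProbabilityMeasure ρ],
      IntegrableOn (fun t => ρ.real {x | t ≤ φ (middle K N x)}) (Set.Ioc 0 M) volume := by
    intro ρ _
    have : Antitone fun t => ρ.real {x | t ≤ φ (middle K N x)} := fun s t hst =>
      measureReal_mono fun x hx => hst.trans hx
    exact (this.intervalIntegrable (a := 0) (b := M)).1
  rw [(hint κ hκ).integral_eq_integral_Ioc_meas_le (Eventually.of_forall fun x => h0 _) hκ,
    (hint μ hμ).integral_eq_integral_Ioc_meas_le (Eventually.of_forall fun x => h0 _) hμ,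
    ← integral_sub (hanti κ) (hanti μ), ← Real.norm_eq_abs]
  refine (norm_setIntegral_le_of_norm_le_const measure_Ioc_lt_top fun t _ => h {x | t ≤ φ x}).trans ?_
  rw [Real.volume_real_Ioc_of_le hM, sub_zero]

/-- Insensitivity is known only under μ. The exceptional event is therefore described through the
middle digits alone, so that its small probability carries over to P N. -/
theorem AgreeInMiddle.exists_middle_close {E : Type*} [PseudoMetricSpace E]
    (h : AgreeInMiddle P μ B) {T : ℕ → (ℕ → ℕ) → E} (hT : BoundaryInsensitive μ T) {ε η : ℝ}
    (hε : 0 < ε) (hη : 0 < η) : ∃ K, ∀ᶠ N in atTop, IsProbabilityMeasure (P N) ∧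
      (∀ A : Set (ℕ → ℕ), |(P N).real (middle K N ⁻¹' A) - μ.real (middle K N ⁻¹' A)| ≤ η) ∧
      ∃ O : Set (ℕ → ℕ), μ.real (middle K N ⁻¹' O) ≤ η ∧ (P N).real (middle K N ⁻¹' O) ≤ 2 * η ∧
        (∀ᵐ x ∂μ, x ∉ middle K N ⁻¹' O → dist (T N x) (T N (middle K N x)) ≤ ε) ∧
        ∀ᵐ x ∂(P N), x ∉ middle K N ⁻¹' O → dist (T N x) (T N (middle K N x)) ≤ ε := by
  have := h.isProbability
  obtain ⟨K, hK⟩ := h.close η hη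
  refine ⟨K, ?_⟩
  have h1 := hT B K (ε / 2) (half_pos hε)
  filter_upwards [h.eventually_isProbability, hK K le_rfl,
    h1.eventually_le_const (ENNReal.ofReal_pos.2 hη)] with N hN1 hN2 hN3
  refine ⟨hN1, hN2, ?_⟩
  -- Middles having two bounded completions on which T N differs by more than ε. For any x with such
  -- a middle, one of the completions differs from x by more than ε / 2, whence the choice of ε / 2
  -- above.
  set O : Set (ℕ → ℕ) := {x | ∃ y y' : ℕ → ℕ, (∀ i, y i ≤ B) ∧ (∀ i, y' i ≤ B) ∧
    middle K N y = middle K N x ∧ middle K N y' = middle K N x ∧ ε < dist (T N y) (T N y')}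
  have hmm : ∀ x, middle K N (middle K N x) = middle K N x := fun x =>
    middle_congr fun i h1 h2 => middle_apply x h1 h2
  have hmid : ∀ {x y : ℕ → ℕ}, middle K N y = middle K N x → ∀ i, K ≤ i → i + K ≤ N → y i = x i := by
    intro x y hxy i h1 h2
    rw [← middle_apply y h1 h2, hxy, middle_apply x h1 h2]
  have hO : middle K N ⁻¹' O ⊆ {x | ∃ y : ℕ → ℕ, (∀ i, y i ≤ B) ∧
      (∀ i, K ≤ i → i + K ≤ N → y i = x i) ∧ ε / 2 < dist (T N x) (T N y)} := by
    rintro x ⟨y, y', hy, hy', hyx, hyx', hd⟩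
    rw [hmm] at hyx hyx'
    rcases lt_or_ge (ε / 2) (dist (T N x) (T N y)) with h2 | h2
    · exact ⟨y, hy, hmid hyx, h2⟩
    · refine ⟨y', hy', hmid hyx', ?_⟩
      have := dist_triangle_left (T N y) (T N y') (T N x)
      linarith
  have hμO : μ.real (middle K N ⁻¹' O) ≤ η :=
    ENNReal.toReal_le_of_le_ofReal hη.le ((measure_mono hO).trans hN3)
  have key : ∀ x : ℕ → ℕ, (∀ i, x i ≤ B) → x ∉ middle K N ⁻¹' O →
      dist (T N x) (T N (middle K N x)) ≤ ε := by
    intro x hx hxO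
    by_contra! hlt
    exact hxO ⟨x, middle K N x, hx, middle_le hx, (hmm x).symm, by rw [hmm], hlt⟩
  refine ⟨O, hμO, ?_, ?_, ?_⟩
  · linarith [(abs_le.1 (hN2 O)).2]
  · filter_upwards [h.bounded] with x hx using key x hx
  · filter_upwards [h.bounded_left N] with x hx using key x hx

/-- The integral of a function that is close to `φ` outside a small set. -/
theorem abs_integral_sub_middle_le [IsProbabilityMeasure κ] {K N : ℕ} {F : (ℕ → ℕ) → ℝ}
    (hF : Measurable F) {ε η M : ℝ} (hε : 0 ≤ ε) (hM : ∀ x y, |F x - F y| ≤ M) {O : Set (ℕ → ℕ)}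
    (hO : κ.real (middle K N ⁻¹' O) ≤ η)
    (h : ∀ᵐ x ∂κ, x ∉ middle K N ⁻¹' O → |F x - F (middle K N x)| ≤ ε) :
    |∫ x, F x ∂κ - ∫ x, F (middle K N x) ∂κ| ≤ ε + M * η := by
  have hM0 : 0 ≤ M := (abs_nonneg _).trans (hM 0 0)
  have hb : ∀ x, ‖F x‖ ≤ M + |F 0| := fun x => by
    have h1 := hM x 0
    have h2 := abs_sub_abs_le_abs_sub (F x) (F 0)
    rw [Real.norm_eq_abs]; linarith
  have hi1 : Integrable F κ := Integrable.of_bound hF.aestronglyMeasurable _ (Eventually.of_forall hb)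
  have hi2 : Integrable (fun x => F (middle K N x)) κ :=
    Integrable.of_bound (measurable_comp_middle F K N).aestronglyMeasurable _
      (Eventually.of_forall fun x => hb _)
  have hOm : MeasurableSet (middle K N ⁻¹' O) := measurableSet_preimage_middle K N O
  have hi3 : Integrable ((middle K N ⁻¹' O).indicator fun _ => M) κ :=
    (integrable_const M).indicator hOm
  rw [← integral_sub hi1 hi2, ← Real.norm_eq_abs]
  calc ‖∫ x, (F x - F (middle K N x)) ∂κ‖
      ≤ ∫ x, (ε + (middle K N ⁻¹' O).indicator (fun _ => M) x) ∂κ := by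
        refine norm_integral_le_of_norm_le ((integrable_const ε).add hi3) ?_
        filter_upwards [h] with x hx
        rw [Real.norm_eq_abs]
        by_cases hxO : x ∈ middle K N ⁻¹' O
        · rw [Set.indicator_of_mem hxO]; linarith [hM x (middle K N x)]
        · rw [Set.indicator_of_notMem hxO, add_zero]; exact hx hxO
    _ = ε + κ.real (middle K N ⁻¹' O) * M := by
        rw [integral_add (integrable_const ε) hi3, integral_indicator_const M hOm]; simp
    _ ≤ ε + M * η := by nlinarith

theorem AgreeInMiddle.tendsto_integral_sub {E : Type*} [PseudoMetricSpace E] [MeasurableSpace E]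
    [BorelSpace E] (h : AgreeInMiddle P μ B) {T : ℕ → (ℕ → ℕ) → E} (hTm : ∀ n, Measurable (T n))
    (hT : BoundaryInsensitive μ T) {g : E → ℝ} {C : ℝ} (hC : ∀ x y, dist (g x) (g y) ≤ C)
    {L : NNReal} (hL : LipschitzWith L g) :
    Tendsto (fun N => ∫ x, g (T N x) ∂(P N) - ∫ x, g (T N x) ∂μ) atTop (𝓝 0) := by
  have := h.isProbability
  rcases isEmpty_or_nonempty E with hE | ⟨⟨e⟩⟩
  · exact (hE.false (T 0 0)).elim
  have hC0 : 0 ≤ C := dist_nonneg.trans (hC e e)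
  rw [Metric.tendsto_nhds]
  intro δ hδ
  set ε := δ / (8 * (L + 1)) with hε
  set η := δ / (16 * (C + 1)) with hη
  have hε0 : 0 < ε := by positivity
  have hη0 : 0 < η := by positivity
  have hLε : L * ε ≤ δ / 8 := by
    rw [hε, ← mul_div_assoc, div_le_div_iff₀ (by positivity) (by norm_num)]
    have : 0 ≤ (L : ℝ) := L.2
    nlinarith
  have hCη : C * η ≤ δ / 16 := by
    rw [hη, ← mul_div_assoc, div_le_div_iff₀ (by positivity) (by norm_num)]
    nlinarith
  obtain ⟨K, hK⟩ := h.exists_middle_close hT hε0 hη0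
  filter_upwards [hK] with N hN
  obtain ⟨hP, hA, O, hO1, hO2, hO3, hO4⟩ := hN
  rw [Real.dist_eq, sub_zero]
  have hgm : Measurable fun x => g (T N x) := hL.continuous.measurable.comp (hTm N)
  have hgd : ∀ x y, |g (T N x) - g (T N y)| ≤ C := fun x y => hC _ _
  have hge : ∀ y, |g y - g e| ≤ C := fun y => hC y e
  have hlip : ∀ x, dist (T N x) (T N (middle K N x)) ≤ ε →
      |g (T N x) - g (T N (middle K N x))| ≤ L * ε := fun x hx =>
    (hL.dist_le_mul _ _).trans (mul_le_mul_of_nonneg_left hx L.2)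
  have h1 := abs_integral_sub_middle_le (κ := P N) hgm (by positivity) hgd hO2
    (hO4.mono fun x hx hxO => hlip x (hx hxO))
  have h2 := abs_integral_sub_middle_le (κ := μ) hgm (by positivity) hgd hO1
    (hO3.mono fun x hx hxO => hlip x (hx hxO))
  -- The shift by C - g e makes the integrand take values in [0, 2 C], as the layer cake bound
  -- requires nonnegativity.
  have h3 := abs_integral_middle_sub_le (κ := P N) (μ := μ) (M := 2 * C) (by linarith) hA
    (φ := fun x => g (T N x) - g e + C)
    (fun x => by linarith [(abs_le.1 (hge (T N x))).1])
    (Eventually.of_forall fun x => by linarith [(abs_le.1 (hge (T N (middle K N x)))).2])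
    (Eventually.of_forall fun x => by linarith [(abs_le.1 (hge (T N (middle K N x)))).2])
  have h4 : ∀ (ρ : Measure (ℕ → ℕ)) [IsProbabilityMeasure ρ],
      ∫ x, (g (T N (middle K N x)) - g e + C) ∂ρ = ∫ x, g (T N (middle K N x)) ∂ρ - g e + C := by
    intro ρ _
    have hi : Integrable (fun x => g (T N (middle K N x))) ρ :=
      Integrable.of_bound (measurable_comp_middle (fun x => g (T N x)) K N).aestronglyMeasurable
        (C + |g e|) (Eventually.of_forall fun x => by
          have h1 : |g (T N (middle K N x)) - g e| ≤ C := hC _ e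
          have h2 := abs_sub_abs_le_abs_sub (g (T N (middle K N x))) (g e)
          rw [Real.norm_eq_abs]; linarith)
    simp_rw [sub_add]
    rw [integral_sub hi (integrable_const _)]
    simp
  rw [h4, h4] at h3
  have h5 := abs_le.1 h1
  have h6 := abs_le.1 h2
  have h7 := abs_le.1 h3
  rw [abs_lt]
  constructor <;> nlinarith

/-- Weak convergence may be tested on bounded Lipschitz functions, for which `tendsto_integral_sub`
applies. The index shift N₀ skips the finitely many N at which P N may fail to be a probability
measure. -/
theorem AgreeInMiddle.convergesInLaw {E : Type*} [MetricSpace E] [MeasurableSpace E]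
    [BorelSpace E] (h : AgreeInMiddle P μ B) {T : ℕ → (ℕ → ℕ) → E} (hTm : ∀ n, Measurable (T n))
    (hT : BoundaryInsensitive μ T) {ν : Measure E} [IsProbabilityMeasure ν]
    (hlaw : ConvergesInLaw (fun _ => μ) T ν) : ConvergesInLaw P T ν := by
  have := h.isProbability
  obtain ⟨N₀, hN₀⟩ := eventually_atTop.1 h.eventually_isProbability
  have hP : ∀ n, IsProbabilityMeasure (P (n + N₀)) := fun n => hN₀ _ (by omega)
  set ρ : ℕ → ProbabilityMeasure E := fun n => ⟨(P (n + N₀)).map (T (n + N₀)),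
    Measure.isProbabilityMeasure_map (hTm _).aemeasurable⟩
  have hmap : ∀ n (g : E → ℝ), Measurable g →
      ∫ y, g y ∂(ρ n : Measure E) = ∫ x, g (T (n + N₀) x) ∂(P (n + N₀)) := fun n g hg =>
    integral_map (hTm _).aemeasurable hg.aestronglyMeasurable
  set ν' : ProbabilityMeasure E := ⟨ν, inferInstance⟩
  have hlim : Tendsto ρ atTop (𝓝 ν') := by
    rw [tendsto_iff_forall_lipschitz_integral_tendsto]
    rintro g ⟨C, hC⟩ ⟨L, hL⟩
    have h1 := hlaw (BoundedContinuousFunction.mkOfBound ⟨g, hL.continuous⟩ C hC)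
    have h2 := (h.tendsto_integral_sub hTm hT hC hL).add h1
    simp only [BoundedContinuousFunction.mkOfBound_coe, ContinuousMap.coe_mk, sub_add_cancel,
      zero_add] at h2
    refine ((tendsto_add_atTop_iff_nat N₀).2 h2).congr fun n => ?_
    exact (hmap n g hL.continuous.measurable).symm
  intro g
  rw [ProbabilityMeasure.tendsto_iff_forall_integral_tendsto] at hlim
  refine (tendsto_add_atTop_iff_nat N₀).1 ((hlim g).congr fun n => ?_)
  exact hmap n g g.continuous.measurable

theorem AgreeInMiddle.convergesInProb (h : AgreeInMiddle P μ B) {T : ℕ → (ℕ → ℕ) → ℝ}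
    (hT : BoundaryInsensitive μ T) {c : ℝ}
    (hc : ConvergesInProb (fun _ => μ) T c) : ConvergesInProb P T c := by
  have := h.isProbability
  intro ε hε
  rw [ENNReal.tendsto_nhds_zero]
  intro δ' hδ'
  obtain ⟨δ, hδ, hδδ⟩ : ∃ δ : ℝ, 0 < δ ∧ ENNReal.ofReal δ ≤ δ' := by
    rcases eq_or_ne δ' ⊤ with rfl | h1
    · exact ⟨1, one_pos, le_top⟩
    · exact ⟨δ'.toReal, ENNReal.toReal_pos hδ'.ne' h1, (ENNReal.ofReal_toReal h1).le⟩
  -- Five errors: two for the exceptional set under P N, one for it under μ, one for the assumed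
  -- convergence, and one for exchanging the measures.
  set η := δ / 5 with hη
  have hη0 : 0 < η := by positivity
  obtain ⟨K, hK⟩ := h.exists_middle_close hT (by positivity : 0 < ε / 3) hη0
  filter_upwards [hK, (hc (ε / 3) (by positivity)).eventually_le_const (ENNReal.ofReal_pos.2 hη0)]
    with N hN hcN
  obtain ⟨hP, hA, O, hO1, hO2, hO3, hO4⟩ := hN
  refine le_trans ?_ hδδ
  rw [← ofReal_measureReal (μ := P N)]
  refine ENNReal.ofReal_le_ofReal ?_
  set A : Set (ℕ → ℕ) := {x | 2 * ε / 3 ≤ |T N x - c|}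
  have h1 : (P N).real {x | ε ≤ |T N x - c|}
      ≤ (P N).real (middle K N ⁻¹' O ∪ middle K N ⁻¹' A) := by
    refine ENNReal.toReal_mono (measure_ne_top _ _) (measure_mono_ae ?_)
    filter_upwards [hO4] with x hx hxε
    by_cases hxO : x ∈ middle K N ⁻¹' O
    · exact Or.inl hxO
    · have h2 : |T N x - T N (middle K N x)| ≤ ε / 3 := hx hxO
      have h3 : ε ≤ |T N x - c| := hxε
      have h4 := abs_sub_le (T N x) (T N (middle K N x)) c
      refine Or.inr ?_
      change 2 * ε / 3 ≤ |T N (middle K N x) - c|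
      linarith
  have h2 : μ.real (middle K N ⁻¹' A)
      ≤ μ.real (middle K N ⁻¹' O ∪ {x | ε / 3 ≤ |T N x - c|}) := by
    refine ENNReal.toReal_mono (measure_ne_top _ _) (measure_mono_ae ?_)
    filter_upwards [hO3] with x hx hxA
    by_cases hxO : x ∈ middle K N ⁻¹' O
    · exact Or.inl hxO
    · have h2 : |T N x - T N (middle K N x)| ≤ ε / 3 := hx hxO
      have h3 : 2 * ε / 3 ≤ |T N (middle K N x) - c| := hxA
      have h4 := abs_sub_le (T N (middle K N x)) (T N x) c
      rw [abs_sub_comm] at h2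
      refine Or.inr ?_
      change ε / 3 ≤ |T N x - c|
      linarith
  have h3 : μ.real {x | ε / 3 ≤ |T N x - c|} ≤ η := ENNReal.toReal_le_of_le_ofReal hη0.le hcN
  have h4 := (abs_le.1 (hA A)).2
  have h5 := measureReal_union_le (μ := P N) (middle K N ⁻¹' O) (middle K N ⁻¹' A)
  have h6 := measureReal_union_le (μ := μ) (middle K N ⁻¹' O) {x | ε / 3 ≤ |T N x - c|}
  linarith

end

/-! ### Application to local sums and gaps in the microcanonical ensemble. -/

section

variable {E : LinearRecurrence ℤ} {Z : ℕ → ℕ} {lam : ℝ}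

theorem exists_agreeInMiddle (hZ : IsZLRR E Z) (hlam : IsDominantRoot E Z lam) :
    ∃ B, AgreeInMiddle (microcanonical Z) (betaMeasure lam) B := by
  have hb := hlam.one_lt
  have hl : 0 < lam := by linarith
  obtain ⟨B, hB⟩ := exists_greedyDigit_le hZ hlam
  have hm : MeasurableSet {x : ℕ → ℕ | ∀ i, x i ≤ max B ⌊lam⌋₊} := by
    have : {x : ℕ → ℕ | ∀ i, x i ≤ max B ⌊lam⌋₊}
        = ⋂ i, (fun x : ℕ → ℕ => x i) ⁻¹' Set.Iic (max B ⌊lam⌋₊) := by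
      ext x; simp
    rw [this]
    exact MeasurableSet.iInter fun i => measurable_pi_apply i measurableSet_Iic
  refine ⟨max B ⌊lam⌋₊, (isCanonical_betaMeasure hZ hlam).isProbability, ?_, ?_, fun N => ?_,
    fun ε hε => ?_⟩
  · rw [betaMeasure, ae_map_iff measurable_betaSeq.aemeasurable hm]
    filter_upwards [ae_mem_Ico_parryMeasure hb] with z hz i
    exact (betaSeq_le hl hz.2.le i).trans (le_max_right _ _)
  · obtain ⟨K₀, hK₀⟩ := exists_forall_abs_microcanonical_sub_le hZ hlam one_pos
    filter_upwards [hK₀ K₀ le_rfl] with N hN using isProbabilityMeasure_microcanonical hN.1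
  · rw [microcanonical, ae_map_iff (measurable_greedySeq N).aemeasurable hm]
    refine Eventually.of_forall fun m i => ?_
    rw [greedySeq]
    split_ifs
    · exact (hB _ _).trans (le_max_left _ _)
    · exact Nat.zero_le _
  · obtain ⟨K₀, hK₀⟩ := exists_forall_abs_microcanonical_sub_le hZ hlam hε
    exact ⟨K₀, fun K hK => (hK₀ K hK).mono fun N hN => hN.2⟩

/-! ### Sums of local statistics -/

theorem measurable_localSum {L : ℕ} (f : (Fin L → ℕ) → ℝ) (n : ℕ) : Measurable (localSum f n) :=
  measurable_of_forall_eq (n + 1 + L) fun x y h =>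
    Finset.sum_congr rfl fun i hi => by
      rw [Finset.mem_range] at hi
      congr 1
      funext t
      exact h _ (by omega)

theorem exists_abs_localSum_sub_le {L : ℕ} (f : (Fin L → ℕ) → ℝ) (B K : ℕ) :
    ∃ D, ∀ (n : ℕ) (x y : ℕ → ℕ), (∀ i, x i ≤ B) → (∀ i, y i ≤ B) →
      (∀ i, K ≤ i → i + K ≤ n → y i = x i) → |localSum f n x - localSum f n y| ≤ D := by
  obtain ⟨M, hM⟩ := ((Set.finite_Icc (0 : Fin L → ℕ) (fun _ => B)).image fun w => |f w|).bddAbove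
  have hf : ∀ x : ℕ → ℕ, (∀ i, x i ≤ B) → ∀ i, |f fun t => x (i + t)| ≤ M := fun x hx i =>
    hM ⟨_, ⟨fun t => Nat.zero_le _, fun t => hx _⟩, rfl⟩
  have hM0 : 0 ≤ M := (abs_nonneg _).trans (hf 0 (fun _ => Nat.zero_le _) 0)
  refine ⟨(K + (L + K) : ℕ) * (2 * M), fun n x y hx hy hxy => ?_⟩
  rw [localSum, localSum, ← Finset.sum_sub_distrib]
  -- The windows that can see a changed digit: the first K, and the last L + K since a window
  -- reaches L - 1 places to the right of its start.
  set J := Finset.range K ∪ Finset.Ico (n + 1 - (L + K)) (n + 1)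
  have hJ : J.card ≤ K + (L + K) := by
    refine (Finset.card_union_le _ _).trans ?_
    rw [Finset.card_range, Nat.card_Ico]
    omega
  calc |∑ i ∈ Finset.range (n + 1), ((f fun t => x (i + t)) - f fun t => y (i + t))|
      ≤ ∑ i ∈ Finset.range (n + 1), |(f fun t => x (i + t)) - f fun t => y (i + t)| :=
        Finset.abs_sum_le_sum_abs _ _
    _ ≤ ∑ i ∈ Finset.range (n + 1), if i ∈ J then 2 * M else 0 := by
        refine Finset.sum_le_sum fun i hi => ?_
        rw [Finset.mem_range] at hi
        split_ifs with hiJ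
        · have h1 := abs_le.1 (hf x hx i)
          have h2 := abs_le.1 (hf y hy i)
          rw [abs_le]
          constructor <;> linarith
        · have h1 : (fun t : Fin L => y (i + t)) = fun t : Fin L => x (i + t) := by
            funext t
            simp only [J, Finset.mem_union, Finset.mem_range, Finset.mem_Ico, not_or] at hiJ
            have := t.2
            exact hxy _ (by omega) (by omega)
          rw [h1, sub_self, abs_zero]
    _ ≤ ∑ i ∈ J, 2 * M := by
        rw [← Finset.sum_filter]
        refine Finset.sum_le_sum_of_subset_of_nonneg (fun i hi => (Finset.mem_filter.1 hi).2) ?_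
        intros; positivity
    _ ≤ (K + (L + K) : ℕ) * (2 * M) := by
        rw [Finset.sum_const, nsmul_eq_mul]
        gcongr

theorem boundaryInsensitive_localSum {μ : Measure (ℕ → ℕ)} {B₀ : ℕ}
    (hμ : ∀ᵐ x ∂μ, ∀ i, x i ≤ B₀) {L : ℕ} (f : (Fin L → ℕ) → ℝ) (a : ℕ → ℝ) {b : ℕ → ℝ}
    (hb : Tendsto b atTop atTop) :
    BoundaryInsensitive μ fun n x => (localSum f n x - a n) / b n := by
  intro B K ε hε
  obtain ⟨D, hD⟩ := exists_abs_localSum_sub_le f (max B B₀) K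
  refine tendsto_const_nhds.congr' ?_
  filter_upwards [hb.eventually_gt_atTop (max 0 (D / ε))] with n hn
  symm
  have hbn : 0 < b n := (le_max_left _ _).trans_lt hn
  have hDn : D / b n ≤ ε := by
    rw [div_le_iff₀ hbn, ← div_le_iff₀' hε]
    exact ((le_max_right _ _).trans_lt hn).le
  rw [measure_eq_zero_iff_ae_notMem]
  filter_upwards [hμ] with x hx
  rintro ⟨y, hy, hxy, hd⟩
  refine hd.not_ge ?_
  rw [Real.dist_eq, ← sub_div, sub_sub_sub_cancel_right, abs_div, abs_of_pos hbn]
  refine le_trans ?_ hDn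
  exact div_le_div_of_nonneg_right (hD n x y (fun i => (hx i).trans (le_max_right _ _))
    (fun i => (hy i).trans (le_max_left _ _)) hxy) hbn.le

/-! ### Gaps -/

/-- The differences of consecutive terms of a list. -/
def gapList (l : List ℕ) : List ℕ := List.zipWith (fun a b => b - a) l l.tail

theorem length_gapList (l : List ℕ) : (gapList l).length = l.length - 1 := by
  simp [gapList]

theorem gapList_cons_cons (a c : ℕ) (l : List ℕ) :
    gapList (a :: c :: l) = (c - a) :: gapList (c :: l) := rfl

/-- Counting by a predicate treats the gaps of a given length and all gaps at once. -/
theorem countP_gapList_cons (p : ℕ → Bool) (a : ℕ) (l : List ℕ) :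
    (gapList l).countP p ≤ (gapList (a :: l)).countP p ∧
      (gapList (a :: l)).countP p ≤ (gapList l).countP p + 1 := by
  cases l with
  | nil => simp [gapList]
  | cons c l =>
    rw [gapList_cons_cons, List.countP_cons]
    split_ifs <;> omega

theorem countP_gapList_append_left (p : ℕ → Bool) (l₁ l₂ : List ℕ) :
    (gapList l₂).countP p ≤ (gapList (l₁ ++ l₂)).countP p ∧
      (gapList (l₁ ++ l₂)).countP p ≤ (gapList l₂).countP p + l₁.length := by
  induction l₁ with
  | nil => simp
  | cons a l₁ ih =>
    have := countP_gapList_cons p a (l₁ ++ l₂)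
    rw [List.cons_append, List.length_cons]
    omega

theorem countP_gapList_append_right (p : ℕ → Bool) (l₁ l₂ : List ℕ) :
    (gapList l₁).countP p ≤ (gapList (l₁ ++ l₂)).countP p ∧
      (gapList (l₁ ++ l₂)).countP p ≤ (gapList l₁).countP p + l₂.length := by
  induction l₁ with
  | nil =>
    have h1 := List.countP_le_length (p := p) (l := gapList l₂)
    rw [length_gapList] at h1
    simp only [List.nil_append, gapList, List.zipWith_nil_left, List.countP_nil] at *
    omega
  | cons a l₁ ih =>
    cases l₁ with
    | nil =>
      have h1 := List.countP_le_length (p := p) (l := gapList (a :: l₂))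
      rw [length_gapList] at h1
      simp [gapList] at *
      omega
    | cons c l₁ =>
      rw [List.cons_append, List.cons_append, gapList_cons_cons, gapList_cons_cons,
        List.countP_cons, List.countP_cons]
      rw [List.cons_append] at ih
      omega

theorem length_flatMap_replicate_le {B : ℕ} {x : ℕ → ℕ} (hx : ∀ i, x i ≤ B) (l : List ℕ) :
    (l.flatMap fun i => List.replicate (x i) i).length ≤ l.length * B := by
  induction l with
  | nil => simp
  | cons a l ih =>
    rw [List.flatMap_cons, List.length_append, List.length_replicate, List.length_cons]
    have := hx a
    linarith

theorem length_summandPositions (n : ℕ) (x : ℕ → ℕ) :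
    (summandPositions n x).length = ∑ i ∈ Finset.range (n + 1), x i := by
  rw [summandPositions, List.length_flatMap]
  simp [Finset.sum, Multiset.range]

/-- The number of gaps with the property `p`. -/
def gapCountP (p : ℕ → Bool) (n : ℕ) (x : ℕ → ℕ) : ℝ := ((gaps n x).countP p : ℝ)

theorem gapCount_eq (g : ℕ) : gapCount g = gapCountP (fun k => k == g) := rfl

theorem gapTotal_eq : gapTotal = gapCountP fun _ => true := by
  funext n x
  rw [gapTotal, gapCountP, List.countP_true]

theorem gapCountP_nonneg (p : ℕ → Bool) (n : ℕ) (x : ℕ → ℕ) : 0 ≤ gapCountP p n x :=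
  Nat.cast_nonneg _

theorem gapCountP_le_gapTotal (p : ℕ → Bool) (n : ℕ) (x : ℕ → ℕ) :
    gapCountP p n x ≤ gapTotal n x :=
  Nat.cast_le.2 List.countP_le_length

theorem gapTotal_eq_sum_sub (n : ℕ) (x : ℕ → ℕ) :
    gapTotal n x = ((∑ i ∈ Finset.range (n + 1), x i - 1 : ℕ) : ℝ) := by
  rw [← length_summandPositions, ← length_gapList]
  rfl

theorem measurable_gapCountP (p : ℕ → Bool) (n : ℕ) : Measurable (gapCountP p n) :=
  measurable_of_forall_eq (n + 1) fun x y h => by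
    have : summandPositions n x = summandPositions n y := by
      rw [summandPositions, summandPositions]
      exact List.flatMap_congr fun i hi => by rw [h i (List.mem_range.1 hi)]
    rw [gapCountP, gapCountP, gaps, gaps, this]

theorem gapCountP_le {B : ℕ} (p : ℕ → Bool) (n : ℕ) {x : ℕ → ℕ} (hx : ∀ i, x i ≤ B) :
    gapCountP p n x ≤ ((n + 1) * B : ℕ) := by
  have h1 := length_flatMap_replicate_le hx (List.range (n + 1))
  rw [List.length_range] at h1
  have h2 : (gaps n x).length ≤ (summandPositions n x).length := by
    rw [show gaps n x = gapList (summandPositions n x) from rfl, length_gapList]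
    omega
  exact Nat.cast_le.2 (List.countP_le_length.trans (h2.trans h1))

/-- Each added or removed summand changes the count by at most one, and each end has at most K B
summands. When the two ends overlap, the trivial bound is already good enough. -/
theorem gapCountP_le_add {B K n : ℕ} (p : ℕ → Bool) {x y : ℕ → ℕ} (hx : ∀ i, x i ≤ B)
    (hxy : ∀ i, K ≤ i → i + K ≤ n → x i = y i) :
    gapCountP p n x ≤ gapCountP p n y + 2 * K * B := by
  rcases lt_or_ge (n + 1) (2 * K) with h | h
  · have h1 := gapCountP_le p n hx
    have h2 : ((n + 1) * B : ℕ) ≤ 2 * K * B := Nat.mul_le_mul_right B h.le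
    have h3 : (((n + 1) * B : ℕ) : ℝ) ≤ 2 * K * B := by exact_mod_cast h2
    linarith [gapCountP_nonneg p n y]
  · obtain ⟨m, hm⟩ : ∃ m, n + 1 = K + m + K := ⟨n + 1 - 2 * K, by omega⟩
    have hsplit : List.range (n + 1) = List.range' 0 K ++ (List.range' K m ++ List.range' (K + m) K) := by
      have h1 := List.range'_append_1 (s := K) (m := m) (n := K)
      have h2 := List.range'_append_1 (s := 0) (m := K) (n := m + K)
      rw [zero_add] at h2
      rw [h1, h2, List.range_eq_range', hm, add_assoc]
    have key : ∀ z : ℕ → ℕ, gaps n z = gapList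
        (((List.range' 0 K).flatMap fun i => List.replicate (z i) i) ++
        (((List.range' K m).flatMap fun i => List.replicate (z i) i) ++
        ((List.range' (K + m) K).flatMap fun i => List.replicate (z i) i))) := by
      intro z
      rw [← List.flatMap_append, ← List.flatMap_append, ← hsplit]
      rfl
    have hmid : ((List.range' K m).flatMap fun i => List.replicate (x i) i)
        = (List.range' K m).flatMap fun i => List.replicate (y i) i :=
      List.flatMap_congr fun i hi => by
        rw [List.mem_range'_1] at hi
        rw [hxy i (by omega) (by omega)]
    have h1 := length_flatMap_replicate_le hx (List.range' 0 K)
    have h2 := length_flatMap_replicate_le hx (List.range' (K + m) K)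
    rw [List.length_range'] at h1 h2
    have h3 : (gaps n x).countP p ≤ (gaps n y).countP p + 2 * K * B := by
      rw [key x, key y, hmid]
      have h4 := (countP_gapList_append_left p
        ((List.range' 0 K).flatMap fun i => List.replicate (x i) i)
        (((List.range' K m).flatMap fun i => List.replicate (y i) i) ++
          ((List.range' (K + m) K).flatMap fun i => List.replicate (x i) i))).2
      have h5 := (countP_gapList_append_right p
        ((List.range' K m).flatMap fun i => List.replicate (y i) i)
        ((List.range' (K + m) K).flatMap fun i => List.replicate (x i) i)).2
      have h6 := (countP_gapList_append_left p
        ((List.range' 0 K).flatMap fun i => List.replicate (y i) i)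
        (((List.range' K m).flatMap fun i => List.replicate (y i) i) ++
          ((List.range' (K + m) K).flatMap fun i => List.replicate (y i) i))).1
      have h7 := (countP_gapList_append_right p
        ((List.range' K m).flatMap fun i => List.replicate (y i) i)
        ((List.range' (K + m) K).flatMap fun i => List.replicate (y i) i)).1
      have h8 : 2 * K * B = K * B + K * B := by ring
      omega
    rw [gapCountP, gapCountP]
    exact_mod_cast h3

theorem abs_gapCountP_sub_le {B K n : ℕ} (p : ℕ → Bool) {x y : ℕ → ℕ} (hx : ∀ i, x i ≤ B)
    (hy : ∀ i, y i ≤ B) (hxy : ∀ i, K ≤ i → i + K ≤ n → y i = x i) :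
    |gapCountP p n x - gapCountP p n y| ≤ 2 * K * B := by
  have h1 := gapCountP_le_add p hx fun i h1 h2 => (hxy i h1 h2).symm
  have h2 := gapCountP_le_add p hy hxy
  rw [abs_le]
  constructor <;> linarith

/-- As a' ≤ b', the difference is ((a - a') - (a' / b')(b - b')) / b with a' / b' in [0, 1]. The
case b' = 0 is consistent, since then a' = 0. -/
theorem abs_div_sub_div_le {a b a' b' D : ℝ} (ha' : 0 ≤ a') (hb : 0 < b)
    (hab' : a' ≤ b') (h1 : |a - a'| ≤ D) (h2 : |b - b'| ≤ D) : |a / b - a' / b'| ≤ 2 * D / b := by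
  have hq0 : 0 ≤ a' / b' := div_nonneg ha' (ha'.trans hab')
  have hq1 : a' / b' ≤ 1 := div_le_one_of_le₀ hab' (ha'.trans hab')
  have hq : a' / b' * b' = a' := by
    rcases eq_or_ne b' 0 with h | h
    · rw [h, mul_zero]; linarith
    · exact div_mul_cancel₀ _ h
  have h3 : a / b - a' / b' = ((a - a') - a' / b' * (b - b')) / b := by
    rw [mul_sub, hq]; field_simp; ring
  rw [h3, abs_div, abs_of_pos hb]
  refine div_le_div_of_nonneg_right ?_ hb.le
  calc |a - a' - a' / b' * (b - b')| ≤ |a - a'| + |a' / b' * (b - b')| := abs_sub _ _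
    _ ≤ D + D := by
      refine add_le_add h1 ?_
      rw [abs_mul, abs_of_nonneg hq0]
      exact (mul_le_of_le_one_left (abs_nonneg _) hq1).trans h2
    _ = 2 * D := by ring

/-! ### Infinitely many summands -/

/-- The zero sequence is null because its prefixes have weight tending to 0; by stationarity so is
each event that all digits from k on vanish. -/
theorem IsCanonical.ae_exists_ne_zero {μ : Measure (ℕ → ℕ)} (hb : 1 < lam)
    (hμ : IsCanonical Z lam μ) : ∀ᵐ x ∂μ, ∀ k, ∃ i ≥ k, x i ≠ 0 := by
  have := hμ.isProbability
  rw [ae_all_iff]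
  intro k
  obtain ⟨c, C, -, hC, -⟩ := hμ.weight
  have h0 : μ {x | ∀ i, x i = 0} = 0 := by
    have hsub : ∀ n, {x : ℕ → ℕ | ∀ i, x i = 0} ⊆ prefixCylinder (0 : Fin n → ℕ) :=
      fun n x hx t => hx t
    have h1 : ∀ n, μ.real {x | ∀ i, x i = 0} ≤ C * (lam ^ n)⁻¹ := fun n =>
      (measureReal_mono (hsub n)).trans (hC n 0)
    have h2 := ge_of_tendsto' ((tendsto_inv_pow hb).const_mul C) h1
    rw [mul_zero] at h2
    exact (measureReal_eq_zero_iff (measure_ne_top _ _)).1 (le_antisymm h2 measureReal_nonneg)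
  have hs : MeasurePreserving (fun (x : ℕ → ℕ) i => x (i + 1)) μ μ :=
    ⟨measurable_seqTail, hμ.stationary⟩
  have hiter : ∀ (k : ℕ) (x : ℕ → ℕ), (fun (x : ℕ → ℕ) i => x (i + 1))^[k] x = fun i => x (i + k) := by
    intro k
    induction k with
    | zero => intro x; rfl
    | succ k ih =>
      intro x
      rw [Function.iterate_succ_apply, ih]
      funext i
      congr 1
  have h3 := (hs.iterate k).quasiMeasurePreserving.preimage_null h0
  rw [measure_eq_zero_iff_ae_notMem] at h3
  filter_upwards [h3] with x hx
  rw [Set.mem_preimage, hiter] at hx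
  by_contra! hne
  exact hx fun i => hne _ (Nat.le_add_left k i)

/-- The events that few summands occur among the first positions decrease, and their intersection is
null since there are almost surely infinitely many summands. This keeps the denominator of the gap
frequency large. -/
theorem IsCanonical.tendsto_gapTotal_lt {μ : Measure (ℕ → ℕ)} (hb : 1 < lam)
    (hμ : IsCanonical Z lam μ) (R : ℝ) :
    Tendsto (fun n => μ {x | gapTotal n x < R}) atTop (𝓝 0) := by
  have := hμ.isProbability
  set s : ℕ → Set (ℕ → ℕ) := fun n => {x | ∑ i ∈ Finset.range (n + 1), x i < ⌈R⌉₊ + 1} with hs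
  have hanti : Antitone s := fun m n hmn x hx =>
    (Finset.sum_le_sum_of_subset (f := x) (Finset.range_mono (by omega))).trans_lt hx
  have hmeas : ∀ n, MeasurableSet (s n) := fun n =>
    measurableSet_of_forall_eq (n + 1) fun x y h hx => by
      simp only [hs, Set.mem_ofPred_eq] at hx ⊢
      rwa [← Finset.sum_congr rfl fun i hi => h i (Finset.mem_range.1 hi)]
  have h1 := tendsto_measure_iInter_atTop (μ := μ) (fun n => (hmeas n).nullMeasurableSet) hanti
    ⟨0, measure_ne_top _ _⟩
  have h2 : μ (⋂ n, s n) = 0 := by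
    rw [measure_eq_zero_iff_ae_notMem]
    filter_upwards [hμ.ae_exists_ne_zero hb] with x hx hxs
    rw [Set.mem_iInter] at hxs
    have h3 : Summable fun i => (x i : ℝ) := by
      refine summable_of_sum_range_le (c := ⌈R⌉₊ + 1) (fun _ => Nat.cast_nonneg _) fun n => ?_
      have h4 : ∑ i ∈ Finset.range n, x i ≤ ⌈R⌉₊ + 1 :=
        (Finset.sum_le_sum_of_subset (Finset.range_mono (Nat.le_succ n))).trans (hxs n).le
      exact_mod_cast h4
    obtain ⟨k, hk⟩ := eventually_atTop.1 (h3.tendsto_atTop_zero.eventually_lt_const one_pos)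
    obtain ⟨i, hi, hne⟩ := hx k
    have h5 := hk i hi
    rw [Nat.cast_lt_one] at h5
    exact hne h5
  rw [h2] at h1
  refine tendsto_of_tendsto_of_tendsto_of_le_of_le tendsto_const_nhds h1 (fun _ => zero_le)
    fun n => measure_mono fun x hx => ?_
  simp only [hs, Set.mem_ofPred_eq] at hx ⊢
  rw [gapTotal_eq_sum_sub, ← Nat.lt_ceil] at hx
  omega

theorem IsCanonical.boundaryInsensitive_gap {μ : Measure (ℕ → ℕ)} (hb : 1 < lam)
    (hμ : IsCanonical Z lam μ) {B₀ : ℕ} (hB : ∀ᵐ x ∂μ, ∀ i, x i ≤ B₀) (g : ℕ) :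
    BoundaryInsensitive μ fun n x => gapCount g n x / gapTotal n x := by
  intro B K ε hε
  set D : ℝ := 2 * K * (max B B₀ : ℕ)
  have hD0 : 0 ≤ D := by positivity
  set R : ℝ := 2 * D / ε + 1
  have hR0 : 0 < R := by positivity
  refine tendsto_of_tendsto_of_tendsto_of_le_of_le tendsto_const_nhds
    (hμ.tendsto_gapTotal_lt hb R) (fun _ => zero_le) fun n => measure_mono_ae ?_
  filter_upwards [hB] with x hx
  rintro ⟨y, hy, hxy, hd⟩
  by_contra hlt
  have hge : R ≤ gapTotal n x := not_lt.1 hlt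
  have hx' : ∀ i, x i ≤ max B B₀ := fun i => (hx i).trans (le_max_right _ _)
  have hy' : ∀ i, y i ≤ max B B₀ := fun i => (hy i).trans (le_max_left _ _)
  have h1 := abs_gapCountP_sub_le (fun k => k == g) hx' hy' hxy
  have h2 := abs_gapCountP_sub_le (fun _ => true) hx' hy' hxy
  rw [← gapCount_eq] at h1
  rw [← gapTotal_eq] at h2
  have h3 := abs_div_sub_div_le (gapCountP_nonneg _ n y) (hR0.trans_le hge)
    (gapCountP_le_gapTotal (fun k => k == g) n y) h1 h2
  refine hd.not_ge (h3.trans ?_)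
  rw [div_le_iff₀ (hR0.trans_le hge), ← div_le_iff₀' hε]
  exact (le_add_of_nonneg_right zero_le_one).trans hge

/-! ### Expected numbers of gaps -/

/-- Discarding the ends costs a constant, and exchanging the measures costs η times the maximal
count (N + 1) B; both are small compared with N + 1. -/
theorem AgreeInMiddle.tendsto_integral_gapCountP_sub {P : ℕ → Measure (ℕ → ℕ)}
    {μ : Measure (ℕ → ℕ)} {B : ℕ} (h : AgreeInMiddle P μ B) (p : ℕ → Bool) :
    Tendsto (fun N : ℕ => (∫ x, gapCountP p N x ∂(P N) - ∫ x, gapCountP p N x ∂μ) / (N + 1))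
      atTop (𝓝 0) := by
  have hμ := h.isProbability
  rw [Metric.tendsto_nhds]
  intro δ hδ
  set η := δ / (2 * (B + 1)) with hη
  have hη0 : 0 < η := by positivity
  have hηB : η * B < δ / 2 := by
    rw [hη, div_mul_eq_mul_div, div_lt_div_iff₀ (by positivity) (by norm_num)]
    nlinarith
  obtain ⟨K, hK⟩ := h.close η hη0
  set D : ℝ := 2 * K * B
  have hlim : Tendsto (fun N : ℕ => 2 * D / ((N : ℝ) + 1)) atTop (𝓝 0) :=
    tendsto_const_nhds.div_atTop (tendsto_atTop_add_const_right _ _ tendsto_natCast_atTop_atTop)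
  filter_upwards [h.eventually_isProbability, hK K le_rfl, hlim.eventually_lt_const (half_pos hδ)]
    with N hP hA hN
  have hN0 : (0 : ℝ) < N + 1 := by positivity
  have key : ∀ (ρ : Measure (ℕ → ℕ)) [IsProbabilityMeasure ρ], (∀ᵐ x ∂ρ, ∀ i, x i ≤ B) →
      |∫ x, gapCountP p N x ∂ρ - ∫ x, gapCountP p N (middle K N x) ∂ρ| ≤ D := by
    intro ρ _ hρ
    have hi1 : Integrable (gapCountP p N) ρ :=
      Integrable.of_bound (measurable_gapCountP p N).aestronglyMeasurable ((N + 1) * B : ℕ) (by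
        filter_upwards [hρ] with x hx
        rw [Real.norm_eq_abs, abs_of_nonneg (gapCountP_nonneg _ _ _)]
        exact gapCountP_le p N hx)
    have hi2 : Integrable (fun x => gapCountP p N (middle K N x)) ρ :=
      Integrable.of_bound (measurable_comp_middle _ K N).aestronglyMeasurable ((N + 1) * B : ℕ) (by
        filter_upwards [hρ] with x hx
        rw [Real.norm_eq_abs, abs_of_nonneg (gapCountP_nonneg _ _ _)]
        exact gapCountP_le p N (middle_le hx))
    rw [← integral_sub hi1 hi2, ← Real.norm_eq_abs]
    have h1 : ∀ᵐ x ∂ρ, ‖gapCountP p N x - gapCountP p N (middle K N x)‖ ≤ D := by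
      filter_upwards [hρ] with x hx
      exact abs_gapCountP_sub_le p hx (middle_le hx) fun i h1 h2 => middle_apply x h1 h2
    simpa using norm_integral_le_of_norm_le_const h1
  have h1 := abs_le.1 (key (P N) (h.bounded_left N))
  have h2 := abs_le.1 (key μ h.bounded)
  have h3 := abs_le.1 (abs_integral_middle_sub_le (κ := P N) (μ := μ)
    (Nat.cast_nonneg ((N + 1) * B)) hA (gapCountP_nonneg p N)
    ((h.bounded_left N).mono fun x hx => gapCountP_le p N (middle_le hx))
    (h.bounded.mono fun x hx => gapCountP_le p N (middle_le hx)))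
  push_cast at h3
  rw [div_lt_iff₀ hN0] at hN
  have h4 : η * ((N + 1) * B) < δ / 2 * (N + 1) := by nlinarith
  rw [Real.dist_eq, sub_zero, abs_div, abs_of_pos hN0, div_lt_iff₀ hN0, abs_lt]
  constructor <;> linarith

/-- There is one gap less than summands, up to the truncation at 0, and by stationarity the expected
number of summands is (n + 1) times the mean of the first digit. A zero mean would make all digits
vanish. -/
theorem IsCanonical.exists_tendsto_integral_gapTotal {μ : Measure (ℕ → ℕ)} (hb : 1 < lam)
    (hμ : IsCanonical Z lam μ) {B : ℕ} (hB : ∀ᵐ x ∂μ, ∀ i, x i ≤ B) :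
    ∃ m : ℝ, 0 < m ∧
      Tendsto (fun n : ℕ => (∫ x, gapTotal n x ∂μ) / (n + 1)) atTop (𝓝 m) := by
  have := hμ.isProbability
  have hi : ∀ i, Integrable (fun x : ℕ → ℕ => (x i : ℝ)) μ := fun i =>
    Integrable.of_bound ((measurable_of_countable fun k : ℕ => (k : ℝ)).comp
      (measurable_pi_apply i)).aestronglyMeasurable B (by
        filter_upwards [hB] with x hx
        rw [Real.norm_natCast]
        exact_mod_cast hx i)
  have hconst : ∀ i, ∫ x, (x i : ℝ) ∂μ = ∫ x, (x 0 : ℝ) ∂μ := by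
    intro i
    induction i with
    | zero => rfl
    | succ i ih =>
      rw [← ih]
      nth_rewrite 2 [← hμ.stationary]
      rw [integral_map measurable_seqTail.aemeasurable]
      exact ((measurable_of_countable fun k : ℕ => (k : ℝ)).comp
        (measurable_pi_apply i)).aestronglyMeasurable
  have hm0 : 0 ≤ ∫ x, (x 0 : ℝ) ∂μ := integral_nonneg fun x => Nat.cast_nonneg _
  refine ⟨∫ x, (x 0 : ℝ) ∂μ, lt_of_le_of_ne hm0 fun h0 => ?_, ?_⟩
  · have h1 : ∀ᵐ x ∂μ, ∀ i, x i = 0 := by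
      rw [ae_all_iff]
      intro i
      have h2 := hconst i
      rw [← h0, integral_eq_zero_iff_of_nonneg (fun x => Nat.cast_nonneg _) (hi i)] at h2
      filter_upwards [h2] with x hx
      have hx' : (x i : ℝ) = 0 := hx
      exact_mod_cast hx'
    obtain ⟨x, hx1, hx2⟩ := (h1.and (hμ.ae_exists_ne_zero hb)).exists
    obtain ⟨i, -, hne⟩ := hx2 0
    exact hne (hx1 i)
  · set m := ∫ x, (x 0 : ℝ) ∂μ
    have hsum : ∀ n : ℕ, ∫ x, ∑ i ∈ Finset.range (n + 1), (x i : ℝ) ∂μ = (n + 1) * m := fun n => by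
      rw [integral_finsetSum _ fun i _ => hi i, Finset.sum_congr rfl fun i _ => hconst i,
        Finset.sum_const, Finset.card_range, nsmul_eq_mul]
      push_cast
      rfl
    have hle : ∀ (n : ℕ) (x : ℕ → ℕ), gapTotal n x ≤ ∑ i ∈ Finset.range (n + 1), (x i : ℝ) := by
      intro n x
      rw [gapTotal_eq_sum_sub]
      exact_mod_cast Nat.sub_le _ _
    have hge : ∀ (n : ℕ) (x : ℕ → ℕ),
        ∑ i ∈ Finset.range (n + 1), (x i : ℝ) - 1 ≤ gapTotal n x := by
      intro n x
      rw [gapTotal_eq_sum_sub, sub_le_iff_le_add]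
      have : ∑ i ∈ Finset.range (n + 1), x i ≤ (∑ i ∈ Finset.range (n + 1), x i - 1) + 1 := by omega
      exact_mod_cast this
    have hsi : ∀ n : ℕ, Integrable (fun x : ℕ → ℕ => ∑ i ∈ Finset.range (n + 1), (x i : ℝ)) μ :=
      fun n => integrable_finsetSum _ fun i _ => hi i
    have hgi : ∀ n : ℕ, Integrable (gapTotal n) μ := fun n => by
      refine (hsi n).mono' ?_ (Eventually.of_forall fun x => ?_)
      · rw [gapTotal_eq]; exact (measurable_gapCountP _ n).aestronglyMeasurable
      · rw [Real.norm_eq_abs, abs_of_nonneg (Nat.cast_nonneg _)]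
        exact hle n x
    have h1 : ∀ n : ℕ, ∫ x, gapTotal n x ∂μ ≤ (n + 1) * m := fun n =>
      (integral_mono (hgi n) (hsi n) (hle n)).trans (hsum n).le
    have h2 : ∀ n : ℕ, (n + 1) * m - 1 ≤ ∫ x, gapTotal n x ∂μ := fun n => by
      refine le_trans (le_of_eq ?_)
        (integral_mono ((hsi n).sub (integrable_const 1)) (hgi n) (hge n))
      simp only [Pi.sub_apply]
      rw [integral_sub (hsi n) (integrable_const 1), hsum]
      simp
    have hlim : Tendsto (fun n : ℕ => m - 1 / ((n : ℝ) + 1)) atTop (𝓝 (m - 0)) :=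
      tendsto_one_div_add_atTop_nhds_zero_nat.const_sub m
    rw [sub_zero] at hlim
    refine tendsto_of_tendsto_of_tendsto_of_le_of_le hlim tendsto_const_nhds (fun n => ?_)
      fun n => ?_
    · have : (0 : ℝ) < n + 1 := by positivity
      simp only
      rw [le_div_iff₀ this, sub_mul, one_div_mul_cancel this.ne']
      linarith [h2 n]
    · have : (0 : ℝ) < n + 1 := by positivity
      simp only
      rw [div_le_iff₀ this]
      linarith [h1 n]

theorem AgreeInMiddle.tendsto_integral_gap_div {P : ℕ → Measure (ℕ → ℕ)}
    {μ : Measure (ℕ → ℕ)} {B : ℕ} (h : AgreeInMiddle P μ B) (hb : 1 < lam)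
    (hμ : IsCanonical Z lam μ) {g : ℕ} {p : ℝ}
    (hp : Tendsto (fun n => (∫ x, gapCount g n x ∂μ) / ∫ x, gapTotal n x ∂μ) atTop (𝓝 p)) :
    Tendsto (fun n => (∫ x, gapCount g n x ∂(P n)) / ∫ x, gapTotal n x ∂(P n)) atTop (𝓝 p) := by
  obtain ⟨m, hm, hlim⟩ := hμ.exists_tendsto_integral_gapTotal hb h.bounded
  have h1 := h.tendsto_integral_gapCountP_sub fun k => k == g
  have h2 := h.tendsto_integral_gapCountP_sub fun _ => true
  rw [← gapCount_eq] at h1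
  rw [← gapTotal_eq] at h2
  have h3 := ((hp.mul hlim).add h1).div (hlim.add h2) (by linarith)
  simp only [add_zero] at h3
  rw [mul_div_cancel_right₀ p hm.ne'] at h3
  refine h3.congr' ?_
  filter_upwards [hlim.eventually_const_lt hm] with n hn
  have hn0 : (0 : ℝ) < n + 1 := by positivity
  have hne : ∫ x, gapTotal n x ∂μ ≠ 0 := fun h0 => by rw [h0, zero_div] at hn; exact lt_irrefl _ hn
  simp only [Pi.div_apply]
  rw [div_mul_div_cancel₀ hne, ← add_div, ← add_div, add_sub_cancel, add_sub_cancel,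
    div_div_div_cancel_right₀ hn0.ne']

end

end ZLRR

end

theorem mainTheorem8 (E : LinearRecurrence ℤ) (Z : ℕ → ℕ) (lam : ℝ)
    (hZ : ZLRR.IsZLRR E Z) (hlam : ZLRR.IsDominantRoot E Z lam) :
    -- the canonical ensemble exists and is unique
    (∃! μ : Measure (ℕ → ℕ), ZLRR.IsCanonical Z lam μ) ∧
    ∀ μ : Measure (ℕ → ℕ), ZLRR.IsCanonical Z lam μ →
      -- limit laws of arbitrary statistics that do not depend on the two ends
      (∀ (S : Type*) [MetricSpace S] [MeasurableSpace S] [BorelSpace S]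
        (T : ℕ → (ℕ → ℕ) → S) (ν : Measure S) [IsProbabilityMeasure ν],
        (∀ n, Measurable (T n)) → ZLRR.BoundaryInsensitive μ T →
        ZLRR.ConvergesInLaw (fun _ => μ) T ν →
        ZLRR.ConvergesInLaw (ZLRR.microcanonical Z) T ν) ∧
      -- limit laws of normalized sums of a local statistic, such as the central limit theorem
      (∀ (L : ℕ) (f : (Fin L → ℕ) → ℝ) (a b : ℕ → ℝ) (ν : Measure ℝ) [IsProbabilityMeasure ν],
        Tendsto b atTop atTop →
        ZLRR.ConvergesInLaw (fun _ => μ) (fun n x => (ZLRR.localSum f n x - a n) / b n) ν →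
        ZLRR.ConvergesInLaw (ZLRR.microcanonical Z)
          (fun n x => (ZLRR.localSum f n x - a n) / b n) ν) ∧
      -- law of large numbers for a local statistic
      (∀ (L : ℕ) (f : (Fin L → ℕ) → ℝ) (c : ℝ),
        ZLRR.ConvergesInProb (fun _ => μ) (fun n x => ZLRR.localSum f n x / (n + 1)) c →
        ZLRR.ConvergesInProb (ZLRR.microcanonical Z)
          (fun n x => ZLRR.localSum f n x / (n + 1)) c) ∧
      -- gap distribution: empirical frequency of the gaps of length `g`
      (∀ (g : ℕ) (p : ℝ),
        ZLRR.ConvergesInProb (fun _ => μ)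
          (fun n x => ZLRR.gapCount g n x / ZLRR.gapTotal n x) p →
        ZLRR.ConvergesInProb (ZLRR.microcanonical Z)
          (fun n x => ZLRR.gapCount g n x / ZLRR.gapTotal n x) p) ∧
      -- gap distribution: proportion of the gaps of length `g` in the whole ensemble
      (∀ (g : ℕ) (p : ℝ),
        Tendsto (fun n => (∫ x, ZLRR.gapCount g n x ∂μ) / ∫ x, ZLRR.gapTotal n x ∂μ)
          atTop (𝓝 p) →
        Tendsto (fun n => (∫ x, ZLRR.gapCount g n x ∂(ZLRR.microcanonical Z n)) /
          ∫ x, ZLRR.gapTotal n x ∂(ZLRR.microcanonical Z n)) atTop (𝓝 p)) := by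
  refine ⟨⟨ZLRR.betaMeasure lam, ZLRR.isCanonical_betaMeasure hZ hlam,
    fun μ hμ => hμ.eq_betaMeasure hZ hlam⟩, fun μ hμ => ?_⟩
  -- By uniqueness, the comparison proved for `betaMeasure` applies to the given canonical ensemble.
  obtain rfl := hμ.eq_betaMeasure hZ hlam
  obtain ⟨B, hB⟩ := ZLRR.exists_agreeInMiddle hZ hlam
  have hb1 : Tendsto (fun n : ℕ => (n : ℝ) + 1) atTop atTop :=
    tendsto_atTop_add_const_right _ _ tendsto_natCast_atTop_atTop
  refine ⟨?_, ?_, ?_, ?_, ?_⟩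
  · intro S _ _ _ T ν _ hTm hT hlaw
    exact hB.convergesInLaw hTm hT hlaw
  · intro L f a b ν _ hb hlaw
    exact hB.convergesInLaw
      (fun n => ((ZLRR.measurable_localSum f n).sub_const _).div_const _)
      (ZLRR.boundaryInsensitive_localSum hB.bounded f a hb) hlaw
  · intro L f c hc
    have h := ZLRR.boundaryInsensitive_localSum hB.bounded f (fun _ => 0) hb1
    simp only [sub_zero] at h
    exact hB.convergesInProb h hc
  · intro g p hp
    exact hB.convergesInProb (hμ.boundaryInsensitive_gap hlam.one_lt hB.bounded g) hp
  · intro g p hp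
    exact hB.tendsto_integral_gap_div hlam.one_lt hμ hp
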